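/- Let $n\ge 1$, let $\mathbb D^n$ be the unit polydisc in $\mathbb C^n$, let $\alpha=(\alpha_1,\dots,\alpha_n)\in\mathbb R^n$ with $\alpha_j>-1$ for all $j$, and let $1<p<\infty$, $pq=p+q$. Let $dv_\alpha(z)=\prod_{j=1}^n(\alpha_j+1)(1-|z_j|^2)^{\alpha_j}\,d\nu(z_j)$, where $\nu$ is the area measure on the disc normalized to mass $1$, let $\|\cdot\|_{p,\alpha}$ be the norm of $L^p(\mathbb D^n,dv_\alpha)$, and let $A^p_\alpha=A^p_\alpha(\mathbb D^n)$ be the space of holomorphic functions in $L^p(\mathbb D^n,dv_\alpha)$. Put $K^\alpha(z,w)=\prod_{j=1}^n(1-z_j\bar w_j)^{-(\alpha_j+2)}$, $k^\alpha_w=K^\alpha(\cdot,w)/\|K^\alpha(\cdot,w)\|_{2,\alpha}$, $P_\alpha u(w)=\int_{\mathbb D^n}u(z)K^\alpha(w,z)\,dv_\alpha(z)$ and $T_\varphi u=P_\alpha(\varphi u)$ whenever $\varphi u\in L^1(dv_\alpha)$. For $f\in A^p_\alpha$ and $g\in A^q_\alpha$ the product $T_fT_{\bar g}$ is thus densely defined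 on $A^p_\alpha$ (its domain contains the bounded holomorphic functions); it is called bounded if it extends to a bounded operator on $A^p_\alpha$, which is then unique and again denoted by $T_fT_{\bar g}$. Put $$[f,g]_{p,\alpha}=\sup_{w\in\mathbb D^n}\|fk_w^\alpha\|_{p,\alpha}\,\|gk_w^\alpha\|_{q,\alpha},\qquad \eta=\inf_{z\in\mathbb D^n}|f(z)||g(z)|.$$ There is a constant $C$, depending only on $n$, $\alpha$ and $p$, such that for all $f\in A^p_\alpha$ and $g\in A^q_\alpha$ the following hold. (i) If $T_fT_{\bar g}$ is bounded and invertible on $A^p_\alpha$, then $[f,g]_{p,\alpha}<\infty$, and this condition is equivalent to $\eta>0$. (ii) If $[f,g]_{p,\alpha}<\infty$ and $\eta>0$, then $$[f]_{p,\alpha}:=\sup_{w\in\mathbb D^n}\|fk_w^\alpha\|_{p,\alpha}\,\|f^{-1}k_w^\alpha\|_{q,\alpha}\le\eta^{-2}[f,g]_{p,\alpha}^2,$$ $T_fT_{\bar g}$ is bounded and invertible on $A^p_\alpha$, and $$\|T_fT_{\bar g}\|\le C\,\eta^{-2n\max\{p,q\}}\,[f,g]_{p,\alpha}^{1+2n\max\{p,q\}}.$$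 -/

import Mathlib

open MeasureTheory
open scoped ENNReal NNReal ComplexConjugate

namespace PolydiscBergman

noncomputable section

/-- The probability measure `(a + 1) (1 - |z|²)^a dν(z)` on the unit disc of `ℂ`, where `ν` is
the area measure divided by `π`; it is a measure on `ℂ` that is carried by the disc. -/
def discMeasure (a : ℝ) : Measure ℂ :=
  (volume.restrict (Metric.ball (0 : ℂ) 1)).withDensity
    fun z => ENNReal.ofReal ((a + 1) / Real.pi * (1 - ‖z‖ ^ 2) ^ a)

variable {n : ℕ}

/-- The unit polydisc `𝔻ⁿ`. -/
def polydisc (n : ℕ) : Set (Fin n → ℂ) := {z | ∀ j, ‖z j‖ < 1}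

/-- The measure `dv_α(z) = ∏ⱼ (αⱼ + 1) (1 - |zⱼ|²)^{αⱼ} dν(zⱼ)`, carried by the polydisc. -/
def polydiscMeasure (α : Fin n → ℝ) : Measure (Fin n → ℂ) :=
  Measure.pi fun j => discMeasure (α j)

/-- The norm `‖f‖_{p,α} ∈ [0, ∞]`. -/
def bergmanNorm (α : Fin n → ℝ) (p : ℝ) (f : (Fin n → ℂ) → ℂ) : ℝ≥0∞ :=
  eLpNorm f (ENNReal.ofReal p) (polydiscMeasure α)

/-- `f ∈ A^p_α(𝔻ⁿ)`: `f` is holomorphic on the polydisc and in `L^p(dv_α)`.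
Values of `f` outside the polydisc play no role. -/
def MemBergman (α : Fin n → ℝ) (p : ℝ) (f : (Fin n → ℂ) → ℂ) : Prop :=
  DifferentiableOn ℂ f (polydisc n) ∧ MemLp f (ENNReal.ofReal p) (polydiscMeasure α)

/-- The Bergman space `A^p_α(𝔻ⁿ)` as a subspace of `L^p(dv_α)`, with the norm of `L^p(dv_α)`:
the classes that have a representative holomorphic on the polydisc. -/
def bergmanSpace (α : Fin n → ℝ) (p : ℝ) :
    Submodule ℂ (Lp ℂ (ENNReal.ofReal p) (polydiscMeasure α)) where
  carrier := {F | ∃ h : (Fin n → ℂ) → ℂ,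
    DifferentiableOn ℂ h (polydisc n) ∧ F =ᵐ[polydiscMeasure α] h}
  zero_mem' := ⟨0, differentiableOn_const 0, Lp.coeFn_zero _ _ _⟩
  add_mem' := by
    rintro F G ⟨h, hh, hF⟩ ⟨k, hk, hG⟩
    exact ⟨h + k, hh.add hk, (Lp.coeFn_add F G).trans (hF.add hG)⟩
  smul_mem' := by
    rintro c F ⟨h, hh, hF⟩
    exact ⟨c • h, hh.const_smul c, (Lp.coeFn_smul c F).trans (hF.const_smul c)⟩

/-- For `p > 1` the `L^p` seminorm is a norm. -/
instance factOneLeOfReal (p : ℝ) [hp : Fact (1 < p)] : Fact (1 ≤ ENNReal.ofReal p) :=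
  ⟨ENNReal.one_le_ofReal.2 hp.out.le⟩

/-- The reproducing kernel `K^α(z, w) = ∏ⱼ (1 - zⱼ w̄ⱼ)^{-(αⱼ + 2)}` (principal branch; for
`z, w` in the polydisc the base has positive real part). -/
def bergmanKernel (α : Fin n → ℝ) (z w : Fin n → ℂ) : ℂ :=
  ∏ j, 1 / (1 - z j * conj (w j)) ^ ((α j + 2 : ℝ) : ℂ)

/-- The normalized kernel `k_w^α(z) = K^α(z, w) / ‖K^α(·, w)‖_{2,α}`. -/
def normalizedKernel (α : Fin n → ℝ) (w z : Fin n → ℂ) : ℂ :=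
  bergmanKernel α z w / ((bergmanNorm α 2 fun ζ => bergmanKernel α ζ w).toReal : ℂ)

/-- The Bergman projection `P_α u(w) = ∫ u(z) K^α(w, z) dv_α(z)`. -/
def bergmanProjection (α : Fin n → ℝ) (u : (Fin n → ℂ) → ℂ) (w : Fin n → ℂ) : ℂ :=
  ∫ z, u z * bergmanKernel α w z ∂(polydiscMeasure α)

/-- The Toeplitz operator `T_φ u = P_α(φ u)`. -/
def toeplitz (α : Fin n → ℝ) (φ u : (Fin n → ℂ) → ℂ) : (Fin n → ℂ) → ℂ :=
  bergmanProjection α fun z => φ z * u z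

/-- `T_φ u` is defined: `φ u ∈ L¹(dv_α)`. (For `w` in the polydisc `K^α(w, ·)` is bounded on the
polydisc, so the integral that defines `T_φ u (w)` then converges.) -/
def ToeplitzDefined (α : Fin n → ℝ) (φ u : (Fin n → ℂ) → ℂ) : Prop :=
  Integrable (fun z => φ z * u z) (polydiscMeasure α)

/-- The bounded operator `S` on `A^p_α` is the Toeplitz product `T_f T_ḡ`: it agrees with
`h ↦ T_f (T_ḡ h)` at every `h ∈ A^p_α` for which the latter is defined. For `f ∈ A^p_α`,
`g ∈ A^q_α` these `h` include the bounded holomorphic functions and so are dense in `A^p_α`;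
thus `T_f T_ḡ` is bounded on `A^p_α` when such an `S` exists, and `S` is then unique. -/
def IsToeplitzProduct (α : Fin n → ℝ) (p : ℝ) [Fact (1 < p)] (f g : (Fin n → ℂ) → ℂ)
    (S : bergmanSpace α p →L[ℂ] bergmanSpace α p) : Prop :=
  ∀ h : bergmanSpace α p,
    ToeplitzDefined α (fun z => conj (g z)) (h : Lp ℂ (ENNReal.ofReal p) (polydiscMeasure α)) →
    ToeplitzDefined α f (toeplitz α (fun z => conj (g z))
      (h : Lp ℂ (ENNReal.ofReal p) (polydiscMeasure α))) →
    (S h : Lp ℂ (ENNReal.ofReal p) (polydiscMeasure α)) =ᵐ[polydiscMeasure α]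
      toeplitz α f (toeplitz α (fun z => conj (g z))
        (h : Lp ℂ (ENNReal.ofReal p) (polydiscMeasure α)))

/-- The quantity `[f, g]_{p,α} = sup_{w ∈ 𝔻ⁿ} ‖f k_w^α‖_{p,α} ‖g k_w^α‖_{q,α} ∈ [0, ∞]`. -/
def sarason (α : Fin n → ℝ) (p q : ℝ) (f g : (Fin n → ℂ) → ℂ) : ℝ≥0∞ :=
  ⨆ w ∈ polydisc n, bergmanNorm α p (fun z => f z * normalizedKernel α w z) *
    bergmanNorm α q (fun z => g z * normalizedKernel α w z)

/-- The quantity `[f]_{p,α} = sup_{w ∈ 𝔻ⁿ} ‖f k_w^α‖_{p,α} ‖f⁻¹ k_w^α‖_{q,α} ∈ [0, ∞]`. -/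
def invariantConst (α : Fin n → ℝ) (p q : ℝ) (f : (Fin n → ℂ) → ℂ) : ℝ≥0∞ :=
  sarason α p q f fun z => (f z)⁻¹

/-- The quantity `η = inf_{z ∈ 𝔻ⁿ} |f(z)| |g(z)|`. -/
def infProd (f g : (Fin n → ℂ) → ℂ) : ℝ≥0∞ :=
  ⨅ z ∈ polydisc n, ‖f z‖ₑ * ‖g z‖ₑ

end

end PolydiscBergman

open PolydiscBergman

/-! Sufficiency rests on a weighted bound for the positive operator with kernel `|K^α|`. If `f` is
holomorphic without zeros and `A` bounds the joint averages of `|f|^p` and `|f|^(-q)` over Carleson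
boxes, then `h ↦ |f| ∫ |K(·,w)| |f(w)|⁻¹ h(w)` has norm at most `C A^(2n max(p,q))` on `L^p`
(`exists_weighted_bound_polydisc`). In one variable put `B(x)` for the ball of radius `12(1-|x|)`
and `e(x) = (1-|x|)^(a+2)`. The kernel is dominated by the integral over `x` of `1_B(x)(z) 1_B(x)(w)
e(x)⁻²` (`exists_discKernel_le`). Paired with a test function, the operator becomes an integral of
products of two averages over `B(x)`, one for the measure `|f|^(-q) dv` and one for `|f|^p dv`. The
joint condition makes both measures doubling from `B(x)` to `5B(x)`, and a Vitali covering bounds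
the averages in `L^p` and `L^q`. Holomorphy enters through the sub-mean value property of `f` and
`1/f`, which compares the weights at `x` with their integrals over `B(x)`. In `n` variables the
kernel is a product and the same property passes the joint condition to slices, so induction applies
and each variable costs `A^(2 max(p,q))`. Since `|fg| ≤ c [f,g]` and `[f] ≤ η⁻¹ [f,g]`, the weighted
bound makes `S h = f P(ḡ h)` bounded with the stated norm. Its inverse is `R h = P(h / (f ḡ))`,
bounded because `|fg| ≥ η`; the identities `SR = RS = 1` follow from `P(ḡ P u) = P(ḡ u)` for
holomorphic `g` (`exists_invertible_toeplitzProduct`). For necessity of `[f,g] < ∞`, let `φ` be the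
involution of the polydisc attached to `w`. The Möbius identity gives `k_w(z) conj k_w(ζ) = ∏ (1 -
φ_j(z) conj φ_j(ζ))^(α_j+2) K(z,ζ)`. The binomial series of the power has absolutely summable
coefficients, so the rank-one operator `u ↦ ⟨u, g k_w⟩ f k_w` is a summable combination of operators
`φ^κ · S P (conj φ^κ · )`, bounded uniformly in `w`; its norm is `‖f k_w‖_p ‖g k_w‖_q`
(`IsToeplitzProduct.sarason_lt_top`). For `η > 0`, use `S k_w = conj g(w) f k_w` and evaluate `k_w =
f P(ḡ S⁻¹ k_w)` at `w`. Together they give `1 ≤ ‖S⁻¹‖² [f,g] |f(w) g(w)|`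
(`IsToeplitzProduct.infProd_pos`). So an invertible product satisfies both conditions, and the
equivalence in (i) holds with both sides true. -/

namespace PolydiscBergman

noncomputable section

/-! ### Real-variable tools: duality and centred averages over balls of prescribed radius -/

/-- An `L^p` bound from bounds on all pairings, on a finite measure space. -/
theorem lintegral_rpow_le_of_pairing {X : Type*} [MeasurableSpace X] {μ : Measure X}
    [IsFiniteMeasure μ] {p q : ℝ} (hpq : p.HolderConjugate q) {G : X → ℝ≥0∞} (hG : Measurable G)
    {N : ℝ≥0∞} (h : ∀ v : X → ℝ≥0∞, Measurable v →
      ∫⁻ x, G x * v x ∂μ ≤ N * (∫⁻ x, v x ^ q ∂μ) ^ (1 / q)) :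
    (∫⁻ x, G x ^ p ∂μ) ^ (1 / p) ≤ N := by
  have hp0 : 0 < p := hpq.pos
  have hq0 : 0 < q := hpq.symm.pos
  have hp1 : 0 < p - 1 := hpq.sub_one_pos
  -- Testing against `min(G,k)^(p-1)` gives `I ≤ N I^(1/q)`. Truncating at `k` makes `I` finite, so
  -- `I^(1/q)` can be cancelled; monotone convergence then removes the truncation.
  have key : ∀ k : ℕ, (∫⁻ x, (min (G x) k) ^ p ∂μ) ^ (1 / p) ≤ N := by
    intro k
    set I := ∫⁻ x, (min (G x) k) ^ p ∂μ with hI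
    have hIfin : I ≠ ∞ := by
      refine ne_top_of_le_ne_top (b := ∫⁻ _, (k : ℝ≥0∞) ^ p ∂μ) ?_
        (lintegral_mono fun x => ENNReal.rpow_le_rpow (min_le_right _ _) hp0.le)
      rw [lintegral_const]
      exact ENNReal.mul_ne_top (ENNReal.rpow_ne_top_of_nonneg hp0.le (ENNReal.natCast_ne_top k))
        (measure_ne_top _ _)
    have h1 := h (fun x => (min (G x) k) ^ (p - 1)) (by fun_prop)
    have h2 : I ≤ ∫⁻ x, G x * (min (G x) k) ^ (p - 1) ∂μ := by
      refine lintegral_mono fun x => ?_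
      calc (min (G x) (k : ℝ≥0∞)) ^ p = min (G x) (k : ℝ≥0∞) * (min (G x) k) ^ (p - 1) := by
            rcases eq_or_ne (min (G x) (k : ℝ≥0∞)) 0 with h0 | h0
            · rw [h0, ENNReal.zero_rpow_of_pos hp0, zero_mul]
            · have ht : min (G x) (k : ℝ≥0∞) ≠ ∞ :=
                ne_top_of_le_ne_top (ENNReal.natCast_ne_top k) (min_le_right _ _)
              nth_rewrite 2 [← ENNReal.rpow_one (min (G x) (k : ℝ≥0∞))]
              rw [← ENNReal.rpow_add _ _ h0 ht]; congr 1; ring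
        _ ≤ _ := by gcongr; exact min_le_left _ _
    have h3 : ∫⁻ x, ((min (G x) (k : ℝ≥0∞)) ^ (p - 1)) ^ q ∂μ = I := by
      refine lintegral_congr fun x => ?_
      rw [← ENNReal.rpow_mul, hpq.sub_one_mul_conj]
    rw [h3] at h1
    have h4 := h2.trans h1
    rcases eq_or_ne I 0 with h0 | h0
    · rw [h0, ENNReal.zero_rpow_of_pos (by positivity)]; exact zero_le
    · have h5 : I = I ^ (1 / p) * I ^ (1 / q) := by
        rw [← ENNReal.rpow_add _ _ h0 hIfin, one_div, one_div, hpq.inv_add_inv_eq_one,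
          ENNReal.rpow_one]
      rw [h5, ← h5] at h4
      nth_rewrite 1 [h5] at h4
      refine (ENNReal.mul_le_mul_iff_left ?_ ?_).1 h4
      · exact (ENNReal.rpow_pos (pos_iff_ne_zero.2 h0) hIfin).ne'
      · exact ENNReal.rpow_ne_top_of_nonneg (by positivity) hIfin
  have hlim : Filter.Tendsto (fun k : ℕ => (∫⁻ x, (min (G x) k) ^ p ∂μ) ^ (1 / p)) Filter.atTop
      (nhds ((∫⁻ x, G x ^ p ∂μ) ^ (1 / p))) := by
    refine (ENNReal.continuous_rpow_const.tendsto _).comp ?_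
    refine lintegral_tendsto_of_tendsto_of_monotone (fun k => by fun_prop) ?_ ?_
    · refine Filter.Eventually.of_forall fun x k l hkl => ?_
      exact ENNReal.rpow_le_rpow (min_le_min le_rfl (by exact_mod_cast hkl)) hp0.le
    · refine Filter.Eventually.of_forall fun x => ?_
      refine (ENNReal.continuous_rpow_const.tendsto _).comp ?_
      have := (tendsto_const_nhds (x := G x)).min ENNReal.tendsto_nat_nhds_top
      simpa using this
  exact le_of_tendsto' hlim key

/-- Weak type estimate for the centred maximal function over balls of prescribed radius. -/
theorem mul_measure_lt_setLIntegral_ball_le {X : Type*} [MetricSpace X]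
    [TopologicalSpace.SeparableSpace X] [MeasurableSpace X] [OpensMeasurableSpace X]
    {τ : Measure X} {r : X → ℝ} {R : ℝ} (hR : ∀ x, r x ≤ R) {D : ℝ≥0∞}
    (hD : ∀ x, 0 < r x → τ (Metric.ball x (5 * r x)) ≤ D * τ (Metric.ball x (r x)))
    (u : X → ℝ≥0∞) (t : ℝ≥0∞) :
    t * τ {x | 0 < r x ∧ t * τ (Metric.ball x (r x)) < ∫⁻ y in Metric.ball x (r x), u y ∂τ} ≤
      D * ∫⁻ y, u y ∂τ := by
  set E := {x | 0 < r x ∧ t * τ (Metric.ball x (r x)) < ∫⁻ y in Metric.ball x (r x), u y ∂τ} with hE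
  -- The `5` in `hD` is the enlargement factor of this covering lemma. Only one ball per centre
  -- occurs, so doubling is needed at the radius `r x` alone.
  obtain ⟨v, hvE, hdisj, hcov⟩ := Vitali.exists_disjoint_subfamily_covering_enlargement_ball
    E id r R (fun a _ => hR a) 5 (by norm_num)
  have hvc : v.Countable := by
    refine hdisj.countable_of_isOpen (fun x _ => Metric.isOpen_ball) fun x hx => ?_
    exact Metric.nonempty_ball.2 (hvE hx).1
  have hsub : E ⊆ ⋃ b ∈ v, Metric.ball b (5 * r b) := by
    intro a ha
    obtain ⟨b, hb, hab⟩ := hcov a ha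
    exact Set.mem_biUnion hb (hab (Metric.mem_ball_self ha.1))
  calc t * τ E ≤ t * ∑' b : v, τ (Metric.ball (b : X) (5 * r b)) := by
        gcongr
        exact (measure_mono hsub).trans (measure_biUnion_le _ hvc _)
    _ ≤ t * ∑' b : v, D * τ (Metric.ball (b : X) (r b)) := by
        gcongr with b; exact hD _ (hvE b.2).1
    _ = D * ∑' b : v, t * τ (Metric.ball (b : X) (r b)) := by
        rw [ENNReal.tsum_mul_left, ENNReal.tsum_mul_left]; ring
    _ ≤ D * ∑' b : v, ∫⁻ y in Metric.ball (b : X) (r b), u y ∂τ := by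
        gcongr with b; exact (hvE b.2).2.le
    _ = D * ∫⁻ y in ⋃ b ∈ v, Metric.ball b (r b), u y ∂τ := by
        congr 1
        exact (lintegral_biUnion hvc (fun b _ => Metric.isOpen_ball.measurableSet) hdisj _).symm
    _ ≤ D * ∫⁻ y, u y ∂τ := mul_le_mul_right (setLIntegral_le_lintegral _ _) _

/-- Inner integral of the layer cake computation: it is `∫₀ᵇ t^(p-2) dt`, which converges at `0`
because `p > 1`. -/
theorem lintegral_Ioi_indicator_rpow_le {p : ℝ} (hp : 1 < p) (b : ℝ≥0∞) :
    ∫⁻ t in Set.Ioi (0 : ℝ), (if ENNReal.ofReal t < b then ENNReal.ofReal (t ^ (p - 2)) else 0) ≤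
      ENNReal.ofReal (1 / (p - 1)) * b ^ (p - 1) := by
  have hp1 : 0 < p - 1 := by linarith
  rcases eq_or_ne b ∞ with rfl | hb
  · rw [ENNReal.top_rpow_of_pos hp1, ENNReal.mul_top]
    · exact le_top
    · simpa using hp
  · lift b to ℝ≥0 using hb
    have h1 : ∫⁻ t in Set.Ioi (0 : ℝ),
        (if ENNReal.ofReal t < (b : ℝ≥0∞) then ENNReal.ofReal (t ^ (p - 2)) else 0) ≤
        ∫⁻ t in Set.Ioc (0 : ℝ) b, ENNReal.ofReal (t ^ (p - 2)) := by
      rw [← lintegral_indicator measurableSet_Ioi, ← lintegral_indicator measurableSet_Ioc]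
      refine lintegral_mono fun t => ?_
      by_cases ht : 0 < t
      · rw [Set.indicator_of_mem (show t ∈ Set.Ioi (0 : ℝ) from ht)]
        split_ifs with h
        · rw [Set.indicator_of_mem]
          refine ⟨ht, ?_⟩
          rw [ENNReal.ofReal, ENNReal.coe_lt_coe, Real.toNNReal_lt_iff_lt_coe ht.le] at h
          exact h.le
        · exact zero_le
      · rw [Set.indicator_of_notMem (show t ∉ Set.Ioi (0 : ℝ) from ht)]; exact zero_le
    refine h1.trans ?_
    rw [← ofReal_integral_eq_lintegral_ofReal, ← intervalIntegral.integral_of_le b.coe_nonneg,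
      integral_rpow (Or.inl (by linarith)), show p - 2 + 1 = p - 1 by ring,
      Real.zero_rpow hp1.ne', sub_zero, ← ENNReal.ofReal_coe_nnreal,
      ENNReal.ofReal_rpow_of_nonneg b.coe_nonneg hp1.le, ← ENNReal.ofReal_mul (by positivity)]
    · apply le_of_eq; congr 1; ring
    · have := intervalIntegral.intervalIntegrable_rpow' (a := 0) (b := b) (r := p - 2) (by linarith)
      exact (intervalIntegrable_iff_integrableOn_Ioc_of_le b.2).1 this
    · refine (ae_restrict_iff' measurableSet_Ioc).2 (Filter.Eventually.of_forall fun t ht => ?_)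
      exact Real.rpow_nonneg ht.1.le _

/-- Strong type estimate for the centred maximal function over balls of prescribed radius, with
the dependence on the doubling constant `D`. -/
theorem lintegral_average_ball_rpow_le {X : Type*} [MetricSpace X]
    [TopologicalSpace.SeparableSpace X] [MeasurableSpace X] [OpensMeasurableSpace X]
    {τ : Measure X} [SFinite τ] {r : X → ℝ} {R : ℝ} (hR : ∀ x, r x ≤ R) {D : ℝ≥0∞}
    (hD : ∀ x, 0 < r x → τ (Metric.ball x (5 * r x)) ≤ D * τ (Metric.ball x (r x)))
    (h0 : ∀ x, 0 < r x → τ (Metric.ball x (r x)) ≠ 0)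
    (htop : ∀ x, 0 < r x → τ (Metric.ball x (r x)) ≠ ∞)
    (hpos : ∀ᵐ x ∂τ, 0 < r x) {p q : ℝ} (hpq : p.HolderConjugate q) {u M : X → ℝ≥0∞}
    (hu : Measurable u) (hM : Measurable M)
    (hMdef : ∀ x, 0 < r x →
      M x = (τ (Metric.ball x (r x)))⁻¹ * ∫⁻ y in Metric.ball x (r x), u y ∂τ) :
    ∫⁻ x, M x ^ p ∂τ ≤ ENNReal.ofReal (2 ^ p * q) * D * ∫⁻ x, u x ^ p ∂τ := by
  have hp0 : 0 < p := hpq.pos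
  have hq0 : 0 < q := hpq.symm.pos
  have hp1 : 0 < p - 1 := hpq.sub_one_pos
  -- With `0 * ∞ = 0` the bound is not automatic here: `D = 0` has to be excluded, and it forces `τ
  -- = 0`.
  rcases eq_or_ne (∫⁻ x, u x ^ p ∂τ) ∞ with hinf | hfin
  · rcases eq_or_ne D 0 with hD0 | hD0
    · have hz : ∀ᵐ x ∂τ, False := by
        filter_upwards [hpos] with x hx
        have := hD x hx
        rw [hD0, zero_mul] at this
        refine h0 x hx (le_antisymm ((measure_mono ?_).trans this) zero_le)
        exact Metric.ball_subset_ball (by linarith)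
      have hτ : τ = 0 := by simpa using hz
      simp [hτ]
    · rw [hinf, ENNReal.mul_top]
      · exact le_top
      · refine mul_ne_zero ?_ hD0
        rw [ne_eq, ENNReal.ofReal_eq_zero, not_le]; positivity
  have hMfin : ∀ x, 0 < r x → M x ≠ ∞ := by
    intro x hx
    rw [hMdef x hx]
    refine ENNReal.mul_ne_top (ENNReal.inv_ne_top.2 (h0 x hx)) ?_
    have := ENNReal.lintegral_mul_le_Lp_mul_Lq (τ.restrict (Metric.ball x (r x))) hpq
      hu.aemeasurable (aemeasurable_const (b := (1 : ℝ≥0∞)))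
    simp only [Pi.mul_apply, mul_one, ENNReal.one_rpow, lintegral_const,
      Measure.restrict_apply MeasurableSet.univ, Set.univ_inter, one_mul] at this
    refine ne_top_of_le_ne_top (ENNReal.mul_ne_top ?_ ?_) this
    · refine ENNReal.rpow_ne_top_of_nonneg (by positivity) ?_
      exact ne_top_of_le_ne_top hfin (setLIntegral_le_lintegral _ _)
    · exact ENNReal.rpow_ne_top_of_nonneg (by positivity) (htop x hx)
  -- Marcinkiewicz splitting: the part of `u` that is at most `t/2` has averages at most `t/2`, so
  -- `M > t` forces the average of the remaining part `u₁` above `t/2`.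
  have hweak : ∀ t : ℝ, 0 < t → τ {x | t < (M x).toReal} ≤ 2 * D * ENNReal.ofReal t⁻¹ *
      ∫⁻ x, (if ENNReal.ofReal t < 2 * u x then u x else 0) ∂τ := by
    intro t ht
    set u₁ : X → ℝ≥0∞ := fun x => if ENNReal.ofReal t < 2 * u x then u x else 0 with hu₁
    have hu₁m : Measurable u₁ :=
      Measurable.ite (measurableSet_lt measurable_const (by fun_prop)) hu measurable_const
    have hle : ∀ x, u x ≤ u₁ x + ENNReal.ofReal (t / 2) := by
      intro x
      simp only [hu₁]
      split_ifs with h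
      · exact le_self_add
      · rw [zero_add, ENNReal.ofReal_div_of_pos two_pos,
          ENNReal.le_div_iff_mul_le (by norm_num) (by norm_num)]
        rw [mul_comm]; simpa using h
    have hw := mul_measure_lt_setLIntegral_ball_le hR hD u₁ (ENNReal.ofReal (t / 2))
    have hsub : τ {x | t < (M x).toReal} ≤ τ {x | 0 < r x ∧ ENNReal.ofReal (t / 2) *
        τ (Metric.ball x (r x)) < ∫⁻ y in Metric.ball x (r x), u₁ y ∂τ} := by
      refine measure_mono_ae ?_
      filter_upwards [hpos] with x hx hxt
      refine ⟨hx, ?_⟩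
      by_contra hcon
      rw [not_lt] at hcon
      have hxt' : ENNReal.ofReal t < M x := by
        rwa [ENNReal.ofReal_lt_iff_lt_toReal ht.le (hMfin x hx)]
      refine absurd hxt' (not_lt.2 ?_)
      rw [hMdef x hx, mul_comm, ← div_eq_mul_inv,
        ENNReal.div_le_iff (h0 x hx) (htop x hx)]
      calc ∫⁻ y in Metric.ball x (r x), u y ∂τ
          ≤ ∫⁻ y in Metric.ball x (r x), (u₁ y + ENNReal.ofReal (t / 2)) ∂τ :=
            lintegral_mono hle
        _ = (∫⁻ y in Metric.ball x (r x), u₁ y ∂τ) +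
            ENNReal.ofReal (t / 2) * τ (Metric.ball x (r x)) := by
            rw [lintegral_add_left hu₁m, setLIntegral_const]
        _ ≤ ENNReal.ofReal (t / 2) * τ (Metric.ball x (r x)) +
            ENNReal.ofReal (t / 2) * τ (Metric.ball x (r x)) := by gcongr
        _ = ENNReal.ofReal t * τ (Metric.ball x (r x)) := by
            rw [← add_mul, ← ENNReal.ofReal_add (by positivity) (by positivity)]; simp
    have hc : 2 * ENNReal.ofReal t⁻¹ * ENNReal.ofReal (t / 2) = 1 := by
      rw [show (2 : ℝ≥0∞) = ENNReal.ofReal 2 by simp, ← ENNReal.ofReal_mul (by norm_num),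
        ← ENNReal.ofReal_mul (by positivity)]
      rw [show 2 * t⁻¹ * (t / 2) = 1 by field_simp]; simp
    calc τ {x | t < (M x).toReal}
        = 2 * ENNReal.ofReal t⁻¹ * (ENNReal.ofReal (t / 2) * τ {x | t < (M x).toReal}) := by
          rw [← mul_assoc, hc, one_mul]
      _ ≤ 2 * ENNReal.ofReal t⁻¹ * (D * ∫⁻ y, u₁ y ∂τ) :=
          mul_le_mul_right ((mul_le_mul_right hsub _).trans hw) _
      _ = _ := by ring
  have h1 : ∫⁻ x, M x ^ p ∂τ = ∫⁻ x, ENNReal.ofReal ((M x).toReal ^ p) ∂τ := by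
    refine lintegral_congr_ae ?_
    filter_upwards [hpos] with x hx
    rw [← ENNReal.ofReal_rpow_of_nonneg ENNReal.toReal_nonneg hp0.le,
      ENNReal.ofReal_toReal (hMfin x hx)]
  rw [h1, lintegral_rpow_eq_lintegral_meas_lt_mul τ
    (Filter.Eventually.of_forall fun x => ENNReal.toReal_nonneg)
    (hM.ennreal_toReal.aemeasurable) hp0]
  -- The layer cake factor `t^(p-1)` times the weak-type factor `t⁻¹` leaves `t^(p-2)`. Tonelli then
  -- allows integrating in `t` first.
  set F : ℝ → X → ℝ≥0∞ := fun t x =>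
    u x * (if ENNReal.ofReal t < 2 * u x then ENNReal.ofReal (t ^ (p - 2)) else 0) with hF
  have hFm : Measurable (Function.uncurry F) := by
    refine (hu.comp measurable_snd).mul (Measurable.ite ?_ (by fun_prop) measurable_const)
    exact measurableSet_lt (by fun_prop) (by fun_prop)
  calc ENNReal.ofReal p * ∫⁻ t in Set.Ioi (0 : ℝ), τ {a | t < (M a).toReal} * ENNReal.ofReal (t ^ (p - 1))
      ≤ ENNReal.ofReal p * ∫⁻ t in Set.Ioi (0 : ℝ), 2 * D * ∫⁻ x, F t x ∂τ := by
        gcongr ENNReal.ofReal p * ?_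
        refine setLIntegral_mono' measurableSet_Ioi fun t ht => ?_
        have ht : 0 < t := ht
        refine (mul_le_mul_left (hweak t ht) _).trans (le_of_eq ?_)
        have h2 : ∫⁻ x, F t x ∂τ = ENNReal.ofReal (t ^ (p - 2)) *
            ∫⁻ x, (if ENNReal.ofReal t < 2 * u x then u x else 0) ∂τ := by
          rw [← lintegral_const_mul' _ _ ENNReal.ofReal_ne_top]
          refine lintegral_congr fun x => ?_
          simp only [hF]
          split_ifs
          · ring
          · simp
        rw [h2, show p - 1 = (p - 2) + 1 by ring, Real.rpow_add_one ht.ne', ENNReal.ofReal_mul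
          (by positivity)]
        have h3 : ENNReal.ofReal t⁻¹ * ENNReal.ofReal t = 1 := by
          rw [← ENNReal.ofReal_mul (by positivity), inv_mul_cancel₀ ht.ne']; simp
        calc _ = 2 * D * (ENNReal.ofReal (t ^ (p - 2)) *
            ∫⁻ x, (if ENNReal.ofReal t < 2 * u x then u x else 0) ∂τ) *
            (ENNReal.ofReal t⁻¹ * ENNReal.ofReal t) := by ring
          _ = _ := by rw [h3, mul_one]
    _ = ENNReal.ofReal p * (2 * D * ∫⁻ x, (∫⁻ t in Set.Ioi (0 : ℝ), F t x) ∂τ) := by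
        have hFm' : Measurable fun t => ∫⁻ x, F t x ∂τ := hFm.lintegral_prod_right'
        rw [lintegral_const_mul _ hFm', lintegral_lintegral_swap hFm.aemeasurable]
    _ ≤ ENNReal.ofReal p * (2 * D * ∫⁻ x, ENNReal.ofReal (1 / (p - 1) * 2 ^ (p - 1)) * u x ^ p ∂τ) := by
        gcongr with x
        simp only [hF]
        rw [lintegral_const_mul]
        · refine (mul_le_mul_right (lintegral_Ioi_indicator_rpow_le hpq.lt (2 * u x)) _).trans ?_
          rw [ENNReal.mul_rpow_of_nonneg _ _ hp1.le, ENNReal.ofReal_mul (by positivity),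
            ← ENNReal.ofReal_rpow_of_pos two_pos, ENNReal.ofReal_ofNat]
          have h4 : u x * u x ^ (p - 1) = u x ^ p := by
            nth_rewrite 1 [← ENNReal.rpow_one (u x)]
            rw [← ENNReal.rpow_add_of_nonneg _ _ zero_le_one hp1.le]; congr 1; ring
          rw [← h4]
          apply le_of_eq; ring
        · exact Measurable.ite (measurableSet_lt (by fun_prop) (by fun_prop)) (by fun_prop)
            measurable_const
    _ = _ := by
        rw [lintegral_const_mul _ (by fun_prop)]
        have h5 : ENNReal.ofReal (2 ^ p * q) =
            ENNReal.ofReal p * (2 * ENNReal.ofReal (1 / (p - 1) * 2 ^ (p - 1))) := by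
          rw [show (2 : ℝ≥0∞) = ENNReal.ofReal 2 by simp, ← ENNReal.ofReal_mul (by norm_num),
            ← ENNReal.ofReal_mul hp0.le]
          congr 1
          rw [hpq.conjugate_eq, Real.rpow_sub_one two_ne_zero]
          field_simp
        rw [h5]; ring

/-- For `q ≤ p` the `p`-th power of the left side of `h` is `a b^(p/q) = a b · b^(p-2)`, and the
surplus `b^(p-2)` is bounded below because `b ≥ 1/c`. The other case is symmetric. -/
theorem mul_le_rpow_max_of_rpow_mul_rpow_le {p q : ℝ} (hpq : p.HolderConjugate q)
    {a b c A : ℝ≥0∞} (hc : 1 ≤ c) (ha : 1 ≤ c * a) (hb : 1 ≤ c * b)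
    (h : a ^ (1 / p) * b ^ (1 / q) ≤ A) : a * b ≤ c ^ max p q * A ^ max p q := by
  wlog hle : q ≤ p generalizing p q a b
  · rw [max_comm, mul_comm a b]
    exact this hpq.symm hb ha (by rwa [mul_comm]) (not_le.1 hle).le
  have hp0 : 0 < p := hpq.pos
  have hq0 : 0 < q := hpq.symm.pos
  rw [max_eq_left hle]
  have h1 : p / q = 1 + (p - 2) := by rw [hpq.div_conj_eq_sub_one]; ring
  have h2 : 0 ≤ p - 2 := by
    have : 1 ≤ p / q := (one_le_div hq0).2 hle
    linarith
  have h3 : 1 ≤ (c * b) ^ (p - 2) := by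
    simpa using ENNReal.rpow_le_rpow hb h2
  calc a * b ≤ a * (b * (c * b) ^ (p - 2)) := by
        gcongr; exact le_mul_of_one_le_right' h3
    _ = c ^ (p - 2) * (a ^ (1 / p) * b ^ (1 / q)) ^ p := by
        rw [ENNReal.mul_rpow_of_nonneg _ _ h2, ENNReal.mul_rpow_of_nonneg _ _ hp0.le,
          ← ENNReal.rpow_mul, ← ENNReal.rpow_mul, one_div_mul_cancel hp0.ne', ENNReal.rpow_one,
          show 1 / q * p = 1 + (p - 2) by rw [← h1]; ring,
          ENNReal.rpow_add_of_nonneg _ _ zero_le_one h2, ENNReal.rpow_one]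
        ring
    _ ≤ c ^ p * A ^ p := by
        gcongr
        linarith

/-! ### Weight pairs and the weighted inequality for kernels dominated by ball averages -/

/-- A pair of reciprocal weights with the joint `A_p` type condition at scale `5 r`, where `e`
stands for the size of the balls of radius `r`. -/
structure IsWeightPair {X : Type*} [MetricSpace X] [MeasurableSpace X] (μ : Measure X)
    (r : X → ℝ) (e : X → ℝ≥0∞) (p q : ℝ) (c A : ℝ≥0∞) (W V : X → ℝ≥0∞) : Prop where
  measurable_left : Measurable W
  measurable_right : Measurable V
  mul_eq_one : ∀ x, 0 < r x → W x * V x = 1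
  le_left : ∀ x, 0 < r x → W x ^ p * e x ≤ c * ∫⁻ y in Metric.ball x (r x), W y ^ p ∂μ
  le_right : ∀ x, 0 < r x → V x ^ q * e x ≤ c * ∫⁻ y in Metric.ball x (r x), V y ^ q ∂μ
  le_mul : ∀ x, 0 < r x → (∫⁻ y in Metric.ball x (5 * r x), W y ^ p ∂μ) ^ (1 / p) *
    (∫⁻ y in Metric.ball x (5 * r x), V y ^ q ∂μ) ^ (1 / q) ≤ A * e x

section WeightPair

variable {X : Type*} [MetricSpace X] [MeasurableSpace X]
  {μ : Measure X} {r : X → ℝ} {e : X → ℝ≥0∞} {p q : ℝ} {c A : ℝ≥0∞} {W V : X → ℝ≥0∞}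

theorem IsWeightPair.symm (h : IsWeightPair μ r e p q c A W V) :
    IsWeightPair μ r e q p c A V W :=
  ⟨h.measurable_right, h.measurable_left, fun x hx => by rw [mul_comm, h.mul_eq_one x hx],
    h.le_right, h.le_left, fun x hx => by rw [mul_comm]; exact h.le_mul x hx⟩

/-- Hölder applied to `1 = W V` on the ball: the joint quantity is bounded below by the size of the
ball for free. -/
theorem IsWeightPair.le_rpow_mul_rpow (h : IsWeightPair μ r e p q c A W V)
    (hpq : p.HolderConjugate q) (hr : ∀ᵐ x ∂μ, 0 < r x)
    (he : ∀ x, 0 < r x → e x ≤ c * μ (Metric.ball x (r x))) {x : X} (hx : 0 < r x) :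
    e x ≤ c * ((∫⁻ y in Metric.ball x (r x), W y ^ p ∂μ) ^ (1 / p) *
      (∫⁻ y in Metric.ball x (r x), V y ^ q ∂μ) ^ (1 / q)) := by
  refine (he x hx).trans ?_
  gcongr
  refine le_trans (le_of_eq ?_) (ENNReal.lintegral_mul_le_Lp_mul_Lq _ hpq
    h.measurable_left.aemeasurable h.measurable_right.aemeasurable)
  rw [← setLIntegral_one]
  refine lintegral_congr_ae ?_
  filter_upwards [ae_restrict_of_ae hr] with y hy
  exact (h.mul_eq_one y hy).symm

theorem setLIntegral_ball_mono (μ : Measure X) {x : X} {r : ℝ} (hr : 0 < r) (F : X → ℝ≥0∞) :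
    ∫⁻ y in Metric.ball x r, F y ∂μ ≤ ∫⁻ y in Metric.ball x (5 * r), F y ∂μ :=
  lintegral_mono_set (Metric.ball_subset_ball (by linarith))

/-- The Hölder lower bound prevents either factor from vanishing at scale `r`; the upper bound at
scale `5 r` then keeps the other factor finite. -/
theorem IsWeightPair.pos_finite (h : IsWeightPair μ r e p q c A W V)
    (hpq : p.HolderConjugate q) (hr : ∀ᵐ x ∂μ, 0 < r x)
    (he : ∀ x, 0 < r x → e x ≤ c * μ (Metric.ball x (r x))) (he0 : ∀ x, 0 < r x → e x ≠ 0)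
    (het : ∀ x, e x ≠ ∞) (hA : A ≠ ∞) {x : X} (hx : 0 < r x) :
    ∫⁻ y in Metric.ball x (r x), W y ^ p ∂μ ≠ 0 ∧
      ∫⁻ y in Metric.ball x (5 * r x), W y ^ p ∂μ ≠ ∞ := by
  have h1 := h.le_rpow_mul_rpow hpq hr he hx
  have hne : (∫⁻ y in Metric.ball x (r x), W y ^ p ∂μ) ^ (1 / p) *
      (∫⁻ y in Metric.ball x (r x), V y ^ q ∂μ) ^ (1 / q) ≠ 0 := by
    intro h0
    rw [h0, mul_zero] at h1
    exact he0 x hx (le_antisymm h1 zero_le)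
  have hp0 := hpq.one_div_pos
  have hq0 := hpq.symm.one_div_pos
  refine ⟨fun h0 => hne ?_, fun h0 => ?_⟩
  · rw [h0, ENNReal.zero_rpow_of_pos hp0, zero_mul]
  · have h2 := h.le_mul x hx
    rw [h0, ENNReal.top_rpow_of_pos hp0, ENNReal.top_mul] at h2
    · exact (ENNReal.mul_ne_top hA (het x)) (top_le_iff.1 h2)
    · intro h3
      refine hne (mul_eq_zero_of_right _ (le_antisymm (le_trans ?_ h3.le) zero_le))
      exact ENNReal.rpow_le_rpow (setLIntegral_ball_mono μ hx _) hq0.le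

/-- Divide the upper bound at scale `5 r` by the Hölder lower bound at scale `r`. After enlarging
its ball, the `V` factor is common to both sides and cancels. This is why the joint condition is
imposed on the enlarged balls. -/
theorem IsWeightPair.doubling (h : IsWeightPair μ r e p q c A W V)
    (hpq : p.HolderConjugate q) (hr : ∀ᵐ x ∂μ, 0 < r x)
    (he : ∀ x, 0 < r x → e x ≤ c * μ (Metric.ball x (r x))) (he0 : ∀ x, 0 < r x → e x ≠ 0)
    (het : ∀ x, e x ≠ ∞) (hA : A ≠ ∞) {x : X} (hx : 0 < r x) :
    ∫⁻ y in Metric.ball x (5 * r x), W y ^ p ∂μ ≤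
      (c * A) ^ p * ∫⁻ y in Metric.ball x (r x), W y ^ p ∂μ := by
  have hp0 := hpq.one_div_pos
  have hq0 := hpq.symm.one_div_pos
  obtain ⟨h1, h2⟩ := h.symm.pos_finite hpq.symm hr he he0 het hA hx
  have h3 : (∫⁻ y in Metric.ball x (5 * r x), W y ^ p ∂μ) ^ (1 / p) *
      (∫⁻ y in Metric.ball x (5 * r x), V y ^ q ∂μ) ^ (1 / q) ≤
      c * A * (∫⁻ y in Metric.ball x (r x), W y ^ p ∂μ) ^ (1 / p) *
      (∫⁻ y in Metric.ball x (5 * r x), V y ^ q ∂μ) ^ (1 / q) := by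
    refine (h.le_mul x hx).trans ?_
    refine (mul_le_mul_right (h.le_rpow_mul_rpow hpq hr he hx) A).trans ?_
    rw [mul_assoc (c * A), mul_comm c A, mul_assoc A]
    gcongr A * (c * (_ * ?_))
    exact ENNReal.rpow_le_rpow (setLIntegral_ball_mono μ hx _) hq0.le
  have h4 := (ENNReal.mul_le_mul_iff_left (ENNReal.rpow_pos (pos_iff_ne_zero.2 fun h0 => h1
    (le_antisymm ((setLIntegral_ball_mono μ hx _).trans h0.le) zero_le)) h2).ne'
    (ENNReal.rpow_ne_top_of_nonneg hq0.le h2)).1 h3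
  have h5 := ENNReal.rpow_le_rpow h4 hpq.nonneg
  rwa [← ENNReal.rpow_mul, one_div_mul_cancel hpq.ne_zero, ENNReal.rpow_one,
    ENNReal.mul_rpow_of_nonneg _ _ hpq.nonneg, ← ENNReal.rpow_mul,
    one_div_mul_cancel hpq.ne_zero, ENNReal.rpow_one] at h5

variable [SecondCountableTopology X] [BorelSpace X]

theorem measurableSet_mem_ball (hrm : Measurable r) :
    MeasurableSet {z : X × X | z.2 ∈ Metric.ball z.1 (r z.1)} :=
  measurableSet_lt (measurable_snd.dist measurable_fst) (hrm.comp measurable_fst)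

theorem measurable_setLIntegral_ball (μ : Measure X) [SFinite μ] (hrm : Measurable r)
    {F : X → ℝ≥0∞} (hF : Measurable F) :
    Measurable fun x => ∫⁻ y in Metric.ball x (r x), F y ∂μ := by
  have h1 : Measurable fun z : X × X =>
      {z : X × X | z.2 ∈ Metric.ball z.1 (r z.1)}.indicator (fun z => F z.2) z :=
    (hF.comp measurable_snd).indicator (measurableSet_mem_ball hrm)
  convert h1.lintegral_prod_right' (ν := μ) using 2 with x
  rw [← lintegral_indicator Metric.isOpen_ball.measurableSet]
  rfl

/-- The averaging operator `u ↦ (∫_B V^q)⁻¹ ∫_B u V^q` on `L^p(V^q)`. -/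
theorem IsWeightPair.lintegral_average_le (h : IsWeightPair μ r e p q c A W V) [SFinite μ]
    (hpq : p.HolderConjugate q) (hr : ∀ᵐ x ∂μ, 0 < r x) (hrm : Measurable r) {R : ℝ}
    (hR : ∀ x, r x ≤ R)
    (he : ∀ x, 0 < r x → e x ≤ c * μ (Metric.ball x (r x))) (he0 : ∀ x, 0 < r x → e x ≠ 0)
    (het : ∀ x, e x ≠ ∞) (hA : A ≠ ∞) {u : X → ℝ≥0∞} (hu : Measurable u) :
    ∫⁻ x, ((∫⁻ y in Metric.ball x (r x), V y ^ q ∂μ)⁻¹ *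
        ∫⁻ y in Metric.ball x (r x), V y ^ q * u y ∂μ) ^ p * V x ^ q ∂μ ≤
      ENNReal.ofReal (2 ^ p * q) * (c * A) ^ q * ∫⁻ x, u x ^ p * V x ^ q ∂μ := by
  have hVm : Measurable fun x => V x ^ q := h.measurable_right.pow_const q
  have hM : Measurable fun x => (∫⁻ y in Metric.ball x (r x), V y ^ q ∂μ)⁻¹ *
        ∫⁻ y in Metric.ball x (r x), V y ^ q * u y ∂μ :=
    (measurable_setLIntegral_ball μ hrm hVm).inv.mul
      (measurable_setLIntegral_ball μ hrm (hVm.mul hu))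
  have hτ : ∀ x ρ, μ.withDensity (fun y => V y ^ q) (Metric.ball x ρ) =
      ∫⁻ y in Metric.ball x ρ, V y ^ q ∂μ := fun x ρ =>
    withDensity_apply _ Metric.isOpen_ball.measurableSet
  -- The averages are taken for `V^q dμ`, whose doubling constant `(cA)^q` comes from `doubling`
  -- with the roles of the weights exchanged.
  have main := lintegral_average_ball_rpow_le (τ := μ.withDensity fun y => V y ^ q) hR
    (D := (c * A) ^ q)
    (fun x hx => by rw [hτ, hτ]; exact h.symm.doubling hpq.symm hr he he0 het hA hx)
    (fun x hx => by rw [hτ]; exact (h.symm.pos_finite hpq.symm hr he he0 het hA hx).1)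
    (fun x hx => by
      rw [hτ]
      exact ne_top_of_le_ne_top (h.symm.pos_finite hpq.symm hr he he0 het hA hx).2
        (setLIntegral_ball_mono μ hx _))
    ((withDensity_absolutelyContinuous μ _).ae_le hr) hpq hu hM
    (fun x hx => by
      rw [hτ, setLIntegral_withDensity_eq_setLIntegral_mul _ hVm hu
        Metric.isOpen_ball.measurableSet]; rfl)
  rw [lintegral_withDensity_eq_lintegral_mul _ hVm (hM.pow_const p),
    lintegral_withDensity_eq_lintegral_mul _ hVm (hu.pow_const p)] at main
  simp only [Pi.mul_apply] at main
  simpa only [mul_comm (V _ ^ q)] using main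

/-- The substitution `u = h W^(q-1)` turns `∫_B V h` into an integral of `u` against `V^q`, while `∫
u^p V^q = ∫ h^p`. Both facts use only that the weights are reciprocal. -/
theorem rpow_sub_one_cancel {p q : ℝ} (hpq : p.HolderConjugate q) {W V : ℝ≥0∞} (h : W * V = 1)
    (x : ℝ≥0∞) : V ^ q * (x * W ^ (q - 1)) = V * x ∧ (x * W ^ (q - 1)) ^ p * V ^ q = x ^ p := by
  have hq1 := hpq.symm.sub_one_pos
  have hV : V = W⁻¹ := by rw [mul_comm] at h; exact ENNReal.eq_inv_of_mul_eq_one_left h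
  have hWV : ∀ s : ℝ, 0 ≤ s → W ^ s * V ^ s = 1 := fun s hs => by
    rw [← ENNReal.mul_rpow_of_nonneg _ _ hs, h, ENNReal.one_rpow]
  constructor
  · rw [show V ^ q = V ^ (q - 1) * V by
      nth_rewrite 3 [← ENNReal.rpow_one V]
      rw [← ENNReal.rpow_add_of_nonneg _ _ hq1.le zero_le_one, sub_add_cancel]]
    calc _ = (W ^ (q - 1) * V ^ (q - 1)) * (V * x) := by ring
      _ = _ := by rw [hWV _ hq1.le, one_mul]
  · rw [ENNReal.mul_rpow_of_nonneg _ _ hpq.nonneg, ← ENNReal.rpow_mul, hpq.symm.sub_one_mul_conj,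
      mul_assoc, hWV _ hpq.symm.nonneg, mul_one]

/-- Weighted bound for positive kernels that are dominated by averages over balls. -/
theorem exists_weighted_bound [IsFiniteMeasure μ] (hpq : p.HolderConjugate q)
    (hr : ∀ᵐ x ∂μ, 0 < r x) (hrm : Measurable r) {R : ℝ} (hR : ∀ x, r x ≤ R)
    (hem : Measurable e) (hc : 1 ≤ c) (hct : c ≠ ∞)
    (he : ∀ x, 0 < r x → e x ≤ c * μ (Metric.ball x (r x))) (he0 : ∀ x, 0 < r x → e x ≠ 0)
    (het : ∀ x, e x ≠ ∞) {k : X → X → ℝ≥0∞} (hkm : Measurable (Function.uncurry k))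
    {c₀ : ℝ≥0} (hk : ∀ z w, 0 < r z → 0 < r w → k z w ≤ c₀ * ∫⁻ x,
      (Metric.ball x (r x)).indicator 1 z * (Metric.ball x (r x)).indicator 1 w *
        (e x)⁻¹ ^ 2 ∂μ) :
    ∃ C : ℝ≥0, ∀ (A : ℝ≥0) (W V : X → ℝ≥0∞), 1 ≤ A → IsWeightPair μ r e p q c A W V →
      ∀ h : X → ℝ≥0∞, Measurable h →
        (∫⁻ z, (W z * ∫⁻ w, k z w * (V w * h w) ∂μ) ^ p ∂μ) ^ (1 / p) ≤
          C * A ^ (2 * max p q) * (∫⁻ z, h z ^ p ∂μ) ^ (1 / p) := by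
  have hp0 := hpq.pos
  have hq0 := hpq.symm.pos
  set C : ℝ≥0∞ := c₀ * c ^ max p q * ((ENNReal.ofReal (2 ^ p * q) * c ^ q) ^ (1 / p) *
    (ENNReal.ofReal (2 ^ q * p) * c ^ p) ^ (1 / q)) with hC
  have hCt : C ≠ ∞ := by
    have h1 : ∀ s t : ℝ, 0 ≤ s → 0 ≤ t → ∀ y : ℝ, (ENNReal.ofReal y * c ^ s) ^ t ≠ ∞ :=
      fun s t hs ht y => ENNReal.rpow_ne_top_of_nonneg ht
        (ENNReal.mul_ne_top ENNReal.ofReal_ne_top (ENNReal.rpow_ne_top_of_nonneg hs hct))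
    refine ENNReal.mul_ne_top (ENNReal.mul_ne_top ENNReal.coe_ne_top
      (ENNReal.rpow_ne_top_of_nonneg (by positivity) hct)) (ENNReal.mul_ne_top ?_ ?_)
    · exact h1 _ _ hq0.le hpq.one_div_nonneg _
    · exact h1 _ _ hp0.le hpq.symm.one_div_nonneg _
  refine ⟨C.toNNReal, fun A W V hA hWV h hh => ?_⟩
  rw [ENNReal.coe_toNNReal hCt]
  have hAt : (A : ℝ≥0∞) ≠ ∞ := ENNReal.coe_ne_top
  have hA' : (1 : ℝ≥0∞) ≤ A := by exact_mod_cast hA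
  have hWm := hWV.measurable_left
  have hVm := hWV.measurable_right
  have hinner : Measurable fun z => ∫⁻ w, k z w * (V w * h w) ∂μ := by
    have : Measurable fun z : X × X => k z.1 z.2 * (V z.2 * h z.2) :=
      hkm.mul ((hVm.comp measurable_snd).mul (hh.comp measurable_snd))
    exact this.lintegral_prod_right'
  -- Duality makes the estimate symmetric: `h` is averaged against `V^q` in `L^p`, `v` against `W^p`
  -- in `L^q`.
  refine lintegral_rpow_le_of_pairing hpq (hWm.mul hinner) fun v hv => ?_
  set B : X → Set X := fun x => Metric.ball x (r x) with hB
  set u : X → ℝ≥0∞ := fun x => h x * W x ^ (q - 1) with hu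
  set u' : X → ℝ≥0∞ := fun x => v x * V x ^ (p - 1) with hu'
  set σ : X → ℝ≥0∞ := fun x => ∫⁻ y in B x, V y ^ q ∂μ with hσ
  set ω : X → ℝ≥0∞ := fun x => ∫⁻ y in B x, W y ^ p ∂μ with hω
  set M : X → ℝ≥0∞ := fun x => (σ x)⁻¹ * ∫⁻ y in B x, V y ^ q * u y ∂μ with hM
  set M' : X → ℝ≥0∞ := fun x => (ω x)⁻¹ * ∫⁻ y in B x, W y ^ p * u' y ∂μ with hM'
  have hum : Measurable u := hh.mul (hWm.pow_const _)
  have hum' : Measurable u' := hv.mul (hVm.pow_const _)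
  have hMm : Measurable M := (measurable_setLIntegral_ball μ hrm (hVm.pow_const _)).inv.mul
      (measurable_setLIntegral_ball μ hrm ((hVm.pow_const _).mul hum))
  have hMm' : Measurable M' := (measurable_setLIntegral_ball μ hrm (hWm.pow_const _)).inv.mul
      (measurable_setLIntegral_ball μ hrm ((hWm.pow_const _).mul hum'))
  have hind : Measurable fun z : X × X => (B z.2).indicator (1 : X → ℝ≥0∞) z.1 := by
    have : Measurable ({z : X × X | z.2 ∈ Metric.ball z.1 (r z.1)}.indicator
        (fun _ => (1 : ℝ≥0∞))) := measurable_const.indicator (measurableSet_mem_ball hrm)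
    exact this.comp measurable_swap
  have hbound := hWV.lintegral_average_le hpq hr hrm hR he he0 het hAt hum
  have hbound' := hWV.symm.lintegral_average_le hpq.symm hr hrm hR he he0 het hAt hum'
  have hnu : ∫⁻ x, u x ^ p * V x ^ q ∂μ = ∫⁻ x, h x ^ p ∂μ := by
    refine lintegral_congr_ae ?_
    filter_upwards [hr] with x hx
    exact (rpow_sub_one_cancel hpq (hWV.mul_eq_one x hx) (h x)).2
  have hnu' : ∫⁻ x, u' x ^ q * W x ^ p ∂μ = ∫⁻ x, v x ^ q ∂μ := by
    refine lintegral_congr_ae ?_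
    filter_upwards [hr] with x hx
    exact (rpow_sub_one_cancel hpq.symm (hWV.symm.mul_eq_one x hx) (v x)).2
  rw [hnu] at hbound
  rw [hnu'] at hbound'
  have hVu : ∀ x, 0 < r x → ∫⁻ y in B x, V y * h y ∂μ = σ x * M x := by
    intro x hx
    obtain ⟨h0, ht⟩ := hWV.symm.pos_finite hpq.symm hr he he0 het hAt hx
    simp only [hM]
    rw [← mul_assoc, ENNReal.mul_inv_cancel h0
      (ne_top_of_le_ne_top ht (setLIntegral_ball_mono μ hx _)), one_mul]
    refine lintegral_congr_ae ?_
    filter_upwards [ae_restrict_of_ae hr] with y hy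
    exact (rpow_sub_one_cancel hpq (hWV.mul_eq_one y hy) (h y)).1.symm
  have hWu : ∀ x, 0 < r x → ∫⁻ y in B x, W y * v y ∂μ = ω x * M' x := by
    intro x hx
    obtain ⟨h0, ht⟩ := hWV.pos_finite hpq hr he he0 het hAt hx
    simp only [hM']
    rw [← mul_assoc, ENNReal.mul_inv_cancel h0
      (ne_top_of_le_ne_top ht (setLIntegral_ball_mono μ hx _)), one_mul]
    refine lintegral_congr_ae ?_
    filter_upwards [ae_restrict_of_ae hr] with y hy
    exact (rpow_sub_one_cancel hpq.symm (hWV.symm.mul_eq_one y hy) (v y)).1.symm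
  -- With `a = V^p ω/e` and `b = W^q σ/e`, the left side is `a b W^p V^q`. The fields `le_left` and
  -- `le_right` give `a, b ≥ 1/c`, the joint condition gives `a^(1/p) b^(1/q) ≤ A`, and `W^p V^q =
  -- W^(p/q) V^(q/p)` because `W V = 1`.
  have hpt : ∀ x, 0 < r x → ω x * σ x * (e x)⁻¹ ^ 2 ≤
      c ^ max p q * A ^ max p q * (W x ^ (p / q) * V x ^ (q / p)) := by
    intro x hx
    have hW1 := hWV.mul_eq_one x hx
    have hWV1 : ∀ s : ℝ, 0 ≤ s → W x ^ s * V x ^ s = 1 := fun s hs => by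
      rw [← ENNReal.mul_rpow_of_nonneg _ _ hs, hW1, ENNReal.one_rpow]
    have hee : e x * (e x)⁻¹ = 1 := ENNReal.mul_inv_cancel (he0 x hx) (het x)
    have hpp : W x ^ p = W x ^ (p / q) * W x := by
      nth_rewrite 3 [← ENNReal.rpow_one (W x)]
      rw [← ENNReal.rpow_add_of_nonneg _ _ (by positivity) zero_le_one, hpq.div_conj_eq_sub_one,
        sub_add_cancel]
    have hqq : V x ^ q = V x ^ (q / p) * V x := by
      nth_rewrite 3 [← ENNReal.rpow_one (V x)]
      rw [← ENNReal.rpow_add_of_nonneg _ _ (by positivity) zero_le_one,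
        hpq.symm.div_conj_eq_sub_one, sub_add_cancel]
    have key := mul_le_rpow_max_of_rpow_mul_rpow_le hpq (a := V x ^ p * ω x * (e x)⁻¹)
      (b := W x ^ q * σ x * (e x)⁻¹) (A := A) hc ?_ ?_ ?_
    · calc ω x * σ x * (e x)⁻¹ ^ 2 = (W x ^ p * V x ^ p) * (W x ^ q * V x ^ q) *
            (ω x * σ x * (e x)⁻¹ ^ 2) := by
            rw [hWV1 p hp0.le, hWV1 q hq0.le, one_mul, one_mul]
        _ = (V x ^ p * ω x * (e x)⁻¹) * (W x ^ q * σ x * (e x)⁻¹) * (W x ^ p * V x ^ q) := by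
            ring
        _ ≤ (c ^ max p q * A ^ max p q) * (W x ^ p * V x ^ q) := by gcongr
        _ = c ^ max p q * A ^ max p q * (W x ^ (p / q) * V x ^ (q / p)) * (W x * V x) := by
            rw [hpp, hqq]; ring
        _ = _ := by rw [hW1, mul_one]
    · calc (1 : ℝ≥0∞) = V x ^ p * (e x)⁻¹ * (W x ^ p * e x) := by
            rw [show V x ^ p * (e x)⁻¹ * (W x ^ p * e x) =
              (W x ^ p * V x ^ p) * (e x * (e x)⁻¹) by ring, hWV1 p hp0.le, hee, one_mul]
        _ ≤ V x ^ p * (e x)⁻¹ * (c * ω x) := mul_le_mul_right (hWV.le_left x hx) _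
        _ = _ := by ring
    · calc (1 : ℝ≥0∞) = W x ^ q * (e x)⁻¹ * (V x ^ q * e x) := by
            rw [show W x ^ q * (e x)⁻¹ * (V x ^ q * e x) =
              (W x ^ q * V x ^ q) * (e x * (e x)⁻¹) by ring, hWV1 q hq0.le, hee, one_mul]
        _ ≤ W x ^ q * (e x)⁻¹ * (c * σ x) := mul_le_mul_right (hWV.le_right x hx) _
        _ = _ := by ring
    · have h1 : ω x ^ (1 / p) * σ x ^ (1 / q) ≤ A * e x := by
        refine le_trans ?_ (hWV.le_mul x hx)
        gcongr
        · exact setLIntegral_ball_mono μ hx _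
        · exact setLIntegral_ball_mono μ hx _
      have h2 : ((e x)⁻¹) ^ (1 / p) * ((e x)⁻¹) ^ (1 / q) = (e x)⁻¹ := by
        rw [← ENNReal.rpow_add_of_nonneg _ _ hpq.one_div_nonneg hpq.symm.one_div_nonneg,
          one_div, one_div, hpq.inv_add_inv_eq_one, ENNReal.rpow_one]
      have h3 : ∀ (s : ℝ) (_ : 0 < s) (a b d : ℝ≥0∞), (a ^ s * b * d) ^ (1 / s) =
          a * b ^ (1 / s) * d ^ (1 / s) := fun s hs a b d => by
        rw [ENNReal.mul_rpow_of_nonneg _ _ (by positivity),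
          ENNReal.mul_rpow_of_nonneg _ _ (by positivity), ← ENNReal.rpow_mul,
          mul_one_div_cancel hs.ne', ENNReal.rpow_one]
      rw [h3 p hp0, h3 q hq0]
      calc _ = (ω x ^ (1 / p) * σ x ^ (1 / q)) * (W x * V x) *
            (((e x)⁻¹) ^ (1 / p) * ((e x)⁻¹) ^ (1 / q)) := by ring
        _ ≤ (A * e x) * (W x * V x) * (e x)⁻¹ := by rw [h2]; gcongr
        _ = A * (e x * (e x)⁻¹) := by rw [hW1]; ring
        _ = A := by rw [hee, mul_one]
  -- Insert the domination of `k` and use Tonelli twice to make the centre `x` the outermost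
  -- variable; the two indicators decouple `z` from `w`.
  have hpair : ∫⁻ z, W z * (∫⁻ w, k z w * (V w * h w) ∂μ) * v z ∂μ ≤
      c₀ * ∫⁻ x, (∫⁻ y in B x, W y * v y ∂μ) * (∫⁻ y in B x, V y * h y ∂μ) * (e x)⁻¹ ^ 2 ∂μ := by
    have hset : ∀ (F : X → ℝ≥0∞) (x : X), ∫⁻ y, (B x).indicator 1 y * F y ∂μ =
        ∫⁻ y in B x, F y ∂μ := fun F x => by
      rw [← lintegral_indicator Metric.isOpen_ball.measurableSet]
      refine lintegral_congr fun y => ?_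
      change _ = (B x).indicator F y
      by_cases hy : y ∈ B x
      · simp [hy]
      · simp [hy]
    have hΨ : Measurable fun x => ∫⁻ y in B x, V y * h y ∂μ :=
      measurable_setLIntegral_ball μ hrm (hVm.mul hh)
    have h1 : ∀ z, 0 < r z → ∫⁻ w, k z w * (V w * h w) ∂μ ≤
        c₀ * ∫⁻ x, (B x).indicator 1 z * ((∫⁻ y in B x, V y * h y ∂μ) * (e x)⁻¹ ^ 2) ∂μ := by
      intro z hz
      have hm1 : Measurable fun y : X × X => (B y.2).indicator (1 : X → ℝ≥0∞) z *
          (B y.2).indicator 1 y.1 * (e y.2)⁻¹ ^ 2 * (V y.1 * h y.1) := by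
        have h4 : Measurable fun y : X × X => (B y.2).indicator (1 : X → ℝ≥0∞) z :=
          hind.comp (measurable_const.prodMk measurable_snd)
        fun_prop
      calc ∫⁻ w, k z w * (V w * h w) ∂μ
          ≤ ∫⁻ w, c₀ * ∫⁻ x, (B x).indicator 1 z * (B x).indicator 1 w * (e x)⁻¹ ^ 2 *
              (V w * h w) ∂μ ∂μ := by
            refine lintegral_mono_ae ?_
            filter_upwards [hr] with w hw
            have hm2 : Measurable fun x : X => (B x).indicator (1 : X → ℝ≥0∞) z *
                (B x).indicator 1 w * (e x)⁻¹ ^ 2 := by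
              have h4 : ∀ z, Measurable fun x : X => (B x).indicator (1 : X → ℝ≥0∞) z :=
                fun z => hind.comp (measurable_const.prodMk measurable_id)
              exact ((h4 z).mul (h4 w)).mul (hem.inv.pow_const 2)
            rw [lintegral_mul_const _ hm2, ← mul_assoc (c₀ : ℝ≥0∞)]
            exact mul_le_mul_left (hk z w hz hw) _
        _ = c₀ * ∫⁻ x, ∫⁻ w, (B x).indicator 1 z * (B x).indicator 1 w * (e x)⁻¹ ^ 2 *
              (V w * h w) ∂μ ∂μ := by
            rw [lintegral_const_mul' _ _ ENNReal.coe_ne_top,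
              lintegral_lintegral_swap hm1.aemeasurable]
        _ = _ := by
            congr 1
            refine lintegral_congr fun x => ?_
            rw [← hset, ← lintegral_mul_const'' _ (by
              have h4 : Measurable fun y : X => (B x).indicator (1 : X → ℝ≥0∞) y :=
                measurable_one.indicator Metric.isOpen_ball.measurableSet
              fun_prop), ← lintegral_const_mul'']
            · refine lintegral_congr fun w => ?_
              ring
            · have h4 : Measurable fun y : X => (B x).indicator (1 : X → ℝ≥0∞) y :=
                measurable_one.indicator Metric.isOpen_ball.measurableSet
              fun_prop
    calc ∫⁻ z, W z * (∫⁻ w, k z w * (V w * h w) ∂μ) * v z ∂μ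
        ≤ ∫⁻ z, c₀ * ∫⁻ x, (B x).indicator 1 z * (W z * v z) *
            ((∫⁻ y in B x, V y * h y ∂μ) * (e x)⁻¹ ^ 2) ∂μ ∂μ := by
          refine lintegral_mono_ae ?_
          filter_upwards [hr] with z hz
          have hm2 : Measurable fun x : X => (B x).indicator (1 : X → ℝ≥0∞) z *
              ((∫⁻ y in B x, V y * h y ∂μ) * (e x)⁻¹ ^ 2) := by
            have h4 : Measurable fun x : X => (B x).indicator (1 : X → ℝ≥0∞) z :=
              hind.comp (measurable_const.prodMk measurable_id)
            exact h4.mul (hΨ.mul (hem.inv.pow_const 2))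
          calc _ = (W z * v z) * ∫⁻ w, k z w * (V w * h w) ∂μ := by ring
            _ ≤ (W z * v z) * (c₀ * ∫⁻ x, (B x).indicator 1 z *
                ((∫⁻ y in B x, V y * h y ∂μ) * (e x)⁻¹ ^ 2) ∂μ) := mul_le_mul_right (h1 z hz) _
            _ = c₀ * ((W z * v z) * ∫⁻ x, (B x).indicator 1 z *
                ((∫⁻ y in B x, V y * h y ∂μ) * (e x)⁻¹ ^ 2) ∂μ) := by ring
            _ = _ := by
              rw [← lintegral_const_mul _ hm2]
              congr 1
              refine lintegral_congr fun x => ?_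
              ring
      _ = c₀ * ∫⁻ x, ∫⁻ z, (B x).indicator 1 z * (W z * v z) *
            ((∫⁻ y in B x, V y * h y ∂μ) * (e x)⁻¹ ^ 2) ∂μ ∂μ := by
          rw [lintegral_const_mul' _ _ ENNReal.coe_ne_top, lintegral_lintegral_swap]
          refine Measurable.aemeasurable ?_
          have h5 : Measurable fun z : X × X => (∫⁻ y in B z.2, V y * h y ∂μ) :=
            hΨ.comp measurable_snd
          simp only [Function.uncurry_def]
          fun_prop
      _ = _ := by
          congr 1
          refine lintegral_congr fun x => ?_
          rw [lintegral_mul_const, hset, mul_assoc]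
          have h4 : Measurable fun y : X => (B x).indicator (1 : X → ℝ≥0∞) y :=
            measurable_one.indicator Metric.isOpen_ball.measurableSet
          fun_prop
  have hholder : ∫⁻ x, (M x * V x ^ (q / p)) * (M' x * W x ^ (p / q)) ∂μ ≤
      (∫⁻ x, M x ^ p * V x ^ q ∂μ) ^ (1 / p) * (∫⁻ x, M' x ^ q * W x ^ p ∂μ) ^ (1 / q) := by
    refine (ENNReal.lintegral_mul_le_Lp_mul_Lq μ hpq
      (hMm.mul (hVm.pow_const (q / p))).aemeasurable
      (hMm'.mul (hWm.pow_const (p / q))).aemeasurable).trans (le_of_eq ?_)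
    congr 3
    · ext x
      rw [Pi.mul_apply, ENNReal.mul_rpow_of_nonneg _ _ hp0.le, ← ENNReal.rpow_mul,
        div_mul_cancel₀ _ hp0.ne']
    · ext x
      rw [Pi.mul_apply, ENNReal.mul_rpow_of_nonneg _ _ hq0.le, ← ENNReal.rpow_mul,
        div_mul_cancel₀ _ hq0.ne']
  -- The exponent of `A` is `q/p + p/q + max p q = p + q - 2 + max p q`, at most `2 max p q` because
  -- `min p q ≤ 2`. Enlarging the exponent uses `1 ≤ A`.
  have hexp : ((c * A) ^ q) ^ (1 / p) * ((c * A) ^ p) ^ (1 / q) * (A : ℝ≥0∞) ^ max p q ≤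
      (c ^ q) ^ (1 / p) * (c ^ p) ^ (1 / q) * (A : ℝ≥0∞) ^ (2 * max p q) := by
    have h1 : ∀ s t : ℝ, 0 ≤ s → 0 ≤ t → ((c * A) ^ s) ^ t = (c ^ s) ^ t * (A : ℝ≥0∞) ^ (s * t) :=
      fun s t hs ht => by
        rw [ENNReal.mul_rpow_of_nonneg _ _ hs, ENNReal.mul_rpow_of_nonneg _ _ ht,
          ← ENNReal.rpow_mul (A : ℝ≥0∞)]
    rw [h1 _ _ hq0.le hpq.one_div_nonneg, h1 _ _ hp0.le hpq.symm.one_div_nonneg]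
    calc _ = (c ^ q) ^ (1 / p) * (c ^ p) ^ (1 / q) * ((A : ℝ≥0∞) ^ (q * (1 / p)) *
          (A : ℝ≥0∞) ^ (p * (1 / q)) * (A : ℝ≥0∞) ^ max p q) := by ring
      _ ≤ _ := by
        rw [← ENNReal.rpow_add_of_nonneg _ _ (by positivity) (by positivity),
          ← ENNReal.rpow_add_of_nonneg _ _ (by positivity) (by positivity)]
        refine mul_le_mul_right (ENNReal.rpow_le_rpow_of_exponent_le hA' ?_) _
        rw [mul_one_div, mul_one_div, hpq.div_conj_eq_sub_one, hpq.symm.div_conj_eq_sub_one]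
        have hm := hpq.mul_eq_add
        have hp1 := hpq.sub_one_pos
        have hq1 := hpq.symm.sub_one_pos
        rcases le_total p q with hle | hle
        · rw [max_eq_right hle]; nlinarith
        · rw [max_eq_left hle]; nlinarith
  calc ∫⁻ z, W z * (∫⁻ w, k z w * (V w * h w) ∂μ) * v z ∂μ
      ≤ c₀ * ∫⁻ x, (∫⁻ y in B x, W y * v y ∂μ) * (∫⁻ y in B x, V y * h y ∂μ) *
          (e x)⁻¹ ^ 2 ∂μ := hpair
    _ ≤ c₀ * ∫⁻ x, (c ^ max p q * A ^ max p q) *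
          ((M x * V x ^ (q / p)) * (M' x * W x ^ (p / q))) ∂μ := by
        gcongr c₀ * ?_
        refine lintegral_mono_ae ?_
        filter_upwards [hr] with x hx
        rw [hVu x hx, hWu x hx]
        calc _ = (M x * M' x) * (ω x * σ x * (e x)⁻¹ ^ 2) := by ring
          _ ≤ _ := mul_le_mul_right (hpt x hx) _
          _ = _ := by ring
    _ = c₀ * (c ^ max p q * A ^ max p q) *
          ∫⁻ x, (M x * V x ^ (q / p)) * (M' x * W x ^ (p / q)) ∂μ := by
        rw [lintegral_const_mul _ (by fun_prop)]; ring
    _ ≤ c₀ * (c ^ max p q * A ^ max p q) *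
          ((ENNReal.ofReal (2 ^ p * q) * (c * A) ^ q * ∫⁻ x, h x ^ p ∂μ) ^ (1 / p) *
          (ENNReal.ofReal (2 ^ q * p) * (c * A) ^ p * ∫⁻ x, v x ^ q ∂μ) ^ (1 / q)) := by
        gcongr
        refine hholder.trans ?_
        gcongr
    _ = c₀ * c ^ max p q * (ENNReal.ofReal (2 ^ p * q) ^ (1 / p) *
          ENNReal.ofReal (2 ^ q * p) ^ (1 / q)) *
          (((c * A) ^ q) ^ (1 / p) * ((c * A) ^ p) ^ (1 / q) * (A : ℝ≥0∞) ^ max p q) *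
          ((∫⁻ x, h x ^ p ∂μ) ^ (1 / p) * (∫⁻ x, v x ^ q ∂μ) ^ (1 / q)) := by
        simp only [ENNReal.mul_rpow_of_nonneg _ _ hpq.one_div_nonneg,
          ENNReal.mul_rpow_of_nonneg _ _ hpq.symm.one_div_nonneg]
        ring
    _ ≤ c₀ * c ^ max p q * (ENNReal.ofReal (2 ^ p * q) ^ (1 / p) *
          ENNReal.ofReal (2 ^ q * p) ^ (1 / q)) *
          ((c ^ q) ^ (1 / p) * (c ^ p) ^ (1 / q) * (A : ℝ≥0∞) ^ (2 * max p q)) *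
          ((∫⁻ x, h x ^ p ∂μ) ^ (1 / p) * (∫⁻ x, v x ^ q ∂μ) ^ (1 / q)) := by
        gcongr
    _ = _ := by
        simp only [hC, ENNReal.mul_rpow_of_nonneg _ _ hpq.one_div_nonneg,
          ENNReal.mul_rpow_of_nonneg _ _ hpq.symm.one_div_nonneg]
        ring

end WeightPair

/-! ### The weighted measure on the disc, rotation invariance and the mean value property -/

theorem measurable_discDensity (a : ℝ) :
    Measurable fun z : ℂ => ENNReal.ofReal ((a + 1) / Real.pi * (1 - ‖z‖ ^ 2) ^ a) := by
  fun_prop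

theorem lintegral_discMeasure (a : ℝ) {F : ℂ → ℝ≥0∞} (hF : Measurable F) :
    ∫⁻ z, F z ∂discMeasure a = ∫⁻ z in Metric.ball (0 : ℂ) 1,
      ENNReal.ofReal ((a + 1) / Real.pi * (1 - ‖z‖ ^ 2) ^ a) * F z := by
  rw [discMeasure, lintegral_withDensity_eq_lintegral_mul _ (measurable_discDensity a) hF]
  rfl

instance sigmaFinite_discMeasure (a : ℝ) : SigmaFinite (discMeasure a) := by
  unfold discMeasure
  exact SigmaFinite.withDensity_of_ne_top (Filter.Eventually.of_forall fun _ => ENNReal.ofReal_ne_top)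

theorem ae_discMeasure_norm_lt_one (a : ℝ) : ∀ᵐ z ∂discMeasure a, ‖z‖ < 1 := by
  refine (withDensity_absolutelyContinuous _ _).ae_le ?_
  filter_upwards [ae_restrict_mem (Metric.isOpen_ball (x := (0 : ℂ)) (ε := 1)).measurableSet]
    with z hz
  simpa using hz

theorem lintegral_one_sub_sq_rpow {a : ℝ} (ha : -1 < a) :
    ∫⁻ r in Set.Ioo (0 : ℝ) 1, ENNReal.ofReal (2 * r) * ENNReal.ofReal ((1 - r ^ 2) ^ a) =
      ENNReal.ofReal (1 / (a + 1)) := by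
  have himg : (fun r : ℝ => 1 - r ^ 2) '' Set.Ioo 0 1 = Set.Ioo 0 1 := by
    ext x
    constructor
    · rintro ⟨r, ⟨h0, h1⟩, rfl⟩
      constructor <;> simp only <;> nlinarith
    · rintro ⟨h0, h1⟩
      refine ⟨√(1 - x), ⟨Real.sqrt_pos.2 (by linarith), ?_⟩, ?_⟩
      · rw [Real.sqrt_lt' one_pos]; linarith
      · simp only; rw [Real.sq_sqrt (by linarith)]; ring
  have hcv := lintegral_image_eq_lintegral_abs_deriv_mul (measurableSet_Ioo (a := (0 : ℝ)) (b := 1))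
    (f := fun r : ℝ => 1 - r ^ 2) (f' := fun r => -(2 * r))
    (fun x _ => by
      have := ((hasDerivAt_pow 2 x).const_sub 1).hasDerivWithinAt (s := Set.Ioo 0 1)
      simpa using this)
    (fun x hx y hy hxy => by
      simp only [sub_right_inj] at hxy
      exact (sq_eq_sq₀ hx.1.le hy.1.le).1 hxy)
    (fun x => ENNReal.ofReal (x ^ a))
  rw [himg] at hcv
  have h1 : ∫⁻ r in Set.Ioo (0 : ℝ) 1, ENNReal.ofReal (2 * r) * ENNReal.ofReal ((1 - r ^ 2) ^ a) =
      ∫⁻ x in Set.Ioo (0 : ℝ) 1, ENNReal.ofReal (x ^ a) := by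
    rw [hcv]
    refine setLIntegral_congr_fun measurableSet_Ioo fun r hr => ?_
    simp only [abs_neg]
    rw [abs_of_pos (by linarith [hr.1])]
  rw [h1, ← ofReal_integral_eq_lintegral_ofReal, ← integral_Ioc_eq_integral_Ioo,
    ← intervalIntegral.integral_of_le zero_le_one, integral_rpow (Or.inl ha),
    Real.zero_rpow (by linarith), Real.one_rpow, sub_zero]
  · have := intervalIntegral.intervalIntegrable_rpow' (a := 0) (b := 1) ha
    exact ((intervalIntegrable_iff_integrableOn_Ioc_of_le zero_le_one).1 this).mono_set
      Set.Ioo_subset_Ioc_self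
  · refine (ae_restrict_iff' measurableSet_Ioo).2 (Filter.Eventually.of_forall fun t ht => ?_)
    exact Real.rpow_nonneg ht.1.le _

theorem isProbabilityMeasure_discMeasure {a : ℝ} (ha : -1 < a) :
    IsProbabilityMeasure (discMeasure a) := by
  constructor
  have ha1 : 0 < a + 1 := by linarith
  rw [← lintegral_one, ← Pi.one_def, lintegral_discMeasure a measurable_one, ← lintegral_indicator
    Metric.isOpen_ball.measurableSet, ← Complex.lintegral_comp_polarCoord_symm]
  have h1 : ∀ p ∈ polarCoord.target, ENNReal.ofReal p.1 • (Metric.ball (0 : ℂ) 1).indicator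
      (fun z => ENNReal.ofReal ((a + 1) / Real.pi * (1 - ‖z‖ ^ 2) ^ a) * (1 : ℂ → ℝ≥0∞) z)
      (Complex.polarCoord.symm p) = (Set.Ioo (0 : ℝ) 1).indicator (fun r =>
        ENNReal.ofReal ((a + 1) / (2 * Real.pi)) * (ENNReal.ofReal (2 * r) *
          ENNReal.ofReal ((1 - r ^ 2) ^ a))) p.1 := by
    intro p hp
    have hp1 : 0 < p.1 := hp.1
    have hn : ‖Complex.polarCoord.symm p‖ = p.1 := by
      rw [Complex.norm_polarCoord_symm, abs_of_pos hp1]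
    by_cases h : p.1 < 1
    · rw [Set.indicator_of_mem (mem_ball_zero_iff.2 (hn.trans_lt h)),
        Set.indicator_of_mem (show p.1 ∈ Set.Ioo 0 1 from ⟨hp1, h⟩), hn,
        smul_eq_mul, Pi.one_apply, mul_one, ← ENNReal.ofReal_mul hp1.le,
        ← ENNReal.ofReal_mul (by positivity), ← ENNReal.ofReal_mul (by positivity)]
      congr 1
      field_simp
    · rw [Set.indicator_of_notMem (fun hh => h (hn ▸ mem_ball_zero_iff.1 hh)),
        Set.indicator_of_notMem (fun hh => h hh.2), smul_zero]
  rw [setLIntegral_congr_fun polarCoord.open_target.measurableSet h1]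
  have h2 : (volume : Measure (ℝ × ℝ)).restrict polarCoord.target =
      (volume.restrict (Set.Ioi (0 : ℝ))).prod (volume.restrict (Set.Ioo (-Real.pi) Real.pi)) := by
    rw [Measure.prod_restrict]; rfl
  have hm : Measurable ((Set.Ioo (0 : ℝ) 1).indicator fun r =>
      ENNReal.ofReal ((a + 1) / (2 * Real.pi)) * (ENNReal.ofReal (2 * r) *
        ENNReal.ofReal ((1 - r ^ 2) ^ a))) :=
    Measurable.indicator (by fun_prop) measurableSet_Ioo
  rw [h2, lintegral_prod]
  swap
  · exact (hm.comp measurable_fst).aemeasurable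
  simp only [lintegral_const, Measure.restrict_apply MeasurableSet.univ, Set.univ_inter,
    Real.volume_Ioo]
  rw [lintegral_mul_const _ hm,
    lintegral_indicator measurableSet_Ioo, Measure.restrict_restrict measurableSet_Ioo,
    Set.inter_eq_left.2 Set.Ioo_subset_Ioi_self, lintegral_const_mul _ (by fun_prop),
    lintegral_one_sub_sq_rpow ha, ← ENNReal.ofReal_mul (by positivity),
    ← ENNReal.ofReal_mul (by positivity), ← ENNReal.ofReal_one]
  congr 1
  field_simp
  ring

/-- Invariance under all rotations about the origin. -/
def IsRotationInvariant (μ : Measure ℂ) : Prop :=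
  ∀ c : Circle, MeasurePreserving (rotation c) μ μ

theorem isRotationInvariant_volume_restrict (R : ℝ) :
    IsRotationInvariant (volume.restrict (Metric.ball (0 : ℂ) R)) := by
  intro c
  have h := (rotation c).measurePreserving.restrict_preimage
    (Metric.isOpen_ball (x := (0 : ℂ)) (ε := R)).measurableSet
  have h2 : (rotation c) ⁻¹' (Metric.ball (0 : ℂ) R) = Metric.ball (0 : ℂ) R := by
    ext z
    rw [Set.mem_preimage, mem_ball_zero_iff, mem_ball_zero_iff, LinearIsometryEquiv.norm_map]
  rwa [h2] at h

theorem isRotationInvariant_discMeasure (a : ℝ) : IsRotationInvariant (discMeasure a) := by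
  intro c
  have h := isRotationInvariant_volume_restrict 1 c
  refine ⟨h.measurable, ?_⟩
  ext s hs
  rw [Measure.map_apply h.measurable hs, discMeasure, withDensity_apply _ (h.measurable hs),
    withDensity_apply _ hs, ← h.setLIntegral_comp_preimage hs (measurable_discDensity a)]
  simp only [LinearIsometryEquiv.norm_map]

theorem measurable_indicator_of_continuousOn {X Y : Type*} [TopologicalSpace X] [MeasurableSpace X]
    [BorelSpace X] [TopologicalSpace Y] [MeasurableSpace Y] [BorelSpace Y] [Zero Y]
    {s : Set X} (hs : MeasurableSet s) {f : X → Y} (hf : ContinuousOn f s) :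
    Measurable (s.indicator f) := by
  classical
  rw [← Set.piecewise_eq_indicator]
  exact hf.measurable_piecewise continuousOn_const hs

/-- The mean value property for rotation invariant measures. -/
theorem IsRotationInvariant.integral_eq {μ : Measure ℂ} [IsFiniteMeasure μ]
    (hμ : IsRotationInvariant μ) {R : ℝ} (hR : ∀ᵐ z ∂μ, ‖z‖ < R) {G : ℂ → ℂ}
    (hG : DifferentiableOn ℂ G (Metric.ball 0 R)) (hint : Integrable G μ) :
    ∫ z, G z ∂μ = μ.real Set.univ • G 0 := by
  set G₁ : ℂ → ℂ := (Metric.ball 0 R).indicator G with hG₁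
  have hGG : G =ᵐ[μ] G₁ := by
    filter_upwards [hR] with z hz
    rw [hG₁, Set.indicator_of_mem (by simpa using hz)]
  have hm₁ : Measurable G₁ :=
    measurable_indicator_of_continuousOn Metric.isOpen_ball.measurableSet hG.continuousOn
  have hint₁ : Integrable G₁ μ := hint.congr hGG
  set ν : Measure ℝ := volume.restrict (Set.uIoc 0 (2 * Real.pi)) with hν
  have : IsFiniteMeasure ν := by
    rw [hν, Set.uIoc]; infer_instance
  have hmm : Measurable fun x : ℝ × ℂ => G₁ (Circle.exp x.1 * x.2) := by
    refine hm₁.comp ?_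
    have : Continuous fun x : ℝ × ℂ => (Circle.exp x.1 : ℂ) * x.2 := by fun_prop
    exact this.measurable
  -- Integrating this over `θ` multiplies the integral of `G` by `2π`. In the other order, the
  -- integral over each circle is `2π G(0)`.
  have hrot : ∀ θ : ℝ, ∫ z, G₁ (Circle.exp θ * z) ∂μ = ∫ z, G₁ z ∂μ := fun θ =>
    (hμ (Circle.exp θ)).integral_comp
      (rotation (Circle.exp θ)).toHomeomorph.measurableEmbedding G₁
  have hprod : Integrable (fun x : ℝ × ℂ => G₁ (Circle.exp x.1 * x.2)) (ν.prod μ) := by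
    refine (integrable_prod_iff hmm.aestronglyMeasurable).2 ⟨?_, ?_⟩
    · refine Filter.Eventually.of_forall fun θ => ?_
      exact ((hμ (Circle.exp θ)).integrable_comp_emb
        (rotation (Circle.exp θ)).toHomeomorph.measurableEmbedding).2 hint₁
    · have : ∀ θ : ℝ, ∫ z, ‖G₁ (Circle.exp θ * z)‖ ∂μ = ∫ z, ‖G₁ z‖ ∂μ := fun θ =>
        (hμ (Circle.exp θ)).integral_comp
          (rotation (Circle.exp θ)).toHomeomorph.measurableEmbedding fun z => ‖G₁ z‖
      simp only [this]
      exact integrable_const _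
  have hcirc : ∀ᵐ z ∂μ, ∫ θ, G₁ (Circle.exp θ * z) ∂ν = (2 * Real.pi) • G 0 := by
    filter_upwards [hR] with z hz
    have hdiff : DiffContOnCl ℂ (fun ζ => G (ζ * z)) (Metric.ball 0 |(1 : ℝ)|) := by
      refine DifferentiableOn.diffContOnCl fun ζ hζ => ?_
      have hζ1 : ‖ζ‖ ≤ 1 := by
        have := Metric.closure_ball_subset_closedBall hζ
        simpa using this
      have hmem : ζ * z ∈ Metric.ball (0 : ℂ) R := by
        rw [mem_ball_zero_iff, norm_mul]
        nlinarith [norm_nonneg z]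
      refine DifferentiableAt.differentiableWithinAt ?_
      exact (hG.differentiableAt (Metric.isOpen_ball.mem_nhds hmem)).comp ζ (by fun_prop)
    have h1 := hdiff.circleAverage
    rw [Real.circleAverage_def] at h1
    simp only [zero_mul] at h1
    rw [← h1, smul_smul, mul_inv_cancel₀ (by positivity), one_smul,
      intervalIntegral.integral_of_le (by positivity), hν, Set.uIoc_of_le (by positivity)]
    refine integral_congr_ae (Filter.Eventually.of_forall fun θ => ?_)
    simp only [hG₁]
    rw [Set.indicator_of_mem]
    · simp [circleMap]
    · simpa using hz
  have hswap := integral_integral_swap (f := fun θ z => G₁ (Circle.exp θ * z)) hprod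
  rw [integral_congr_ae hcirc] at hswap
  simp only [hrot, integral_const, smul_smul] at hswap
  have hνm : ν.real Set.univ = 2 * Real.pi := by
    rw [hν, Set.uIoc_of_le (by positivity)]
    simp [Measure.real, Real.pi_pos.le]
  rw [hνm, mul_comm (μ.real Set.univ), mul_smul _ (μ.real Set.univ)] at hswap
  rw [integral_congr_ae hGG]
  exact smul_right_injective ℂ (r := 2 * Real.pi) (by positivity) hswap

/-! ### Kernel and involutions of the disc, and the reproducing property -/

/-- The reproducing kernel of the disc. -/
def discKernel (a : ℝ) (z w : ℂ) : ℂ := 1 / (1 - z * conj w) ^ ((a + 2 : ℝ) : ℂ)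

theorem bergmanKernel_eq_prod {n : ℕ} (α : Fin n → ℝ) (z w : Fin n → ℂ) :
    bergmanKernel α z w = ∏ j, discKernel (α j) (z j) (w j) := rfl

theorem one_sub_mul_conj_re_pos {z w : ℂ} (hz : ‖z‖ < 1) (hw : ‖w‖ < 1) :
    0 < (1 - z * conj w).re := by
  have h1 : (z * conj w).re ≤ ‖z * conj w‖ := Complex.re_le_norm _
  rw [norm_mul, RCLike.norm_conj] at h1
  rw [Complex.sub_re, Complex.one_re]
  nlinarith [norm_nonneg z, norm_nonneg w]

theorem one_sub_mul_conj_ne_zero {z w : ℂ} (hz : ‖z‖ < 1) (hw : ‖w‖ < 1) :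
    1 - z * conj w ≠ 0 := fun h => by
  have := one_sub_mul_conj_re_pos hz hw
  rw [h] at this; simp at this

theorem arg_ne_pi_of_re_pos {x : ℂ} (hx : 0 < x.re) : x.arg ≠ Real.pi := by
  have := Complex.abs_arg_lt_pi_div_two_iff.2 (Or.inl hx)
  intro h
  rw [h, abs_of_pos Real.pi_pos] at this
  linarith [Real.pi_pos]

/-- Both arguments lie in `(-π/2, π/2)`, so their sum stays on the principal branch and the
logarithms add. -/
theorem mul_cpow_of_re_pos {x y : ℂ} (hx : 0 < x.re) (hy : 0 < y.re) (s : ℂ) :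
    (x * y) ^ s = x ^ s * y ^ s := by
  have hx0 : x ≠ 0 := fun h => by simp [h] at hx
  have hy0 : y ≠ 0 := fun h => by simp [h] at hy
  have h1 := abs_lt.1 (Complex.abs_arg_lt_pi_div_two_iff.2 (Or.inl hx))
  have h2 := abs_lt.1 (Complex.abs_arg_lt_pi_div_two_iff.2 (Or.inl hy))
  rw [Complex.cpow_def_of_ne_zero (mul_ne_zero hx0 hy0), Complex.cpow_def_of_ne_zero hx0,
    Complex.cpow_def_of_ne_zero hy0, ← Complex.exp_add, ← add_mul, Complex.log_mul hx0 hy0]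
  constructor <;> linarith [h1.1, h1.2, h2.1, h2.2]

theorem inv_re_pos {x : ℂ} (hx : 0 < x.re) : 0 < (x⁻¹).re := by
  rw [Complex.inv_re]
  exact div_pos hx (Complex.normSq_pos.2 fun h => by simp [h] at hx)

theorem conj_cpow_ofReal {x : ℂ} (hx : 0 < x.re) (s : ℝ) :
    conj (x ^ (s : ℂ)) = (conj x) ^ (s : ℂ) := by
  rw [Complex.conj_cpow _ _ (arg_ne_pi_of_re_pos hx), Complex.conj_ofReal]

theorem conj_discKernel (a : ℝ) {z w : ℂ} (hz : ‖z‖ < 1) (hw : ‖w‖ < 1) :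
    conj (discKernel a z w) = discKernel a w z := by
  rw [discKernel, discKernel, map_div₀, map_one, conj_cpow_ofReal (one_sub_mul_conj_re_pos hz hw)]
  simp [mul_comm]

theorem norm_discKernel (a : ℝ) (z w : ℂ) :
    ‖discKernel a z w‖ = (‖1 - z * conj w‖ ^ (a + 2))⁻¹ := by
  rw [discKernel, norm_div, norm_one, Complex.norm_cpow_real, one_div]

theorem differentiableAt_discKernel (a : ℝ) {z w : ℂ} (hz : ‖z‖ < 1) (hw : ‖w‖ < 1) :
    DifferentiableAt ℂ (fun z => discKernel a z w) z := by
  unfold discKernel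
  have h := one_sub_mul_conj_re_pos hz hw
  refine DifferentiableAt.div (by fun_prop) ?_ ?_
  · exact DifferentiableAt.cpow_const (by fun_prop) (Or.inl h)
  · rw [Complex.cpow_def_of_ne_zero (one_sub_mul_conj_ne_zero hz hw)]; exact Complex.exp_ne_zero _

@[fun_prop]
theorem measurable_discKernel (a : ℝ) :
    Measurable fun x : ℂ × ℂ => discKernel a x.1 x.2 := by
  unfold discKernel
  have : Measurable fun x : ℂ × ℂ => 1 - x.1 * conj x.2 :=
    (by fun_prop : Continuous fun x : ℂ × ℂ => 1 - x.1 * conj x.2).measurable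
  exact measurable_const.div (this.pow_const _)

/-- The involutive automorphism of the disc that exchanges `0` and `w`. -/
def discInvolution (w u : ℂ) : ℂ := (w - u) / (1 - u * conj w)

/-- The Möbius identity behind the geometry: `u = z` gives the invariance of the disc, `u = 0` the
involution property, and its `(a+2)`-th power the transformation law of the kernel. -/
theorem one_sub_discInvolution_mul {w z u : ℂ} (hw : ‖w‖ < 1) (hz : ‖z‖ < 1) (hu : ‖u‖ < 1) :
    1 - discInvolution w z * conj (discInvolution w u) =
      ((1 - ‖w‖ ^ 2 : ℝ) : ℂ) * (1 - z * conj u) / ((1 - z * conj w) * (1 - w * conj u)) := by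
  have h1 := one_sub_mul_conj_ne_zero hz hw
  have h2 := one_sub_mul_conj_ne_zero hw hu
  have h3 : 1 - conj u * w ≠ 0 := by rwa [mul_comm]
  have hww : ((‖w‖ ^ 2 : ℝ) : ℂ) = w * conj w := by rw [Complex.mul_conj']; norm_cast
  rw [discInvolution, discInvolution, Complex.ofReal_sub, hww]
  simp only [map_div₀, map_sub, map_one, map_mul, Complex.conj_conj, Complex.ofReal_one]
  field_simp
  ring

theorem one_sub_norm_sq_discInvolution {w u : ℂ} (hw : ‖w‖ < 1) (hu : ‖u‖ < 1) :
    1 - ‖discInvolution w u‖ ^ 2 =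
      (1 - ‖w‖ ^ 2) * (1 - ‖u‖ ^ 2) / ‖1 - u * conj w‖ ^ 2 := by
  have h := one_sub_discInvolution_mul hw hu hu
  rw [Complex.mul_conj', Complex.mul_conj', show (1 - w * conj u : ℂ) = conj (1 - u * conj w) by
    simp [mul_comm], Complex.mul_conj'] at h
  exact_mod_cast h

theorem norm_discInvolution_lt_one {w u : ℂ} (hw : ‖w‖ < 1) (hu : ‖u‖ < 1) :
    ‖discInvolution w u‖ < 1 := by
  have h := one_sub_norm_sq_discInvolution hw hu
  have h1 : 0 < (1 - ‖w‖ ^ 2) * (1 - ‖u‖ ^ 2) / ‖1 - u * conj w‖ ^ 2 := by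
    have := norm_pos_iff.2 (one_sub_mul_conj_ne_zero hu hw)
    have h2 : 0 < 1 - ‖w‖ ^ 2 := by nlinarith [norm_nonneg w]
    have h3 : 0 < 1 - ‖u‖ ^ 2 := by nlinarith [norm_nonneg u]
    positivity
  nlinarith [norm_nonneg (discInvolution w u)]

theorem one_sub_discInvolution_mul_conj {w u : ℂ} (hw : ‖w‖ < 1) (hu : ‖u‖ < 1) :
    1 - discInvolution w u * conj w = ((1 - ‖w‖ ^ 2 : ℝ) : ℂ) / (1 - u * conj w) := by
  have h := one_sub_discInvolution_mul hw hu (u := 0) (by simp)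
  simpa [discInvolution] using h

theorem discInvolution_discInvolution {w u : ℂ} (hw : ‖w‖ < 1) (hu : ‖u‖ < 1) :
    discInvolution w (discInvolution w u) = u := by
  have h1 := one_sub_mul_conj_ne_zero hu hw
  have h2 : (1 - ‖w‖ ^ 2 : ℝ) ≠ 0 := by nlinarith [norm_nonneg w]
  have h3 : ((1 - ‖w‖ ^ 2 : ℝ) : ℂ) ≠ 0 := by exact_mod_cast h2
  have hww : ((‖w‖ ^ 2 : ℝ) : ℂ) = w * conj w := by rw [Complex.mul_conj']; norm_cast
  rw [discInvolution, one_sub_discInvolution_mul_conj hw hu, div_div_eq_mul_div, div_eq_iff h3,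
    discInvolution, sub_mul, div_mul_cancel₀ _ h1, Complex.ofReal_sub, hww]
  push_cast
  ring

theorem hasDerivAt_discInvolution {w u : ℂ} (hw : ‖w‖ < 1) (hu : ‖u‖ < 1) :
    HasDerivAt (discInvolution w) (-((1 - ‖w‖ ^ 2 : ℝ) : ℂ) / (1 - u * conj w) ^ 2) u := by
  have h1 := one_sub_mul_conj_ne_zero hu hw
  have hww : ((‖w‖ ^ 2 : ℝ) : ℂ) = w * conj w := by rw [Complex.mul_conj']; norm_cast
  have h2 : HasDerivAt (fun u => w - u) (-1) u := by
    simpa using (hasDerivAt_id u).const_sub w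
  have h3 : HasDerivAt (fun u => 1 - u * conj w) (-conj w) u := by
    simpa using ((hasDerivAt_id u).mul_const (conj w)).const_sub 1
  refine (h2.div h3 h1).congr_deriv ?_
  rw [Complex.ofReal_sub, hww]
  push_cast
  ring

theorem image_discInvolution {w : ℂ} (hw : ‖w‖ < 1) :
    discInvolution w '' Metric.ball 0 1 = Metric.ball 0 1 := by
  ext z
  simp only [Set.mem_image, mem_ball_zero_iff]
  constructor
  · rintro ⟨u, hu, rfl⟩; exact norm_discInvolution_lt_one hw hu
  · exact fun hz => ⟨_, norm_discInvolution_lt_one hw hz, discInvolution_discInvolution hw hz⟩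

theorem integral_discMeasure (a : ℝ) (ha : -1 < a) (F : ℂ → ℂ) :
    ∫ z, F z ∂discMeasure a =
      ∫ z in Metric.ball 0 1, ((a + 1) / Real.pi * (1 - ‖z‖ ^ 2) ^ a) • F z := by
  rw [discMeasure, integral_withDensity_eq_integral_toReal_smul (measurable_discDensity a)
    (Filter.Eventually.of_forall fun _ => ENNReal.ofReal_lt_top)]
  refine setIntegral_congr_fun Metric.isOpen_ball.measurableSet fun z hz => ?_
  have hz : ‖z‖ < 1 := by simpa using hz
  have h3 : 0 < 1 - ‖z‖ ^ 2 := by nlinarith [norm_nonneg z]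
  have ha1 : 0 < a + 1 := by linarith
  rw [ENNReal.toReal_ofReal (by positivity)]

theorem integrable_discMeasure_iff (a : ℝ) (ha : -1 < a) (F : ℂ → ℂ) :
    Integrable F (discMeasure a) ↔ IntegrableOn
      (fun z => ((a + 1) / Real.pi * (1 - ‖z‖ ^ 2) ^ a) • F z) (Metric.ball 0 1) := by
  rw [discMeasure, integrable_withDensity_iff_integrable_smul' (measurable_discDensity a)
    (Filter.Eventually.of_forall fun _ => ENNReal.ofReal_lt_top)]
  refine integrableOn_congr_fun (fun z hz => ?_) Metric.isOpen_ball.measurableSet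
  have hz : ‖z‖ < 1 := by simpa using hz
  have h3 : 0 < 1 - ‖z‖ ^ 2 := by nlinarith [norm_nonneg z]
  have ha1 : 0 < a + 1 := by linarith
  rw [ENNReal.toReal_ofReal (by positivity)]

theorem abs_det_restrictScalars (c : ℂ) :
    |((ContinuousLinearMap.toSpanSingleton ℂ c).restrictScalars ℝ).det| = ‖c‖ ^ 2 := by
  simp [ContinuousLinearMap.det, LinearMap.det_restrictScalars, Algebra.norm_complex_eq,
    Complex.normSq_eq_norm_sq]

/-- The change of variables `z = discInvolution w u` and the kernel. -/
theorem density_mul_discKernel_discInvolution (a : ℝ) {w u : ℂ} (hw : ‖w‖ < 1) (hu : ‖u‖ < 1)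
    (F : ℂ) :
    ‖-((1 - ‖w‖ ^ 2 : ℝ) : ℂ) / (1 - u * conj w) ^ 2‖ ^ 2 •
      (((a + 1) / Real.pi * (1 - ‖discInvolution w u‖ ^ 2) ^ a) •
        (F * discKernel a w (discInvolution w u))) =
      ((a + 1) / Real.pi * (1 - ‖u‖ ^ 2) ^ a) • (F * discKernel a u w) := by
  have h1 := one_sub_mul_conj_ne_zero hu hw
  have hre := one_sub_mul_conj_re_pos hu hw
  set x : ℂ := 1 - u * conj w with hx
  have hn : 0 < ‖x‖ := norm_pos_iff.2 h1
  have hr : 0 < 1 - ‖w‖ ^ 2 := by nlinarith [norm_nonneg w]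
  have hu' : 0 < 1 - ‖u‖ ^ 2 := by nlinarith [norm_nonneg u]
  set ρ : ℝ := 1 - ‖w‖ ^ 2 with hρ
  have hkx : 1 - w * conj (discInvolution w u) = (ρ : ℂ) * (conj x)⁻¹ := by
    have := congrArg conj (one_sub_discInvolution_mul_conj hw hu)
    rw [← hx, ← hρ] at this
    simp only [map_sub, map_one, map_mul, Complex.conj_conj, map_div₀, Complex.conj_ofReal] at this
    rw [mul_comm w, this, div_eq_mul_inv]
  have hcx : 0 < (conj x).re := by simpa using hre
  have hx0 : x ^ ((a + 2 : ℝ) : ℂ) ≠ 0 := by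
    rw [Complex.cpow_def_of_ne_zero h1]; exact Complex.exp_ne_zero _
  have hcx0 : (conj x) ^ ((a + 2 : ℝ) : ℂ) ≠ 0 := by
    rw [Complex.cpow_def_of_ne_zero (fun h => h1 ((map_eq_zero _).1 h))]; exact Complex.exp_ne_zero _
  have hk : discKernel a w (discInvolution w u) =
      (conj x) ^ ((a + 2 : ℝ) : ℂ) / ((ρ ^ (a + 2) : ℝ) : ℂ) := by
    rw [discKernel, hkx, mul_cpow_of_re_pos (by simpa using hr) (inv_re_pos hcx),
      Complex.inv_cpow _ _ (arg_ne_pi_of_re_pos hcx), Complex.ofReal_cpow hr.le]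
    field_simp
  -- This trades `(conj x)^(a+2)` for a real factor times `K(u, w)`, so that the transformed
  -- integrand is holomorphic in `u` apart from the weight.
  have hxx : x ^ ((a + 2 : ℝ) : ℂ) * (conj x) ^ ((a + 2 : ℝ) : ℂ) =
      ((‖x‖ ^ (a + 2) * ‖x‖ ^ (a + 2) : ℝ) : ℂ) := by
    rw [← conj_cpow_ofReal hre, Complex.mul_conj', Complex.norm_cpow_real, sq]; norm_cast
  have hk2 : (conj x) ^ ((a + 2 : ℝ) : ℂ) =
      ((‖x‖ ^ (a + 2) * ‖x‖ ^ (a + 2) : ℝ) : ℂ) * discKernel a u w := by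
    rw [discKernel, ← hx, ← hxx]; field_simp
  rw [hk, hk2, one_sub_norm_sq_discInvolution hw hu, ← hx, ← hρ, norm_div, norm_neg, norm_pow,
    Complex.norm_real, Real.norm_of_nonneg hr.le]
  simp only [Complex.real_smul]
  -- Real Jacobian, transformed weight and kernel factor: the powers of `ρ` add up to `2 + a - (a+2)
  -- = 0`, those of `‖x‖` to `-4 - 2a + 2(a+2) = 0`.
  have hreal : (ρ / ‖x‖ ^ 2) ^ 2 * ((a + 1) / Real.pi * (ρ * (1 - ‖u‖ ^ 2) / ‖x‖ ^ 2) ^ a) *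
      (‖x‖ ^ (a + 2) * ‖x‖ ^ (a + 2)) / ρ ^ (a + 2) = (a + 1) / Real.pi * (1 - ‖u‖ ^ 2) ^ a := by
    rw [Real.div_rpow (by positivity) (by positivity), Real.mul_rpow hr.le hu'.le,
      Real.rpow_add hr, Real.rpow_add hn, Real.rpow_two, Real.rpow_two,
      show (‖x‖ ^ 2) ^ a = ‖x‖ ^ a * ‖x‖ ^ a by
        rw [sq, Real.mul_rpow hn.le hn.le]]
    have e1 : 0 < ρ ^ a := by positivity
    have e2 : 0 < ‖x‖ ^ a := by positivity
    field_simp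
  rw [← hreal]
  push_cast
  ring

/-- The reproducing property on the disc. -/
theorem integral_mul_discKernel {a : ℝ} (ha : -1 < a) {F : ℂ → ℂ}
    (hF : DifferentiableOn ℂ F (Metric.ball 0 1)) (hint : Integrable F (discMeasure a)) {w : ℂ}
    (hw : ‖w‖ < 1) : ∫ z, F z * discKernel a w z ∂discMeasure a = F w := by
  have hprob := isProbabilityMeasure_discMeasure ha
  have hs : MeasurableSet (Metric.ball (0 : ℂ) 1) := Metric.isOpen_ball.measurableSet
  have hderiv : ∀ u ∈ Metric.ball (0 : ℂ) 1, HasFDerivWithinAt (discInvolution w)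
      ((ContinuousLinearMap.toSpanSingleton ℂ
        (-((1 - ‖w‖ ^ 2 : ℝ) : ℂ) / (1 - u * conj w) ^ 2)).restrictScalars ℝ)
      (Metric.ball 0 1) u := fun u hu => by
    have := (hasDerivAt_discInvolution hw (by simpa using hu)).hasFDerivAt
    exact (this.restrictScalars ℝ).hasFDerivWithinAt
  have hinj : Set.InjOn (discInvolution w) (Metric.ball 0 1) := fun u hu v hv h => by
    rw [← discInvolution_discInvolution hw (mem_ball_zero_iff.1 hu), h,
      discInvolution_discInvolution hw (mem_ball_zero_iff.1 hv)]
  have hkb : ∀ z, ‖z‖ < 1 → ‖discKernel a w z‖ ≤ ((1 - ‖w‖) ^ (a + 2))⁻¹ := fun z hz => by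
    rw [norm_discKernel]
    have h1 : 0 < 1 - ‖w‖ := by linarith
    have h2 : 1 - ‖w‖ ≤ ‖1 - w * conj z‖ := by
      have := norm_sub_norm_le (1 : ℂ) (w * conj z)
      rw [norm_one, norm_mul, RCLike.norm_conj] at this
      nlinarith [norm_nonneg w]
    gcongr
    linarith
  have hintK : Integrable (fun z => F z * discKernel a w z) (discMeasure a) := by
    refine hint.mul_bdd (c := ((1 - ‖w‖) ^ (a + 2))⁻¹) ?_ ?_
    · exact (by fun_prop : Measurable fun z => discKernel a w z).aestronglyMeasurable
    · filter_upwards [ae_discMeasure_norm_lt_one a] with z hz using hkb z hz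
  have hG : Integrable (fun u => F (discInvolution w u) * discKernel a u w) (discMeasure a) := by
    rw [integrable_discMeasure_iff a ha] at hintK ⊢
    rw [← image_discInvolution hw, integrableOn_image_iff_integrableOn_abs_det_fderiv_smul _ hs
      hderiv hinj] at hintK
    refine hintK.congr_fun (fun u hu => ?_) hs
    simp only [abs_det_restrictScalars]
    exact density_mul_discKernel_discInvolution a hw (by simpa using hu) _
  -- After the substitution the integrand is `F(φ_w(u)) K(u,w)`, holomorphic in `u`. Its value at
  -- `0` is `F(w)`, since `φ_w(0) = w` and `K(0,w) = 1`.
  have hmean := (isRotationInvariant_discMeasure a).integral_eq (ae_discMeasure_norm_lt_one a)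
    (G := fun u => F (discInvolution w u) * discKernel a u w) (fun u hu => by
      have hu : ‖u‖ < 1 := by simpa using hu
      refine DifferentiableAt.differentiableWithinAt ((DifferentiableAt.comp u ?_
        (hasDerivAt_discInvolution hw hu).differentiableAt).mul
        (differentiableAt_discKernel a hu hw))
      exact hF.differentiableAt (Metric.isOpen_ball.mem_nhds
        (by simpa using norm_discInvolution_lt_one hw hu))) hG
  have hval : (discMeasure a).real Set.univ • (F (discInvolution w 0) * discKernel a 0 w) = F w := by
    simp [discInvolution, discKernel]
  rw [← hval, ← hmean, integral_discMeasure a ha, integral_discMeasure a ha]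
  nth_rewrite 1 [← image_discInvolution hw]
  rw [integral_image_eq_integral_abs_det_fderiv_smul _ hs hderiv hinj]
  refine setIntegral_congr_fun hs fun u hu => ?_
  simp only [abs_det_restrictScalars]
  exact density_mul_discKernel_discInvolution a hw (by simpa using hu) _

/-! ### Sub-mean value inequalities and domination of the kernel by Carleson regions -/

theorem enorm_mul_volume_ball_le {h : ℂ → ℂ} {x : ℂ} {ρ : ℝ}
    (hd : DifferentiableOn ℂ h (Metric.ball x ρ)) :
    ‖h x‖ₑ * volume (Metric.ball x ρ) ≤ ∫⁻ z in Metric.ball x ρ, ‖h z‖ₑ := by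
  have hpre : (fun z => x + z) ⁻¹' Metric.ball x ρ = Metric.ball 0 ρ := by
    ext z; simp [dist_eq_norm]
  have htr : ∫⁻ z in Metric.ball 0 ρ, ‖h (x + z)‖ₑ = ∫⁻ z in Metric.ball x ρ, ‖h z‖ₑ := by
    rw [← hpre]
    exact (measurePreserving_add_left volume x).setLIntegral_comp_preimage_emb
      (MeasurableEquiv.addLeft x).measurableEmbedding (fun z => ‖h z‖ₑ) _
  rcases eq_or_ne (∫⁻ z in Metric.ball x ρ, ‖h z‖ₑ) ∞ with hinf | hfin
  · rw [hinf]; exact le_top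
  set G : ℂ → ℂ := fun z => h (x + z) with hG
  have hGd : DifferentiableOn ℂ G (Metric.ball 0 ρ) := by
    refine hd.comp (by fun_prop) fun z hz => ?_
    rw [← hpre] at hz; exact hz
  have hfm : IsFiniteMeasure (volume.restrict (Metric.ball (0 : ℂ) ρ)) :=
    ⟨by rw [Measure.restrict_apply_univ]; exact measure_ball_lt_top⟩
  have hint : Integrable G (volume.restrict (Metric.ball 0 ρ)) := by
    refine ⟨hGd.continuousOn.aestronglyMeasurable Metric.isOpen_ball.measurableSet, ?_⟩
    rw [HasFiniteIntegral, htr]; exact hfin.lt_top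
  have hm := (isRotationInvariant_volume_restrict ρ).integral_eq (by
    filter_upwards [ae_restrict_mem Metric.isOpen_ball.measurableSet] with z hz
    simpa using hz) hGd hint
  rw [← htr]
  refine le_trans (le_of_eq ?_) (enorm_integral_le_lintegral_enorm G)
  rw [hm, enorm_smul, mul_comm, hG]
  simp only [add_zero]
  rw [measureReal_restrict_apply_univ, Real.enorm_of_nonneg measureReal_nonneg,
    ofReal_measureReal measure_ball_lt_top.ne, Complex.volume_ball, Complex.volume_ball]

/-- The case of exponent one followed by Hölder against the constant `1`; the constant stays exactly
`1`, hence independent of `p`. -/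
theorem enorm_rpow_mul_volume_ball_le {h : ℂ → ℂ} {x : ℂ} {ρ : ℝ} (hρ : 0 < ρ)
    (hd : DifferentiableOn ℂ h (Metric.ball x ρ)) {p : ℝ} (hp : 1 < p) :
    ‖h x‖ₑ ^ p * volume (Metric.ball x ρ) ≤ ∫⁻ z in Metric.ball x ρ, ‖h z‖ₑ ^ p := by
  have hpq := Real.HolderConjugate.conjExponent hp
  set q := p.conjExponent
  have hp0 : 0 < p := by linarith
  set V := volume (Metric.ball x ρ) with hV
  have hV0 : V ≠ 0 := (Metric.measure_ball_pos volume x hρ).ne'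
  have hVt : V ≠ ∞ := measure_ball_lt_top.ne
  have hm : AEMeasurable (fun z => ‖h z‖ₑ) (volume.restrict (Metric.ball x ρ)) :=
    (hd.continuousOn.aestronglyMeasurable Metric.isOpen_ball.measurableSet).enorm
  have h1 := (enorm_mul_volume_ball_le hd).trans (le_trans (le_of_eq (by simp))
    (ENNReal.lintegral_mul_le_Lp_mul_Lq (volume.restrict (Metric.ball x ρ)) hpq hm
      (aemeasurable_const (b := (1 : ℝ≥0∞)))))
  simp only [ENNReal.one_rpow, lintegral_const, Measure.restrict_apply MeasurableSet.univ,
    Set.univ_inter, one_mul] at h1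
  have h2 := ENNReal.rpow_le_rpow h1 hp0.le
  rw [ENNReal.mul_rpow_of_nonneg _ _ hp0.le, ENNReal.mul_rpow_of_nonneg _ _ hp0.le,
    ← ENNReal.rpow_mul, ← ENNReal.rpow_mul, one_div_mul_cancel hp0.ne', ENNReal.rpow_one,
    one_div_mul_eq_div, hpq.div_conj_eq_sub_one,
    show V ^ p = V * V ^ (p - 1) by
      nth_rewrite 2 [← ENNReal.rpow_one V]
      rw [← ENNReal.rpow_add _ _ hV0 hVt]; congr 1; ring, ← mul_assoc] at h2
  refine (ENNReal.mul_le_mul_iff_left ?_ ?_).1 h2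
  · exact (ENNReal.rpow_pos (pos_iff_ne_zero.2 hV0) hVt).ne'
  · exact ENNReal.rpow_ne_top_of_nonneg (by linarith) hVt

theorem min_rpow_le {a t l u : ℝ} (hl : 0 < l) (h1 : l ≤ t) (h2 : t ≤ u) :
    min (l ^ a) (u ^ a) ≤ t ^ a := by
  rcases le_total 0 a with ha | ha
  · exact (min_le_left _ _).trans (Real.rpow_le_rpow hl.le h1 ha)
  · exact (min_le_right _ _).trans (Real.rpow_le_rpow_of_nonpos (hl.trans_le h1) h2 ha)

/-- Comparison of `discMeasure a` with area on a set where `1 - |x|²` is comparable to `D`. -/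
theorem smul_volume_restrict_le_discMeasure {a : ℝ} (ha : -1 < a) {S : Set ℂ}
    (hSm : MeasurableSet S) {D : ℝ} (hD : 0 < D) (hS : ∀ x ∈ S, ‖x‖ < 1)
    (hS1 : ∀ x ∈ S, D / 8 ≤ 1 - ‖x‖ ^ 2) (hS2 : ∀ x ∈ S, 1 - ‖x‖ ^ 2 ≤ 3 * D) :
    ENNReal.ofReal ((a + 1) / Real.pi * min ((1 / 8 : ℝ) ^ a) (3 ^ a) * D ^ a) •
      volume.restrict S ≤ (discMeasure a).restrict S := by
  have ha1 : 0 < a + 1 := by linarith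
  refine Measure.le_iff.2 fun s hs => ?_
  rw [Measure.smul_apply, Measure.restrict_apply hs, Measure.restrict_apply hs, discMeasure,
    withDensity_apply _ (hs.inter hSm), Measure.restrict_restrict (hs.inter hSm),
    Set.inter_eq_left.2 fun x hx => mem_ball_zero_iff.2 (hS x hx.2), smul_eq_mul,
    ← setLIntegral_const]
  refine setLIntegral_mono' (hs.inter hSm) fun x hx => ENNReal.ofReal_le_ofReal ?_
  rw [mul_assoc]
  gcongr
  have h1 := hS1 x hx.2
  have h2 := hS2 x hx.2
  have h3 : 1 - ‖x‖ ^ 2 = ((1 - ‖x‖ ^ 2) / D) * D := by field_simp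
  rw [h3, Real.mul_rpow (div_nonneg (by linarith) hD.le) hD.le]
  gcongr
  refine min_rpow_le (by norm_num) ?_ ?_
  · rw [le_div_iff₀ hD]; linarith
  · rw [div_le_iff₀ hD]; linarith

/-- The size `(1 - |x|)^(a + 2)` of a Carleson region at `x`. -/
def boxSize (a : ℝ) (x : ℂ) : ℝ≥0∞ := ENNReal.ofReal ((1 - ‖x‖) ^ (a + 2))

/-- On the ball of radius `D/2`, `D = 1 - |x|`, the density of the measure is at least a multiple of
`D^a`, so the area estimate there suffices; the ball of radius `12 D` only enlarges the integral.
The constant must not depend on `p` or `h`: it serves `f` with exponent `p`, `1/f` with exponent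
`q`, and the function `1`. -/
theorem exists_submean {a : ℝ} (ha : -1 < a) : ∃ c : ℝ≥0, 1 ≤ c ∧
    ∀ {p : ℝ}, 1 < p → ∀ {h : ℂ → ℂ}, DifferentiableOn ℂ h (Metric.ball 0 1) → ∀ x : ℂ, ‖x‖ < 1 →
      ‖h x‖ₑ ^ p * boxSize a x ≤
        c * ∫⁻ z in Metric.ball x (12 * (1 - ‖x‖)), ‖h z‖ₑ ^ p ∂discMeasure a := by
  have ha1 : 0 < a + 1 := by linarith
  set κ : ℝ := (a + 1) / Real.pi * min ((1 / 8 : ℝ) ^ a) (3 ^ a) with hκ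
  have hκ0 : 0 < κ := by
    have : 0 < min ((1 / 8 : ℝ) ^ a) (3 ^ a) := lt_min (by positivity) (by positivity)
    positivity
  refine ⟨max 1 (Real.toNNReal (4 / Real.pi / κ)), le_max_left _ _, ?_⟩
  intro p hp h hh x hx
  set D : ℝ := 1 - ‖x‖ with hDdef
  have hD : 0 < D := by rw [hDdef]; linarith
  have hball : ∀ z ∈ Metric.ball x (D / 2), ‖z‖ < 1 - D / 2 ∧ 1 - ‖z‖ < 3 / 2 * D := by
    intro z hz
    rw [mem_ball_iff_norm] at hz
    have h1 := norm_sub_norm_le z x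
    have h2 := norm_sub_norm_le x z
    rw [norm_sub_rev] at h2
    constructor <;> linarith
  have hsub : Metric.ball x (D / 2) ⊆ Metric.ball 0 1 := fun z hz => by
    rw [mem_ball_zero_iff]; linarith [(hball z hz).1]
  have h1 := enorm_rpow_mul_volume_ball_le (half_pos hD) (hh.mono hsub) hp
  have h2 := smul_volume_restrict_le_discMeasure ha (S := Metric.ball x (D / 2))
    Metric.isOpen_ball.measurableSet hD (fun z hz => by linarith [(hball z hz).1])
    (fun z hz => by nlinarith [(hball z hz).1, norm_nonneg z])
    (fun z hz => by nlinarith [(hball z hz).1, (hball z hz).2, norm_nonneg z])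
  have h3 : ENNReal.ofReal (κ * D ^ a) * ∫⁻ z in Metric.ball x (D / 2), ‖h z‖ₑ ^ p ≤
      ∫⁻ z in Metric.ball x (D / 2), ‖h z‖ₑ ^ p ∂discMeasure a := by
    rw [← smul_eq_mul, ← lintegral_smul_measure]
    exact lintegral_mono' h2 le_rfl
  have h4 : boxSize a x = ENNReal.ofReal (4 / Real.pi / κ) * (ENNReal.ofReal (κ * D ^ a) *
      volume (Metric.ball x (D / 2))) := by
    rw [Complex.volume_ball, boxSize, ← hDdef, ← NNReal.coe_real_pi, ← ENNReal.ofReal_coe_nnreal,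
      ← ENNReal.ofReal_pow (by positivity), ← ENNReal.ofReal_mul (by positivity),
      ← ENNReal.ofReal_mul (by positivity), ← ENNReal.ofReal_mul (by positivity),
      Real.rpow_add hD, Real.rpow_two, NNReal.coe_real_pi]
    congr 1
    field_simp
    ring
  calc ‖h x‖ₑ ^ p * boxSize a x = ENNReal.ofReal (4 / Real.pi / κ) * (ENNReal.ofReal (κ * D ^ a) *
      (‖h x‖ₑ ^ p * volume (Metric.ball x (D / 2)))) := by rw [h4]; ring
    _ ≤ ENNReal.ofReal (4 / Real.pi / κ) *
        ∫⁻ z in Metric.ball x (D / 2), ‖h z‖ₑ ^ p ∂discMeasure a := by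
        gcongr
        exact (mul_le_mul_right h1 _).trans h3
    _ ≤ _ := by
        gcongr
        · exact ENNReal.coe_le_coe.2 (le_max_right _ _)
        · linarith

/-- Put `d = |1 - z w̄|`. A whole disc of centres `x`, of `discMeasure` at least a constant times
`d^(a+2)`, sees both `z` and `w` and has `boxSize` at most a constant times `d^(a+2)`. Its
contribution is therefore at least of order `d^(a+2) d^(-2(a+2)) = |K(z,w)|`. -/
theorem exists_discKernel_le {a : ℝ} (ha : -1 < a) : ∃ c₀ : ℝ≥0, ∀ z w : ℂ, ‖z‖ < 1 → ‖w‖ < 1 →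
    ‖discKernel a z w‖ₑ ≤ c₀ * ∫⁻ x, (Metric.ball x (12 * (1 - ‖x‖))).indicator 1 z *
      (Metric.ball x (12 * (1 - ‖x‖))).indicator 1 w * (boxSize a x)⁻¹ ^ 2 ∂discMeasure a := by
  have ha1 : 0 < a + 1 := by linarith
  have ha2 : 0 < a + 2 := by linarith
  set κ : ℝ := (a + 1) / Real.pi * min ((1 / 8 : ℝ) ^ a) (3 ^ a) with hκ
  have hκ0 : 0 < κ := by
    have : 0 < min ((1 / 8 : ℝ) ^ a) (3 ^ a) := lt_min (by positivity) (by positivity)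
    positivity
  set c : ℝ := 64 / (Real.pi * κ) * ((11 / 8 : ℝ) ^ (a + 2)) ^ 2 with hc
  refine ⟨Real.toNNReal c, fun z w hz hw => ?_⟩
  have hne := one_sub_mul_conj_ne_zero hz hw
  set d : ℝ := ‖1 - z * conj w‖ with hd
  have hd0 : 0 < d := norm_pos_iff.2 hne
  have hd2 : d ≤ 2 := by
    refine (norm_sub_le _ _).trans ?_
    rw [norm_one, norm_mul, RCLike.norm_conj]
    nlinarith [norm_nonneg z, norm_nonneg w]
  have hdz : 1 - ‖z‖ ≤ d := by
    have := norm_sub_norm_le (1 : ℂ) (z * conj w)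
    rw [norm_one, norm_mul, RCLike.norm_conj] at this
    nlinarith [norm_nonneg z]
  -- This is `|φ_w(z)| < 1` with the denominator cleared.
  have hzw : ‖w - z‖ ≤ d := by
    have := (norm_discInvolution_lt_one hw hz).le
    rwa [discInvolution, norm_div, div_le_one hd0] at this
  -- Pulling `z` inwards by `d/4` keeps a disc of radius `d/8` around `x₀` at distance more than
  -- `d/8` from the circle.
  set x₀ : ℂ := ((1 - d / 4 : ℝ) : ℂ) * z with hx₀
  have hx₀n : ‖x₀‖ = (1 - d / 4) * ‖z‖ := by
    rw [hx₀, norm_mul, Complex.norm_real, Real.norm_of_nonneg (by linarith)]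
  have hx₀z : ‖z - x₀‖ ≤ d / 4 := by
    rw [show z - x₀ = ((d / 4 : ℝ) : ℂ) * z by rw [hx₀]; push_cast; ring, norm_mul,
      Complex.norm_real, Real.norm_of_nonneg (by linarith)]
    nlinarith
  set S := Metric.ball x₀ (d / 8) with hS
  have hSx : ∀ x ∈ S, ‖x‖ < 1 - d / 8 ∧ 1 - ‖x‖ ≤ 11 / 8 * d := by
    intro x hx
    rw [hS, mem_ball_iff_norm] at hx
    have h1 := norm_sub_norm_le x x₀
    have h2 := norm_sub_norm_le x₀ x
    rw [norm_sub_rev] at h2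
    constructor <;> nlinarith [norm_nonneg z]
  -- Here the factor `12` is fixed: `12(1 - |x|)` exceeds `12d/8`, while `z` and `w` lie within
  -- `3d/8` and `11d/8` of `x`.
  have hmem : ∀ x ∈ S, z ∈ Metric.ball x (12 * (1 - ‖x‖)) ∧ w ∈ Metric.ball x (12 * (1 - ‖x‖)) := by
    intro x hx
    have h1 := (hSx x hx).1
    rw [hS, mem_ball_iff_norm, norm_sub_rev] at hx
    have h2 : ‖z - x‖ < 3 / 8 * d := by
      have := norm_add_le (z - x₀) (x₀ - x)
      rw [sub_add_sub_cancel] at this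
      linarith
    have h3 : ‖w - x‖ < 11 / 8 * d := by
      have := norm_add_le (w - z) (z - x)
      rw [sub_add_sub_cancel] at this
      linarith
    rw [mem_ball_iff_norm, mem_ball_iff_norm]
    constructor <;> linarith
  have h2 := smul_volume_restrict_le_discMeasure ha (S := S)
    Metric.isOpen_ball.measurableSet hd0 (fun x hx => by linarith [(hSx x hx).1])
    (fun x hx => by nlinarith [(hSx x hx).1, norm_nonneg x])
    (fun x hx => by nlinarith [(hSx x hx).1, (hSx x hx).2, norm_nonneg x])
  set B : ℝ := (((11 / 8 * d) ^ (a + 2))⁻¹) ^ 2 with hB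
  have hlow : ∀ x ∈ S, ENNReal.ofReal B ≤ (Metric.ball x (12 * (1 - ‖x‖))).indicator 1 z *
      (Metric.ball x (12 * (1 - ‖x‖))).indicator 1 w * (boxSize a x)⁻¹ ^ 2 := by
    intro x hx
    have h1 := (hSx x hx).1
    have h3 := (hSx x hx).2
    have h5 : 0 < 1 - ‖x‖ := by linarith
    rw [Set.indicator_of_mem (hmem x hx).1, Set.indicator_of_mem (hmem x hx).2, Pi.one_apply,
      Pi.one_apply, one_mul, one_mul, boxSize, ← ENNReal.ofReal_inv_of_pos (by positivity),
      ← ENNReal.ofReal_pow (by positivity)]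
    refine ENNReal.ofReal_le_ofReal ?_
    rw [hB]
    gcongr
  have hint : ENNReal.ofReal B * (ENNReal.ofReal (κ * d ^ a) * volume S) ≤
      ∫⁻ x, (Metric.ball x (12 * (1 - ‖x‖))).indicator 1 z *
      (Metric.ball x (12 * (1 - ‖x‖))).indicator 1 w * (boxSize a x)⁻¹ ^ 2 ∂discMeasure a := by
    calc ENNReal.ofReal B * (ENNReal.ofReal (κ * d ^ a) * volume S)
        = ∫⁻ _, ENNReal.ofReal B ∂(ENNReal.ofReal (κ * d ^ a) • volume.restrict S) := by
          rw [lintegral_const, Measure.smul_apply, Measure.restrict_apply_univ, smul_eq_mul]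
      _ ≤ ∫⁻ _ in S, ENNReal.ofReal B ∂discMeasure a := lintegral_mono' h2 le_rfl
      _ ≤ ∫⁻ x in S, _ ∂discMeasure a :=
          setLIntegral_mono' Metric.isOpen_ball.measurableSet hlow
      _ ≤ _ := setLIntegral_le_lintegral _ _
  refine le_trans (le_of_eq ?_) (mul_le_mul_right hint _)
  change _ = ENNReal.ofReal c * _
  rw [hS, Complex.volume_ball, ← ENNReal.ofReal_coe_nnreal (p := NNReal.pi), NNReal.coe_real_pi,
    ← ENNReal.ofReal_pow (by positivity), ← ENNReal.ofReal_mul (by positivity),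
    ← ENNReal.ofReal_mul (by positivity), ← ENNReal.ofReal_mul (by positivity),
    ← ENNReal.ofReal_mul (by positivity), ← ofReal_norm, norm_discKernel, ← hd]
  congr 1
  rw [hB, hc, Real.mul_rpow (by norm_num) hd0.le, Real.rpow_add hd0, Real.rpow_two]
  have e1 : 0 < d ^ a := by positivity
  have e2 : 0 < (11 / 8 : ℝ) ^ (a + 2) := by positivity
  field_simp
  norm_num

theorem measurable_boxSize (a : ℝ) : Measurable (boxSize a) := by
  unfold boxSize; fun_prop

theorem boxSize_ne_zero (a : ℝ) {x : ℂ} (hx : ‖x‖ < 1) : boxSize a x ≠ 0 := by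
  have : 0 < 1 - ‖x‖ := by linarith
  rw [boxSize, ne_eq, ENNReal.ofReal_eq_zero, not_le]; positivity

theorem boxSize_ne_top (a : ℝ) (x : ℂ) : boxSize a x ≠ ∞ := ENNReal.ofReal_ne_top

/-- The one-variable weighted inequality for the modulus of the Bergman kernel. -/
theorem exists_weighted_bound_disc {a : ℝ} (ha : -1 < a) {p q : ℝ} (hpq : p.HolderConjugate q)
    {c : ℝ≥0} (hc1 : 1 ≤ c)
    (hc : ∀ x : ℂ, ‖x‖ < 1 → boxSize a x ≤ c * discMeasure a (Metric.ball x (12 * (1 - ‖x‖)))) :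
    ∃ C : ℝ≥0, ∀ (A : ℝ≥0) (W V : ℂ → ℝ≥0∞), 1 ≤ A →
      IsWeightPair (discMeasure a) (fun x => 12 * (1 - ‖x‖)) (boxSize a) p q c A W V →
      ∀ h : ℂ → ℝ≥0∞, Measurable h →
        (∫⁻ z, (W z * ∫⁻ w, ‖discKernel a z w‖ₑ * (V w * h w) ∂discMeasure a) ^ p
          ∂discMeasure a) ^ (1 / p) ≤
          C * A ^ (2 * max p q) * (∫⁻ z, h z ^ p ∂discMeasure a) ^ (1 / p) := by
  have := isProbabilityMeasure_discMeasure ha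
  obtain ⟨c₀, hc₀⟩ := exists_discKernel_le ha
  have hr : ∀ x : ℂ, 0 < 12 * (1 - ‖x‖) → ‖x‖ < 1 := fun x hx => by linarith
  refine exists_weighted_bound (k := fun z w => ‖discKernel a z w‖ₑ) (R := 12) (c₀ := c₀) hpq
    ?_ (by fun_prop) (fun x => by linarith [norm_nonneg x]) (measurable_boxSize a)
    (by exact_mod_cast hc1) ENNReal.coe_ne_top (fun x hx => hc x (hr x hx))
    (fun x hx => boxSize_ne_zero a (hr x hx)) (boxSize_ne_top a)
    (measurable_discKernel a).enorm (fun z w hz hw => hc₀ z w (hr z hz) (hr w hw))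
  filter_upwards [ae_discMeasure_norm_lt_one a] with x hx
  linarith

/-! ### The polydisc: splitting off the first variable -/

variable {n : ℕ}

instance sigmaFinite_polydiscMeasure (α : Fin n → ℝ) : SigmaFinite (polydiscMeasure α) := by
  unfold polydiscMeasure; infer_instance

theorem isProbabilityMeasure_polydiscMeasure {α : Fin n → ℝ} (hα : ∀ j, -1 < α j) :
    IsProbabilityMeasure (polydiscMeasure α) := by
  have := fun j => isProbabilityMeasure_discMeasure (hα j)
  unfold polydiscMeasure; infer_instance

theorem ae_mem_polydisc (α : Fin n → ℝ) : ∀ᵐ z ∂polydiscMeasure α, z ∈ polydisc n := by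
  unfold polydisc
  refine Filter.eventually_all.2 fun j => ?_
  exact (Measure.quasiMeasurePreserving_eval (fun j => discMeasure (α j)) j).ae
    (ae_discMeasure_norm_lt_one (α j))

theorem isOpen_polydisc : IsOpen (polydisc n) := by
  have : polydisc n = ⋂ j, {z | ‖z j‖ < 1} := by ext z; simp [polydisc]
  rw [this]
  exact isOpen_iInter_of_finite fun j => isOpen_lt (by fun_prop) continuous_const

theorem cons_mem_polydisc {x : ℂ} {y : Fin n → ℂ} :
    (Fin.cons x y : Fin (n + 1) → ℂ) ∈ polydisc (n + 1) ↔ ‖x‖ < 1 ∧ y ∈ polydisc n := by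
  simp [polydisc, Fin.forall_fin_succ]

theorem bergmanKernel_cons (α : Fin (n + 1) → ℝ) (x x' : ℂ) (y y' : Fin n → ℂ) :
    bergmanKernel α (Fin.cons x y : Fin (n + 1) → ℂ) (Fin.cons x' y' : Fin (n + 1) → ℂ) =
      discKernel (α 0) x x' * bergmanKernel (Fin.tail α) y y' := by
  rw [bergmanKernel_eq_prod, Fin.prod_univ_succ, bergmanKernel_eq_prod]
  simp [Fin.tail]

theorem measurable_cons :
    Measurable fun x : ℂ × (Fin n → ℂ) => (Fin.cons x.1 x.2 : Fin (n + 1) → ℂ) := by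
  refine measurable_pi_iff.2 fun j => ?_
  refine Fin.cases ?_ (fun i => ?_) j
  · simpa using measurable_fst
  · simpa using! (measurable_pi_apply i).comp measurable_snd

theorem measurable_cons_left (y : Fin n → ℂ) :
    Measurable fun x : ℂ => (Fin.cons x y : Fin (n + 1) → ℂ) :=
  measurable_cons.comp (measurable_id.prodMk measurable_const)

theorem measurable_cons_right (x : ℂ) :
    Measurable fun y : Fin n → ℂ => (Fin.cons x y : Fin (n + 1) → ℂ) :=
  measurable_cons.comp (measurable_const.prodMk measurable_id)

theorem differentiable_cons_left (y : Fin n → ℂ) :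
    Differentiable ℂ fun x : ℂ => (Fin.cons x y : Fin (n + 1) → ℂ) := by
  refine differentiable_pi.2 fun j => ?_
  refine Fin.cases ?_ (fun i => ?_) j
  · simp
  · simp

theorem differentiable_cons_right (x : ℂ) :
    Differentiable ℂ fun y : Fin n → ℂ => (Fin.cons x y : Fin (n + 1) → ℂ) := by
  refine differentiable_pi.2 fun j => ?_
  refine Fin.cases ?_ (fun i => ?_) j
  · simp
  · simp only [Fin.cons_succ]; fun_prop

theorem cons_eq_piFinSuccAbove_symm :
    (fun x : ℂ × (Fin n → ℂ) => (Fin.cons x.1 x.2 : Fin (n + 1) → ℂ)) =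
      (MeasurableEquiv.piFinSuccAbove (fun _ => ℂ) (0 : Fin (n + 1))).symm := by
  ext x j
  change _ = Fin.insertNth (α := fun _ => ℂ) 0 x.1 x.2 j
  rw [Fin.insertNth_zero']

theorem measurePreserving_cons (α : Fin (n + 1) → ℝ) :
    MeasurePreserving (fun x : ℂ × (Fin n → ℂ) => (Fin.cons x.1 x.2 : Fin (n + 1) → ℂ))
      ((discMeasure (α 0)).prod (polydiscMeasure (Fin.tail α))) (polydiscMeasure α) := by
  have h := (measurePreserving_piFinSuccAbove (fun j => discMeasure (α j)) 0).symm
  rw [cons_eq_piFinSuccAbove_symm]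
  exact h

theorem measurableEmbedding_cons :
    MeasurableEmbedding fun x : ℂ × (Fin n → ℂ) => (Fin.cons x.1 x.2 : Fin (n + 1) → ℂ) := by
  rw [cons_eq_piFinSuccAbove_symm]
  exact (MeasurableEquiv.piFinSuccAbove (fun _ => ℂ) (0 : Fin (n + 1))).symm.measurableEmbedding

theorem lintegral_polydiscMeasure_succ (α : Fin (n + 1) → ℝ) {F : (Fin (n + 1) → ℂ) → ℝ≥0∞}
    (hF : Measurable F) : ∫⁻ z, F z ∂polydiscMeasure α =
      ∫⁻ x, ∫⁻ y, F (Fin.cons x y) ∂polydiscMeasure (Fin.tail α) ∂discMeasure (α 0) := by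
  rw [← (measurePreserving_cons α).lintegral_comp hF, lintegral_prod]
  exact (hF.comp measurable_cons).aemeasurable

theorem lintegral_polydiscMeasure_succ_swap (α : Fin (n + 1) → ℝ)
    {F : (Fin (n + 1) → ℂ) → ℝ≥0∞} (hF : Measurable F) : ∫⁻ z, F z ∂polydiscMeasure α =
      ∫⁻ y, ∫⁻ x, F (Fin.cons x y) ∂discMeasure (α 0) ∂polydiscMeasure (Fin.tail α) := by
  rw [lintegral_polydiscMeasure_succ α hF, lintegral_lintegral_swap]
  exact (hF.comp measurable_cons).aemeasurable

@[fun_prop]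
theorem measurable_bergmanKernel (α : Fin n → ℝ) :
    Measurable fun x : (Fin n → ℂ) × (Fin n → ℂ) => bergmanKernel α x.1 x.2 := by
  simp only [bergmanKernel_eq_prod]
  refine Finset.measurable_fun_prod Finset.univ fun j _ => ?_
  fun_prop

/-! ### Carleson boxes, slices of weights and the weighted inequality on the polydisc -/

/-- The polydisc of Carleson regions centred at `ζ`. -/
def carlesonBox (ζ : Fin n → ℂ) : Set (Fin n → ℂ) :=
  {z | ∀ j, z j ∈ Metric.ball (ζ j) (5 * (12 * (1 - ‖ζ j‖)))}

/-- The size of `carlesonBox ζ`. -/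
def polyBoxSize (α : Fin n → ℝ) (ζ : Fin n → ℂ) : ℝ≥0∞ := ∏ j, boxSize (α j) (ζ j)

theorem measurableSet_carlesonBox (ζ : Fin n → ℂ) : MeasurableSet (carlesonBox ζ) := by
  have : carlesonBox ζ = ⋂ j, {z | z j ∈ Metric.ball (ζ j) (5 * (12 * (1 - ‖ζ j‖)))} := by
    ext z; simp [carlesonBox]
  rw [this]
  exact MeasurableSet.iInter fun j => measurable_pi_apply j Metric.isOpen_ball.measurableSet

theorem polyBoxSize_cons (α : Fin (n + 1) → ℝ) (x : ℂ) (y : Fin n → ℂ) :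
    polyBoxSize α (Fin.cons x y : Fin (n + 1) → ℂ) =
      boxSize (α 0) x * polyBoxSize (Fin.tail α) y := by
  simp [polyBoxSize, Fin.prod_univ_succ, Fin.tail]

theorem polyBoxSize_ne_zero (α : Fin n → ℝ) {ζ : Fin n → ℂ} (hζ : ζ ∈ polydisc n) :
    polyBoxSize α ζ ≠ 0 :=
  Finset.prod_ne_zero_iff.2 fun j _ => boxSize_ne_zero _ (hζ j)

theorem polyBoxSize_ne_top (α : Fin n → ℝ) (ζ : Fin n → ℂ) : polyBoxSize α ζ ≠ ∞ :=
  ENNReal.prod_ne_top fun _ _ => boxSize_ne_top _ _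

theorem setLIntegral_carlesonBox_cons (α : Fin (n + 1) → ℝ) {F : (Fin (n + 1) → ℂ) → ℝ≥0∞}
    (hF : Measurable F) (x : ℂ) (y : Fin n → ℂ) :
    ∫⁻ z in carlesonBox (Fin.cons x y : Fin (n + 1) → ℂ), F z ∂polydiscMeasure α =
      ∫⁻ x' in Metric.ball x (5 * (12 * (1 - ‖x‖))), ∫⁻ y' in carlesonBox y,
        F (Fin.cons x' y') ∂polydiscMeasure (Fin.tail α) ∂discMeasure (α 0) := by
  rw [← lintegral_indicator (measurableSet_carlesonBox _), lintegral_polydiscMeasure_succ α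
    (hF.indicator (measurableSet_carlesonBox _)), ← lintegral_indicator
    Metric.isOpen_ball.measurableSet]
  refine lintegral_congr fun x' => ?_
  by_cases hx : x' ∈ Metric.ball x (5 * (12 * (1 - ‖x‖)))
  · rw [Set.indicator_of_mem hx, ← lintegral_indicator (measurableSet_carlesonBox _)]
    refine lintegral_congr fun y' => ?_
    have : (Fin.cons x' y' : Fin (n + 1) → ℂ) ∈ carlesonBox (Fin.cons x y : Fin (n + 1) → ℂ) ↔
        y' ∈ carlesonBox y := by
      simp only [carlesonBox, Set.mem_ofPred_eq, Fin.forall_fin_succ, Fin.cons_zero, Fin.cons_succ]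
      exact and_iff_right hx
    by_cases hy : y' ∈ carlesonBox y
    · rw [Set.indicator_of_mem hy, Set.indicator_of_mem (this.2 hy)]
    · rw [Set.indicator_of_notMem hy, Set.indicator_of_notMem (fun h => hy (this.1 h))]
  · rw [Set.indicator_of_notMem hx]
    refine lintegral_eq_zero_of_ae_eq_zero (Filter.Eventually.of_forall fun y' => ?_)
    refine Set.indicator_of_notMem (fun h => hx ?_) _
    simpa using h 0

theorem setLIntegral_carlesonBox_cons_swap (α : Fin (n + 1) → ℝ) {F : (Fin (n + 1) → ℂ) → ℝ≥0∞}
    (hF : Measurable F) (x : ℂ) (y : Fin n → ℂ) :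
    ∫⁻ z in carlesonBox (Fin.cons x y : Fin (n + 1) → ℂ), F z ∂polydiscMeasure α =
      ∫⁻ y' in carlesonBox y, ∫⁻ x' in Metric.ball x (5 * (12 * (1 - ‖x‖))),
        F (Fin.cons x' y') ∂discMeasure (α 0) ∂polydiscMeasure (Fin.tail α) := by
  rw [setLIntegral_carlesonBox_cons α hF, lintegral_lintegral_swap]
  exact (hF.comp measurable_cons).aemeasurable

theorem differentiableOn_slice_left {f : (Fin (n + 1) → ℂ) → ℂ}
    (hf : DifferentiableOn ℂ f (polydisc (n + 1))) {y : Fin n → ℂ} (hy : y ∈ polydisc n) :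
    DifferentiableOn ℂ (fun x : ℂ => f (Fin.cons x y)) (Metric.ball 0 1) :=
  hf.comp (differentiable_cons_left y).differentiableOn fun x hx =>
    cons_mem_polydisc.2 ⟨by simpa using hx, hy⟩

theorem differentiableOn_slice_right {f : (Fin (n + 1) → ℂ) → ℂ}
    (hf : DifferentiableOn ℂ f (polydisc (n + 1))) {x : ℂ} (hx : ‖x‖ < 1) :
    DifferentiableOn ℂ (fun y : Fin n → ℂ => f (Fin.cons x y)) (polydisc n) :=
  hf.comp (differentiable_cons_right x).differentiableOn fun _ hy =>
    cons_mem_polydisc.2 ⟨hx, hy⟩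

/-- Sub-mean value property over Carleson boxes. -/
theorem exists_submean_polydisc : ∀ {n : ℕ} (α : Fin n → ℝ), (∀ j, -1 < α j) →
    ∃ c : ℝ≥0, 1 ≤ c ∧ ∀ {p : ℝ}, 1 < p → ∀ {h : (Fin n → ℂ) → ℂ}, Measurable h →
      DifferentiableOn ℂ h (polydisc n) → ∀ z ∈ polydisc n,
        ‖h z‖ₑ ^ p * polyBoxSize α z ≤
          c * ∫⁻ ζ in carlesonBox z, ‖h ζ‖ₑ ^ p ∂polydiscMeasure α := by
  intro n
  induction n with
  | zero =>
    intro α hα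
    have := isProbabilityMeasure_polydiscMeasure hα
    refine ⟨1, le_rfl, fun {p} hp {h} hm hd z hz => ?_⟩
    have h1 : carlesonBox z = Set.univ := by
      ext; simp [carlesonBox]
    rw [h1, Measure.restrict_univ, lintegral_unique, measure_univ, mul_one,
      polyBoxSize, Finset.prod_of_isEmpty, mul_one, ENNReal.coe_one, one_mul]
    exact (congrArg (fun z => ‖h z‖ₑ ^ p) (Subsingleton.elim z _)).le
  | succ n ih =>
    intro α hα
    obtain ⟨c', hc', ih⟩ := ih (Fin.tail α) fun j => hα _
    obtain ⟨c, hc, h1⟩ := exists_submean (hα 0)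
    refine ⟨c * c', one_le_mul hc hc', fun {p} hp {h} hm hd z hz => ?_⟩
    obtain ⟨x, y, rfl⟩ : ∃ x y, z = (Fin.cons x y : Fin (n + 1) → ℂ) :=
      ⟨z 0, Fin.tail z, (Fin.cons_self_tail z).symm⟩
    obtain ⟨hx, hy⟩ := cons_mem_polydisc.1 hz
    have hmp : Measurable fun z => ‖h z‖ₑ ^ p := hm.enorm.pow_const p
    have h2 := h1 hp (differentiableOn_slice_left hd hy) x hx
    rw [setLIntegral_carlesonBox_cons α hmp, polyBoxSize_cons]
    calc ‖h (Fin.cons x y)‖ₑ ^ p * (boxSize (α 0) x * polyBoxSize (Fin.tail α) y)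
        = (‖h (Fin.cons x y)‖ₑ ^ p * boxSize (α 0) x) * polyBoxSize (Fin.tail α) y := by ring
      -- Sub-mean value in the first variable with `y` fixed, then the inductive hypothesis in `y`
      -- for each `x'`.
      _ ≤ (c * ∫⁻ x' in Metric.ball x (12 * (1 - ‖x‖)), ‖h (Fin.cons x' y)‖ₑ ^ p
            ∂discMeasure (α 0)) * polyBoxSize (Fin.tail α) y := by gcongr
      _ = c * ∫⁻ x' in Metric.ball x (12 * (1 - ‖x‖)), ‖h (Fin.cons x' y)‖ₑ ^ p *
            polyBoxSize (Fin.tail α) y ∂discMeasure (α 0) := by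
          have hmy : Measurable fun x' : ℂ => ‖h (Fin.cons x' y)‖ₑ ^ p :=
            hmp.comp (measurable_cons_left y)
          rw [mul_assoc, lintegral_mul_const _ hmy]
      _ ≤ c * ∫⁻ x' in Metric.ball x (12 * (1 - ‖x‖)), c' * ∫⁻ y' in carlesonBox y,
            ‖h (Fin.cons x' y')‖ₑ ^ p ∂polydiscMeasure (Fin.tail α) ∂discMeasure (α 0) := by
          gcongr c * ?_
          refine lintegral_mono_ae ?_
          filter_upwards [ae_restrict_of_ae (ae_discMeasure_norm_lt_one (α 0))] with x' hx'
          exact ih hp (hm.comp (measurable_cons_right x')) (differentiableOn_slice_right hd hx') y hy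
      _ = c * c' * ∫⁻ x' in Metric.ball x (12 * (1 - ‖x‖)), ∫⁻ y' in carlesonBox y,
            ‖h (Fin.cons x' y')‖ₑ ^ p ∂polydiscMeasure (Fin.tail α) ∂discMeasure (α 0) := by
          rw [lintegral_const_mul' _ _ ENNReal.coe_ne_top, mul_assoc]
      _ ≤ _ := by
          push_cast
          gcongr c * c' * ?_
          exact lintegral_mono_set (Metric.ball_subset_ball (by linarith))

/-- A nonvanishing holomorphic function on the polydisc whose modulus satisfies the joint
`A_p` type condition over Carleson boxes. -/
structure IsPolyWeight (α : Fin n → ℝ) (p q : ℝ) (A : ℝ≥0∞) (f : (Fin n → ℂ) → ℂ) : Prop where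
  measurable : Measurable f
  differentiableOn : DifferentiableOn ℂ f (polydisc n)
  ne_zero : ∀ z ∈ polydisc n, f z ≠ 0
  le_mul : ∀ z ∈ polydisc n, (∫⁻ ζ in carlesonBox z, ‖f ζ‖ₑ ^ p ∂polydiscMeasure α) ^ (1 / p) *
    (∫⁻ ζ in carlesonBox z, ‖(f ζ)⁻¹‖ₑ ^ q ∂polydiscMeasure α) ^ (1 / q) ≤ A * polyBoxSize α z

/-- Passes the joint condition from a box to a slice. Because `1/p + 1/q = 1`, the sub-mean constant
`c` is paid once and the size `e` of the frozen factor cancels. -/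
theorem rpow_mul_rpow_le_of_mul_le {p q : ℝ} (hpq : p.HolderConjugate q)
    {a b e e' c X Y A : ℝ≥0∞} (he0 : e ≠ 0) (het : e ≠ ∞) (ha : a * e ≤ c * X) (hb : b * e ≤ c * Y)
    (h : X ^ (1 / p) * Y ^ (1 / q) ≤ A * (e * e')) :
    a ^ (1 / p) * b ^ (1 / q) ≤ c * A * e' := by
  have hp := hpq.one_div_nonneg
  have hq := hpq.symm.one_div_nonneg
  have hsum : ∀ x : ℝ≥0∞, x ^ (1 / p) * x ^ (1 / q) = x := fun x => by
    rw [← ENNReal.rpow_add_of_nonneg _ _ hp hq, one_div, one_div, hpq.inv_add_inv_eq_one,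
      ENNReal.rpow_one]
  refine (ENNReal.mul_le_mul_iff_left he0 het).1 ?_
  calc a ^ (1 / p) * b ^ (1 / q) * e
      = a ^ (1 / p) * b ^ (1 / q) * (e ^ (1 / p) * e ^ (1 / q)) := by rw [hsum]
    _ = (a * e) ^ (1 / p) * (b * e) ^ (1 / q) := by
        rw [ENNReal.mul_rpow_of_nonneg _ _ hp, ENNReal.mul_rpow_of_nonneg _ _ hq]; ring
    _ ≤ (c * X) ^ (1 / p) * (c * Y) ^ (1 / q) := by gcongr
    _ = (c ^ (1 / p) * c ^ (1 / q)) * (X ^ (1 / p) * Y ^ (1 / q)) := by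
        rw [ENNReal.mul_rpow_of_nonneg _ _ hp, ENNReal.mul_rpow_of_nonneg _ _ hq]; ring
    _ ≤ c * (A * (e * e')) := by rw [hsum]; gcongr
    _ = c * A * e' * e := by ring

/-- Sub-mean value in the frozen first variable, integrated over the box of the others. The ball of
radius `12(1-|x|)` has room inside the five times larger factor of the box. -/
theorem lintegral_slice_right_le {α : Fin (n + 1) → ℝ} {c : ℝ≥0} {p : ℝ}
    {h : (Fin (n + 1) → ℂ) → ℂ} (hm : Measurable h)
    {x : ℂ} (hc : ∀ y ∈ polydisc n, ‖h (Fin.cons x y)‖ₑ ^ p * boxSize (α 0) x ≤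
      c * ∫⁻ z in Metric.ball x (12 * (1 - ‖x‖)), ‖h (Fin.cons z y)‖ₑ ^ p ∂discMeasure (α 0))
    (hx : ‖x‖ < 1) (y : Fin n → ℂ) :
    (∫⁻ ζ in carlesonBox y, ‖h (Fin.cons x ζ)‖ₑ ^ p ∂polydiscMeasure (Fin.tail α)) *
      boxSize (α 0) x ≤ c * ∫⁻ ζ in carlesonBox (Fin.cons x y : Fin (n + 1) → ℂ), ‖h ζ‖ₑ ^ p
        ∂polydiscMeasure α := by
  have hmp : Measurable fun z => ‖h z‖ₑ ^ p := hm.enorm.pow_const p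
  have hmx : Measurable fun y : Fin n → ℂ => ‖h (Fin.cons x y)‖ₑ ^ p :=
    hmp.comp (measurable_cons_right x)
  rw [setLIntegral_carlesonBox_cons_swap α hmp, ← lintegral_mul_const _ hmx,
    ← lintegral_const_mul' _ _ ENNReal.coe_ne_top]
  refine lintegral_mono_ae ?_
  filter_upwards [ae_restrict_of_ae (ae_mem_polydisc (Fin.tail α))] with y' hy'
  refine (hc y' hy').trans ?_
  gcongr c * ?_
  exact lintegral_mono_set (Metric.ball_subset_ball (by linarith))

/-- The counterpart with the last `n` variables frozen. The ball in the remaining variable keeps the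
factor `5`, as the joint condition of `IsWeightPair` demands. -/
theorem lintegral_slice_left_le {α : Fin (n + 1) → ℝ} {c : ℝ≥0} {p : ℝ}
    {h : (Fin (n + 1) → ℂ) → ℂ} (hm : Measurable h) {y : Fin n → ℂ}
    (hc : ∀ x : ℂ, ‖x‖ < 1 → ‖h (Fin.cons x y)‖ₑ ^ p * polyBoxSize (Fin.tail α) y ≤
      c * ∫⁻ ζ in carlesonBox y, ‖h (Fin.cons x ζ)‖ₑ ^ p ∂polydiscMeasure (Fin.tail α)) (x : ℂ) :
    (∫⁻ z in Metric.ball x (5 * (12 * (1 - ‖x‖))), ‖h (Fin.cons z y)‖ₑ ^ p ∂discMeasure (α 0)) *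
      polyBoxSize (Fin.tail α) y ≤ c * ∫⁻ ζ in carlesonBox (Fin.cons x y : Fin (n + 1) → ℂ),
        ‖h ζ‖ₑ ^ p ∂polydiscMeasure α := by
  have hmp : Measurable fun z => ‖h z‖ₑ ^ p := hm.enorm.pow_const p
  have hmy : Measurable fun x : ℂ => ‖h (Fin.cons x y)‖ₑ ^ p :=
    hmp.comp (measurable_cons_left y)
  rw [setLIntegral_carlesonBox_cons α hmp, ← lintegral_mul_const _ hmy,
    ← lintegral_const_mul' _ _ ENNReal.coe_ne_top]
  refine lintegral_mono_ae ?_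
  filter_upwards [ae_restrict_of_ae (ae_discMeasure_norm_lt_one (α 0))] with x' hx'
  exact hc x' hx'

/-- The absence of zeros makes `1/f` holomorphic too, so that the sub-mean value property controls
both weights. The constant becomes `c A` uniformly in the frozen `x`. -/
theorem IsPolyWeight.slice_right {α : Fin (n + 1) → ℝ} {p q : ℝ} (hpq : p.HolderConjugate q)
    {A : ℝ≥0∞} {f : (Fin (n + 1) → ℂ) → ℂ} (hf : IsPolyWeight α p q A f) {c : ℝ≥0}
    (hc : ∀ {p : ℝ}, 1 < p → ∀ {h : ℂ → ℂ}, DifferentiableOn ℂ h (Metric.ball 0 1) →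
      ∀ x : ℂ, ‖x‖ < 1 → ‖h x‖ₑ ^ p * boxSize (α 0) x ≤
        c * ∫⁻ z in Metric.ball x (12 * (1 - ‖x‖)), ‖h z‖ₑ ^ p ∂discMeasure (α 0))
    {x : ℂ} (hx : ‖x‖ < 1) :
    IsPolyWeight (Fin.tail α) p q (c * A) fun y => f (Fin.cons x y) := by
  refine ⟨hf.measurable.comp (measurable_cons_right x),
    differentiableOn_slice_right hf.differentiableOn hx,
    fun y hy => hf.ne_zero _ (cons_mem_polydisc.2 ⟨hx, hy⟩), fun y hy => ?_⟩
  refine rpow_mul_rpow_le_of_mul_le hpq (boxSize_ne_zero (α 0) hx) (boxSize_ne_top _ _)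
    (lintegral_slice_right_le hf.measurable (fun y hy => ?_) hx y)
    (lintegral_slice_right_le hf.measurable.inv (fun y hy => ?_) hx y) ?_
  · exact hc hpq.lt (differentiableOn_slice_left hf.differentiableOn hy) x hx
  · refine hc hpq.symm.lt (h := fun x => (f (Fin.cons x y))⁻¹) ?_ x hx
    exact (differentiableOn_slice_left hf.differentiableOn hy).inv fun x hx =>
      hf.ne_zero _ (cons_mem_polydisc.2 ⟨by simpa using hx, hy⟩)
  · have := hf.le_mul (Fin.cons x y) (cons_mem_polydisc.2 ⟨hx, hy⟩)
    rwa [polyBoxSize_cons] at this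

theorem IsPolyWeight.slice_left {α : Fin (n + 1) → ℝ} {p q : ℝ} (hpq : p.HolderConjugate q)
    {A : ℝ≥0∞} {f : (Fin (n + 1) → ℂ) → ℂ} (hf : IsPolyWeight α p q A f) {c c' : ℝ≥0}
    (hc : ∀ {p : ℝ}, 1 < p → ∀ {h : ℂ → ℂ}, DifferentiableOn ℂ h (Metric.ball 0 1) →
      ∀ x : ℂ, ‖x‖ < 1 → ‖h x‖ₑ ^ p * boxSize (α 0) x ≤
        c * ∫⁻ z in Metric.ball x (12 * (1 - ‖x‖)), ‖h z‖ₑ ^ p ∂discMeasure (α 0))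
    (hc' : ∀ {p : ℝ}, 1 < p → ∀ {h : (Fin n → ℂ) → ℂ}, Measurable h →
      DifferentiableOn ℂ h (polydisc n) → ∀ z ∈ polydisc n,
        ‖h z‖ₑ ^ p * polyBoxSize (Fin.tail α) z ≤
          c' * ∫⁻ ζ in carlesonBox z, ‖h ζ‖ₑ ^ p ∂polydiscMeasure (Fin.tail α))
    {y : Fin n → ℂ} (hy : y ∈ polydisc n) :
    IsWeightPair (discMeasure (α 0)) (fun x => 12 * (1 - ‖x‖)) (boxSize (α 0)) p q c (c' * A)
      (fun x => ‖f (Fin.cons x y)‖ₑ) fun x => ‖(f (Fin.cons x y))⁻¹‖ₑ := by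
  have hm : Measurable fun x : ℂ => f (Fin.cons x y) :=
    hf.measurable.comp (measurable_cons_left y)
  have hne : ∀ x : ℂ, ‖x‖ < 1 → ∀ y ∈ polydisc n, f (Fin.cons x y) ≠ 0 := fun x hx y hy =>
    hf.ne_zero _ (cons_mem_polydisc.2 ⟨hx, hy⟩)
  have hr : ∀ x : ℂ, 0 < 12 * (1 - ‖x‖) → ‖x‖ < 1 := fun x hx => by linarith
  have hd := differentiableOn_slice_left hf.differentiableOn hy
  refine ⟨hm.enorm, hm.inv.enorm, fun x hx => ?_, fun x hx => hc hpq.lt hd x (hr x hx),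
    fun x hx => ?_, fun x hx => ?_⟩
  · have h0 := hne x (hr x hx) y hy
    rw [← enorm_mul, mul_inv_cancel₀ h0, enorm_one]
  · refine hc hpq.symm.lt (h := fun x => (f (Fin.cons x y))⁻¹) ?_ x (hr x hx)
    exact hd.inv fun x hx => hne x (by simpa using hx) y hy
  · refine rpow_mul_rpow_le_of_mul_le hpq (polyBoxSize_ne_zero (Fin.tail α) hy)
      (polyBoxSize_ne_top _ _) (lintegral_slice_left_le hf.measurable (fun x hx => ?_) x)
      (lintegral_slice_left_le hf.measurable.inv (fun x hx => ?_) x) ?_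
    · exact hc' hpq.lt (hf.measurable.comp (measurable_cons_right x))
        (differentiableOn_slice_right hf.differentiableOn hx) y hy
    · refine hc' hpq.symm.lt (h := fun y => (f (Fin.cons x y))⁻¹)
        (hf.measurable.comp (measurable_cons_right x)).inv ?_ y hy
      exact (differentiableOn_slice_right hf.differentiableOn hx).inv (hne x hx)
    · have := hf.le_mul (Fin.cons x y) (cons_mem_polydisc.2 ⟨hr x hx, hy⟩)
      rwa [polyBoxSize_cons, mul_comm (boxSize _ _)] at this

theorem le_rpow_mul_of_rpow_le {p : ℝ} (hp : 0 < p) {a b N : ℝ≥0∞}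
    (h : a ^ (1 / p) ≤ N * b ^ (1 / p)) : a ≤ N ^ p * b := by
  have := ENNReal.rpow_le_rpow h hp.le
  rwa [ENNReal.mul_rpow_of_nonneg _ _ hp.le, ← ENNReal.rpow_mul, ← ENNReal.rpow_mul,
    one_div_mul_cancel hp.ne', ENNReal.rpow_one, ENNReal.rpow_one] at this

set_option maxHeartbeats 1000000 in
/-- The weighted inequality for the modulus of the Bergman kernel of the polydisc. -/
theorem exists_weighted_bound_polydisc {p q : ℝ} (hpq : p.HolderConjugate q) :
    ∀ {n : ℕ} (α : Fin n → ℝ), (∀ j, -1 < α j) →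
    ∃ C : ℝ≥0, ∀ (A : ℝ≥0) (f : (Fin n → ℂ) → ℂ), 1 ≤ A → IsPolyWeight α p q A f →
      ∀ h : (Fin n → ℂ) → ℝ≥0∞, Measurable h →
        ∫⁻ z, (‖f z‖ₑ * ∫⁻ w, ‖bergmanKernel α z w‖ₑ * (‖(f w)⁻¹‖ₑ * h w) ∂polydiscMeasure α) ^ p
          ∂polydiscMeasure α ≤
          ((C : ℝ≥0∞) * A ^ (2 * n * max p q)) ^ p * ∫⁻ z, h z ^ p ∂polydiscMeasure α := by
  have hp0 := hpq.pos
  have hq0 := hpq.symm.pos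
  intro n
  induction n with
  | zero =>
    intro α hα
    have := isProbabilityMeasure_polydiscMeasure hα
    refine ⟨1, fun A f hA hf h hh => ?_⟩
    have h0 : ∀ z : Fin 0 → ℂ, ‖f z‖ₑ * ‖(f z)⁻¹‖ₑ = 1 := fun z => by
      have := hf.ne_zero z fun j => j.elim0
      rw [← enorm_mul, mul_inv_cancel₀ this, enorm_one]
    simp only [lintegral_unique, measure_univ, mul_one, bergmanKernel, Finset.prod_of_isEmpty,
      enorm_one, one_mul, Nat.cast_zero, mul_zero, zero_mul, ENNReal.rpow_zero, ENNReal.one_rpow,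
      ENNReal.coe_one]
    rw [← mul_assoc, h0, one_mul]
  | succ n ih =>
    intro α hα
    obtain ⟨Cn, ih⟩ := ih (Fin.tail α) fun j => hα _
    obtain ⟨c, hc1, hc⟩ := exists_submean (hα 0)
    obtain ⟨c', hc1', hc'⟩ := exists_submean_polydisc (Fin.tail α) fun j => hα _
    obtain ⟨C1, h1⟩ := exists_weighted_bound_disc (hα 0) hpq hc1 (fun x hx => by
      have := hc (p := 2) (by norm_num) (h := fun _ => 1) (differentiableOn_const 1) x hx
      simpa using this)
    set μ := discMeasure (α 0) with hμ
    set ν := polydiscMeasure (Fin.tail α) with hν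
    set m := max p q with hm
    have hm0 : 0 < m := lt_max_of_lt_left hp0
    refine ⟨(C1 * c' ^ (2 * m)) * (Cn * c ^ (2 * n * m)), fun A f hA hf h hh => ?_⟩
    have hcA : 1 ≤ c * A := one_le_mul hc1 hA
    have hcA' : 1 ≤ c' * A := one_le_mul hc1' hA
    have hfm := hf.measurable
    have hgm : Measurable fun z => ‖(f z)⁻¹‖ₑ * h z := hfm.inv.enorm.mul hh
    -- `U` carries out the integration in the last `n` variables. The kernel being a product, the
    -- full operator is the one-variable operator applied to `U` in `x`.
    set U : ℂ → (Fin n → ℂ) → ℝ≥0∞ := fun x w =>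
      ∫⁻ y, ‖bergmanKernel (Fin.tail α) w y‖ₑ * (‖(f (Fin.cons x y))⁻¹‖ₑ * h (Fin.cons x y)) ∂ν
      with hU
    have hcons3 : Measurable fun x : (ℂ × (Fin n → ℂ)) × (Fin n → ℂ) =>
        (Fin.cons x.1.1 x.2 : Fin (n + 1) → ℂ) :=
      measurable_cons.comp ((measurable_fst.comp measurable_fst).prodMk measurable_snd)
    have hUm : Measurable fun x : ℂ × (Fin n → ℂ) => U x.1 x.2 := by
      have h2 : Measurable fun x : (ℂ × (Fin n → ℂ)) × (Fin n → ℂ) =>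
          ‖bergmanKernel (Fin.tail α) x.1.2 x.2‖ₑ *
            (‖(f (Fin.cons x.1.1 x.2))⁻¹‖ₑ * h (Fin.cons x.1.1 x.2)) := by
        have h3 := hgm.comp hcons3
        simp only [Function.comp_def] at h3
        fun_prop
      exact Measurable.lintegral_prod_right' (ν := ν) h2
    have hUx : ∀ w, Measurable fun x => U x w := by
      clear_value U
      exact fun w => hUm.comp (g := fun x : ℂ × (Fin n → ℂ) => U x.1 x.2) measurable_prodMk_right
    have hT : ∀ w₀ w, ∫⁻ v, ‖bergmanKernel α (Fin.cons w₀ w : Fin (n + 1) → ℂ) v‖ₑ *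
        (‖(f v)⁻¹‖ₑ * h v) ∂polydiscMeasure α = ∫⁻ x, ‖discKernel (α 0) w₀ x‖ₑ * U x w ∂μ := by
      intro w₀ w
      have h2 : Measurable fun v => ‖bergmanKernel α (Fin.cons w₀ w : Fin (n + 1) → ℂ) v‖ₑ *
          (‖(f v)⁻¹‖ₑ * h v) := Measurable.mul (by fun_prop) hgm
      rw [lintegral_polydiscMeasure_succ α h2]
      refine lintegral_congr fun x => ?_
      have h3 : Measurable fun y : Fin n → ℂ => ‖bergmanKernel (Fin.tail α) w y‖ₑ *
          (‖(f (Fin.cons x y))⁻¹‖ₑ * h (Fin.cons x y)) :=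
        Measurable.mul (by fun_prop) (hgm.comp (measurable_cons_right x))
      rw [hU]
      simp only
      rw [← lintegral_const_mul _ h3]
      refine lintegral_congr fun y => ?_
      rw [bergmanKernel_cons, enorm_mul, mul_assoc]
    have hIm : Measurable fun z : Fin (n + 1) → ℂ =>
        ∫⁻ w, ‖bergmanKernel α z w‖ₑ * (‖(f w)⁻¹‖ₑ * h w) ∂polydiscMeasure α := by
      have h2 : Measurable fun x : (Fin (n + 1) → ℂ) × (Fin (n + 1) → ℂ) =>
          ‖bergmanKernel α x.1 x.2‖ₑ * (‖(f x.2)⁻¹‖ₑ * h x.2) :=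
        Measurable.mul (by fun_prop) (hgm.comp measurable_snd)
      exact h2.lintegral_prod_right'
    -- The one-variable inequality for the slice at height `y` is applied to `|f| U`, using `|f|⁻¹
    -- (|f| U) = U`. The quantity left on the right is exactly what the inductive hypothesis
    -- controls for fixed `x`.
    have hleft : ∀ y ∈ polydisc n, ∫⁻ x, (‖f (Fin.cons x y)‖ₑ *
        ∫⁻ x', ‖discKernel (α 0) x x'‖ₑ * U x' y ∂μ) ^ p ∂μ ≤
        ((C1 : ℝ≥0∞) * ((c' * A : ℝ≥0) : ℝ≥0∞) ^ (2 * m)) ^ p *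
          ∫⁻ x, (‖f (Fin.cons x y)‖ₑ * U x y) ^ p ∂μ := by
      intro y hy
      have hpair := hf.slice_left hpq hc hc' hy
      rw [← ENNReal.coe_mul] at hpair
      refine le_rpow_mul_of_rpow_le hp0 (le_trans (le_of_eq ?_)
        (h1 (c' * A) _ _ hcA' hpair (fun x => ‖f (Fin.cons x y)‖ₑ * U x y)
        ((hfm.comp (measurable_cons_left y)).enorm.mul (hUx y))))
      congr 1
      refine lintegral_congr fun x => ?_
      congr 2
      refine lintegral_congr_ae ?_
      filter_upwards [ae_discMeasure_norm_lt_one (α 0)] with x' hx'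
      have h0 := hf.ne_zero (Fin.cons x' y) (cons_mem_polydisc.2 ⟨hx', hy⟩)
      rw [← mul_assoc (‖(f _)⁻¹‖ₑ), ← enorm_mul, inv_mul_cancel₀ h0, enorm_one, one_mul]
    have hright : ∀ x : ℂ, ‖x‖ < 1 → ∫⁻ y, (‖f (Fin.cons x y)‖ₑ * U x y) ^ p ∂ν ≤
        ((Cn : ℝ≥0∞) * ((c * A : ℝ≥0) : ℝ≥0∞) ^ (2 * n * m)) ^ p *
          ∫⁻ y, h (Fin.cons x y) ^ p ∂ν := by
      intro x hx
      have hw := hf.slice_right hpq hc hx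
      rw [← ENNReal.coe_mul] at hw
      exact ih (c * A) _ hcA hw (fun y => h (Fin.cons x y)) (hh.comp (measurable_cons_right x))
    have hm1 : Measurable fun x : ℂ × (Fin n → ℂ) => (‖f (Fin.cons x.1 x.2)‖ₑ * U x.1 x.2) ^ p :=
      ((hfm.comp measurable_cons).enorm.mul hUm).pow_const p
    calc ∫⁻ z, (‖f z‖ₑ * ∫⁻ w, ‖bergmanKernel α z w‖ₑ * (‖(f w)⁻¹‖ₑ * h w) ∂polydiscMeasure α) ^ p
          ∂polydiscMeasure α
        = ∫⁻ y, ∫⁻ x, (‖f (Fin.cons x y)‖ₑ *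
            ∫⁻ x', ‖discKernel (α 0) x x'‖ₑ * U x' y ∂μ) ^ p ∂μ ∂ν := by
          have hm2 : Measurable fun z => (‖f z‖ₑ * ∫⁻ w, ‖bergmanKernel α z w‖ₑ *
              (‖(f w)⁻¹‖ₑ * h w) ∂polydiscMeasure α) ^ p := (hfm.enorm.mul hIm).pow_const p
          rw [lintegral_polydiscMeasure_succ_swap α hm2]
          simp only [hT, hμ, hν]
      _ ≤ ∫⁻ y, ((C1 : ℝ≥0∞) * ((c' * A : ℝ≥0) : ℝ≥0∞) ^ (2 * m)) ^ p *
            ∫⁻ x, (‖f (Fin.cons x y)‖ₑ * U x y) ^ p ∂μ ∂ν := by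
          refine lintegral_mono_ae ?_
          filter_upwards [ae_mem_polydisc (Fin.tail α)] with y hy using hleft y hy
      _ = ((C1 : ℝ≥0∞) * ((c' * A : ℝ≥0) : ℝ≥0∞) ^ (2 * m)) ^ p *
            ∫⁻ x, ∫⁻ y, (‖f (Fin.cons x y)‖ₑ * U x y) ^ p ∂ν ∂μ := by
          rw [lintegral_const_mul, lintegral_lintegral_swap]
          · exact (hm1.comp measurable_swap).aemeasurable
          · exact (hm1.comp measurable_swap).lintegral_prod_right'
      _ ≤ ((C1 : ℝ≥0∞) * ((c' * A : ℝ≥0) : ℝ≥0∞) ^ (2 * m)) ^ p *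
            ∫⁻ x, ((Cn : ℝ≥0∞) * ((c * A : ℝ≥0) : ℝ≥0∞) ^ (2 * n * m)) ^ p *
              ∫⁻ y, h (Fin.cons x y) ^ p ∂ν ∂μ := by
          refine mul_le_mul_right (lintegral_mono_ae ?_) _
          filter_upwards [ae_discMeasure_norm_lt_one (α 0)] with x hx using hright x hx
      _ = ((C1 : ℝ≥0∞) * ((c' * A : ℝ≥0) : ℝ≥0∞) ^ (2 * m)) ^ p *
            (((Cn : ℝ≥0∞) * ((c * A : ℝ≥0) : ℝ≥0∞) ^ (2 * n * m)) ^ p *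
              ∫⁻ z, h z ^ p ∂polydiscMeasure α) := by
          rw [lintegral_polydiscMeasure_succ α (hh.pow_const p), lintegral_const_mul]
          exact ((hh.pow_const p).comp measurable_cons).lintegral_prod_right'
      _ = _ := by
          rw [← mul_assoc, ← ENNReal.mul_rpow_of_nonneg _ _ hp0.le]
          congr 2
          -- One variable contributes `A^(2m)` and the other `n` contribute `A^(2nm)`; the slice
          -- constants `c` and `c'` go into `C`.
          rw [ENNReal.coe_mul c' A, ENNReal.coe_mul c A,
            ENNReal.mul_rpow_of_nonneg _ _ (by positivity),
            ENNReal.mul_rpow_of_nonneg _ _ (by positivity),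
            show 2 * ((n + 1 : ℕ) : ℝ) * m = 2 * m + 2 * n * m by push_cast; ring,
            ENNReal.rpow_add_of_nonneg _ _ (by positivity) (by positivity)]
          push_cast
          rw [ENNReal.coe_rpow_of_nonneg _ (by positivity),
            ENNReal.coe_rpow_of_nonneg _ (by positivity)]
          ring

/-! ### The kernel of the polydisc and the reproducing formula -/

theorem norm_bergmanKernel (α : Fin n → ℝ) (z w : Fin n → ℂ) :
    ‖bergmanKernel α z w‖ = ∏ j, (‖1 - z j * conj (w j)‖ ^ (α j + 2))⁻¹ := by
  rw [bergmanKernel_eq_prod, norm_prod]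
  simp only [norm_discKernel]

theorem conj_bergmanKernel (α : Fin n → ℝ) {z w : Fin n → ℂ} (hz : z ∈ polydisc n)
    (hw : w ∈ polydisc n) : conj (bergmanKernel α z w) = bergmanKernel α w z := by
  rw [bergmanKernel_eq_prod, bergmanKernel_eq_prod, map_prod]
  exact Finset.prod_congr rfl fun j _ => conj_discKernel _ (hz j) (hw j)

theorem norm_bergmanKernel_comm (α : Fin n → ℝ) (z w : Fin n → ℂ) :
    ‖bergmanKernel α z w‖ = ‖bergmanKernel α w z‖ := by
  rw [norm_bergmanKernel, norm_bergmanKernel]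
  refine Finset.prod_congr rfl fun j _ => ?_
  rw [← Complex.norm_conj (1 - z j * conj (w j))]
  simp [mul_comm]

theorem norm_discKernel_le {a : ℝ} (ha : -1 < a) {z w : ℂ} (hz : ‖z‖ ≤ 1) {r : ℝ} (hr : r < 1)
    (hw : ‖w‖ ≤ r) : ‖discKernel a z w‖ ≤ ((1 - r) ^ (a + 2))⁻¹ := by
  rw [norm_discKernel]
  have h1 : 1 - r ≤ ‖1 - z * conj w‖ := by
    have h2 : ‖z * conj w‖ ≤ r := by
      rw [norm_mul, Complex.norm_conj]
      exact (mul_le_of_le_one_left (norm_nonneg _) hz).trans hw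
    have h3 := norm_sub_norm_le (1 : ℂ) (z * conj w)
    rw [norm_one] at h3
    linarith
  have h4 : 0 < 1 - r := by linarith
  gcongr
  linarith

/-- An upper bound for `|K(z, w)|` that does not depend on `z`. -/
def kernelBound (α : Fin n → ℝ) (r : Fin n → ℝ) : ℝ := ∏ j, ((1 - r j) ^ (α j + 2))⁻¹

theorem norm_bergmanKernel_le {α : Fin n → ℝ} (hα : ∀ j, -1 < α j) {z w : Fin n → ℂ}
    (hz : ∀ j, ‖z j‖ ≤ 1) {r : Fin n → ℝ} (hr : ∀ j, r j < 1) (hw : ∀ j, ‖w j‖ ≤ r j) :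
    ‖bergmanKernel α z w‖ ≤ kernelBound α r := by
  rw [bergmanKernel_eq_prod, norm_prod]
  exact Finset.prod_le_prod (fun _ _ => norm_nonneg _) fun j _ =>
    norm_discKernel_le (hα j) (hz j) (hr j) (hw j)

theorem differentiableOn_bergmanKernel (α : Fin n → ℝ) {w : Fin n → ℂ} (hw : w ∈ polydisc n) :
    DifferentiableOn ℂ (fun z => bergmanKernel α z w) (polydisc n) := by
  simp only [bergmanKernel_eq_prod]
  intro z hz
  have hd : ∀ j, DifferentiableAt ℂ (fun z : Fin n → ℂ => discKernel (α j) (z j) (w j)) z :=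
    fun j => DifferentiableAt.comp (g := fun x => discKernel (α j) x (w j)) z
      (differentiableAt_discKernel (α j) (hz j) (hw j)) (differentiableAt_apply (𝕜 := ℂ) j z)
  exact (HasFDerivAt.finsetProd (u := Finset.univ)
    fun j _ => (hd j).hasFDerivAt).differentiableAt.differentiableWithinAt

theorem aestronglyMeasurable_of_differentiableOn (α : Fin n → ℝ) {f : (Fin n → ℂ) → ℂ}
    (hf : DifferentiableOn ℂ f (polydisc n)) : AEStronglyMeasurable f (polydiscMeasure α) := by
  have h := measurable_indicator_of_continuousOn isOpen_polydisc.measurableSet hf.continuousOn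
  refine h.stronglyMeasurable.aestronglyMeasurable.congr ?_
  filter_upwards [ae_mem_polydisc α] with z hz
  rw [Set.indicator_of_mem hz]

theorem ae_norm_bergmanKernel_le {α : Fin n → ℝ} (hα : ∀ j, -1 < α j) {w : Fin n → ℂ}
    (hw : w ∈ polydisc n) :
    ∀ᵐ z ∂polydiscMeasure α, ‖bergmanKernel α w z‖ ≤ kernelBound α fun j => ‖w j‖ := by
  filter_upwards [ae_mem_polydisc α] with z hz
  rw [norm_bergmanKernel_comm]
  exact norm_bergmanKernel_le hα (fun j => (hz j).le) hw fun j => le_rfl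

theorem integrable_mul_bergmanKernel {α : Fin n → ℝ} (hα : ∀ j, -1 < α j)
    {u : (Fin n → ℂ) → ℂ} (hu : Integrable u (polydiscMeasure α)) {w : Fin n → ℂ}
    (hw : w ∈ polydisc n) :
    Integrable (fun z => u z * bergmanKernel α w z) (polydiscMeasure α) := by
  have hm : Measurable fun z => bergmanKernel α w z := by fun_prop
  refine hu.mul_bdd hm.aestronglyMeasurable (c := kernelBound α fun j => ‖w j‖) ?_
  exact ae_norm_bergmanKernel_le hα hw

/-- The reproducing property of the Bergman kernel on `A¹`. -/
theorem bergmanProjection_eq_self : ∀ {n : ℕ} {α : Fin n → ℝ} (_ : ∀ j, -1 < α j)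
    {F : (Fin n → ℂ) → ℂ} (_ : DifferentiableOn ℂ F (polydisc n))
    (_ : Integrable F (polydiscMeasure α)) {w : Fin n → ℂ} (_ : w ∈ polydisc n),
    bergmanProjection α F w = F w
  | 0, α, hα, F, _, _, w, _ => by
    have := isProbabilityMeasure_polydiscMeasure hα
    rw [bergmanProjection, integral_unique]
    rw [Subsingleton.elim w default]
    simp only [bergmanKernel, Finset.prod_of_isEmpty, mul_one, probReal_univ, one_smul]
    exact congrArg F (Subsingleton.elim _ _)
  | n + 1, α, hα, F, hF, hFi, w, hw => by
    obtain ⟨w₀, w, rfl⟩ : ∃ w₀ w', w = Fin.cons w₀ w' := ⟨w 0, Fin.tail w, by simp⟩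
    obtain ⟨hw₀, hw'⟩ := cons_mem_polydisc.1 hw
    have hint := ((measurePreserving_cons α).integrable_comp_emb measurableEmbedding_cons).2
      (integrable_mul_bergmanKernel hα hFi hw)
    have hFc := ((measurePreserving_cons α).integrable_comp_emb measurableEmbedding_cons).2 hFi
    have hK : Measurable fun x : ℂ => discKernel (α 0) w₀ x := by fun_prop
    have hslice : ∀ᵐ y ∂polydiscMeasure (Fin.tail α),
        ∫ x, F (Fin.cons x y) * discKernel (α 0) w₀ x ∂discMeasure (α 0) = F (Fin.cons w₀ y) := by
      filter_upwards [ae_mem_polydisc (Fin.tail α), hFc.prod_left_ae] with y hy hi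
      exact integral_mul_discKernel (hα 0) (differentiableOn_slice_left hF hy) hi hw₀
    have hint₂ : Integrable (fun x : ℂ × (Fin n → ℂ) =>
        F (Fin.cons x.1 x.2) * discKernel (α 0) w₀ x.1)
        ((discMeasure (α 0)).prod (polydiscMeasure (Fin.tail α))) := by
      refine hFc.mul_bdd (c := ((1 - ‖w₀‖) ^ (α 0 + 2))⁻¹)
        (hK.comp measurable_fst).aestronglyMeasurable ?_
      refine (Measure.quasiMeasurePreserving_fst (μ := discMeasure (α 0))
        (ν := polydiscMeasure (Fin.tail α))).ae
        (p := fun x => ‖discKernel (α 0) w₀ x‖ ≤ ((1 - ‖w₀‖) ^ (α 0 + 2))⁻¹) ?_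
      filter_upwards [ae_discMeasure_norm_lt_one (α 0)] with x hx
      have h1 := norm_discKernel_le (hα 0) hx.le hw₀ le_rfl
      rwa [norm_discKernel, ← Complex.norm_conj, map_sub, map_one, map_mul, Complex.conj_conj,
        mul_comm, ← norm_discKernel] at h1
    -- A slice of an integrable function need not be integrable. Here it is almost everywhere a
    -- partial integral of `hint₂`, by the reproducing property in the first variable, and this is
    -- what the recursion needs.
    have hR : Integrable (fun y => F (Fin.cons w₀ y)) (polydiscMeasure (Fin.tail α)) :=
      hint₂.integral_prod_right.congr hslice
    simp only [Function.comp_def] at hint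
    rw [← bergmanProjection_eq_self (α := Fin.tail α) (fun j => hα j.succ)
      (differentiableOn_slice_right hF hw₀) hR hw', bergmanProjection, bergmanProjection,
      ← (measurePreserving_cons α).integral_comp measurableEmbedding_cons, integral_prod_symm _ hint]
    refine integral_congr_ae ?_
    filter_upwards [hslice] with y hy
    simp only [bergmanKernel_cons]
    rw [← hy, ← integral_mul_const]
    exact integral_congr_ae (.of_forall fun x => by ring)

theorem integrable_bergmanKernel {α : Fin n → ℝ} (hα : ∀ j, -1 < α j) {w : Fin n → ℂ}
    (hw : w ∈ polydisc n) : Integrable (fun z => bergmanKernel α z w) (polydiscMeasure α) := by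
  have := isProbabilityMeasure_polydiscMeasure hα
  have hm : Measurable fun z => bergmanKernel α z w := by fun_prop
  refine Integrable.of_bound hm.aestronglyMeasurable (kernelBound α fun j => ‖w j‖) ?_
  filter_upwards [ae_norm_bergmanKernel_le hα hw] with z hz
  rwa [norm_bergmanKernel_comm]

/-! ### Normalized kernels against Carleson boxes -/

/-- The value `K(w, w)` of the Bergman kernel on the diagonal. -/
def diagKernel (α : Fin n → ℝ) (w : Fin n → ℂ) : ℝ := ∏ j, ((1 - ‖w j‖ ^ 2) ^ (α j + 2))⁻¹

theorem one_sub_norm_sq_pos {w : ℂ} (hw : ‖w‖ < 1) : 0 < 1 - ‖w‖ ^ 2 := by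
  nlinarith [norm_nonneg w]

theorem diagKernel_pos (α : Fin n → ℝ) {w : Fin n → ℂ} (hw : w ∈ polydisc n) :
    0 < diagKernel α w :=
  Finset.prod_pos fun j _ => inv_pos.2 (Real.rpow_pos_of_pos (one_sub_norm_sq_pos (hw j)) _)

theorem bergmanKernel_self (α : Fin n → ℝ) {w : Fin n → ℂ} (hw : w ∈ polydisc n) :
    bergmanKernel α w w = (diagKernel α w : ℂ) := by
  rw [bergmanKernel, diagKernel, Complex.ofReal_prod]
  refine Finset.prod_congr rfl fun j _ => ?_
  have h : (1 : ℂ) - w j * conj (w j) = ((1 - ‖w j‖ ^ 2 : ℝ) : ℂ) := by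
    rw [Complex.mul_conj, Complex.normSq_eq_norm_sq]
    push_cast
    rfl
  rw [h, ← Complex.ofReal_cpow (one_sub_norm_sq_pos (hw j)).le, one_div, Complex.ofReal_inv]

theorem bergmanNorm_eq (α : Fin n → ℝ) {p : ℝ} (hp : 0 < p) (f : (Fin n → ℂ) → ℂ) :
    bergmanNorm α p f = (∫⁻ z, ‖f z‖ₑ ^ p ∂polydiscMeasure α) ^ (1 / p) := by
  rw [bergmanNorm, eLpNorm_eq_lintegral_rpow_enorm_toReal (by simpa using hp) ENNReal.ofReal_ne_top,
    ENNReal.toReal_ofReal hp.le]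

/-- The reproducing formula for the function `K(·,w)` at the point `w`. -/
theorem lintegral_enorm_bergmanKernel_sq {α : Fin n → ℝ} (hα : ∀ j, -1 < α j) {w : Fin n → ℂ}
    (hw : w ∈ polydisc n) :
    ∫⁻ z, ‖bergmanKernel α z w‖ₑ ^ (2 : ℝ) ∂polydiscMeasure α =
      ENNReal.ofReal (diagKernel α w) := by
  have hF := differentiableOn_bergmanKernel α hw
  have hi := integrable_bergmanKernel hα hw
  have h1 := bergmanProjection_eq_self hα hF hi hw
  have h2 := integrable_mul_bergmanKernel hα hi hw
  have h3 : (fun z => bergmanKernel α z w * bergmanKernel α w z) =ᵐ[polydiscMeasure α]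
      fun z => ((‖bergmanKernel α z w‖ ^ 2 : ℝ) : ℂ) := by
    filter_upwards [ae_mem_polydisc α] with z hz
    rw [← conj_bergmanKernel α hz hw, Complex.mul_conj, Complex.normSq_eq_norm_sq]
  rw [bergmanProjection, integral_congr_ae h3, integral_complex_ofReal, bergmanKernel_self α hw,
    Complex.ofReal_inj] at h1
  have h4 : Integrable (fun z => ‖bergmanKernel α z w‖ ^ 2) (polydiscMeasure α) := by
    exact (h2.congr h3).re
  rw [← h1, ofReal_integral_eq_lintegral_ofReal h4 (.of_forall fun z => by positivity)]
  refine lintegral_congr fun z => ?_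
  rw [ENNReal.ofReal_pow (norm_nonneg _), ofReal_norm, ← ENNReal.rpow_natCast]
  norm_num

theorem bergmanNorm_two_bergmanKernel {α : Fin n → ℝ} (hα : ∀ j, -1 < α j) {w : Fin n → ℂ}
    (hw : w ∈ polydisc n) :
    bergmanNorm α 2 (fun z => bergmanKernel α z w) = ENNReal.ofReal (Real.sqrt (diagKernel α w)) := by
  rw [bergmanNorm_eq α two_pos, lintegral_enorm_bergmanKernel_sq hα hw,
    ENNReal.ofReal_rpow_of_nonneg (diagKernel_pos α hw).le (by norm_num), Real.sqrt_eq_rpow]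

theorem normalizedKernel_eq {α : Fin n → ℝ} (hα : ∀ j, -1 < α j) {w : Fin n → ℂ}
    (hw : w ∈ polydisc n) (z : Fin n → ℂ) :
    normalizedKernel α w z = bergmanKernel α z w / (Real.sqrt (diagKernel α w) : ℂ) := by
  rw [normalizedKernel, bergmanNorm_two_bergmanKernel hα hw,
    ENNReal.toReal_ofReal (Real.sqrt_nonneg _)]

theorem enorm_normalizedKernel_sq {α : Fin n → ℝ} (hα : ∀ j, -1 < α j) {w : Fin n → ℂ}
    (hw : w ∈ polydisc n) (z : Fin n → ℂ) :
    ‖normalizedKernel α w z‖ₑ ^ (2 : ℝ) =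
      ‖bergmanKernel α z w‖ₑ ^ (2 : ℝ) * (ENNReal.ofReal (diagKernel α w))⁻¹ := by
  have hd := diagKernel_pos α hw
  rw [normalizedKernel_eq hα hw, div_eq_mul_inv, enorm_mul, ENNReal.mul_rpow_of_nonneg _ _ two_pos.le,
    enorm_inv (by exact_mod_cast (Real.sqrt_pos.2 hd).ne'), ← ofReal_norm (Complex.ofReal _),
    Complex.norm_real, Real.norm_of_nonneg (Real.sqrt_nonneg _), ENNReal.inv_rpow,
    ENNReal.ofReal_rpow_of_nonneg (Real.sqrt_nonneg _) two_pos.le, Real.rpow_two, Real.sq_sqrt hd.le]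

theorem bergmanNorm_two_normalizedKernel {α : Fin n → ℝ} (hα : ∀ j, -1 < α j) {w : Fin n → ℂ}
    (hw : w ∈ polydisc n) : bergmanNorm α 2 (normalizedKernel α w) = 1 := by
  have hd := diagKernel_pos α hw
  rw [bergmanNorm_eq α two_pos]
  simp only [enorm_normalizedKernel_sq hα hw]
  rw [lintegral_mul_const', lintegral_enorm_bergmanKernel_sq hα hw, ENNReal.mul_inv_cancel,
    ENNReal.one_rpow]
  · simpa using hd
  · exact ENNReal.ofReal_ne_top
  · simpa using hd

/-- On the enlarged region `|1 - z w̄| ≤ (1 - |w|²) + |w - z| ≤ 62(1 - |w|)`: the `62` is `2` from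
the first term and `5 · 12` from the radius. -/
theorem one_le_discKernel_sq_mul {a : ℝ} (ha : -1 < a) {w z : ℂ} (hw : ‖w‖ < 1) (hz : ‖z‖ < 1)
    (h : z ∈ Metric.ball w (5 * (12 * (1 - ‖w‖)))) :
    1 ≤ (62 : ℝ) ^ (2 * (a + 2)) * (‖discKernel a z w‖ ^ 2 * (1 - ‖w‖ ^ 2) ^ (a + 2) *
      (1 - ‖w‖) ^ (a + 2)) := by
  have h0 : 0 < 1 - ‖w‖ := by linarith
  have hs : 0 < a + 2 := by linarith
  rw [norm_discKernel]
  set t := ‖1 - z * conj w‖ with ht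
  have ht0 : 0 < t := norm_pos_iff.2 (one_sub_mul_conj_ne_zero hz hw)
  have htle : t ≤ 62 * (1 - ‖w‖) := by
    have h1 : 1 - z * conj w = ((1 - ‖w‖ ^ 2 : ℝ) : ℂ) + (w - z) * conj w := by
      push_cast
      rw [← Complex.ofReal_pow, ← Complex.normSq_eq_norm_sq, ← Complex.mul_conj]
      ring
    have h2 : t ≤ (1 - ‖w‖ ^ 2) + ‖w - z‖ * ‖w‖ := by
      rw [ht, h1]
      refine (norm_add_le _ _).trans ?_
      rw [norm_mul, Complex.norm_conj, Complex.norm_real, Real.norm_of_nonneg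
        (one_sub_norm_sq_pos hw).le]
    have h3 : ‖w - z‖ < 60 * (1 - ‖w‖) := by
      rw [Metric.mem_ball, dist_comm, dist_eq_norm] at h
      linarith
    nlinarith [norm_nonneg w, norm_nonneg (w - z)]
  have e1 : ((t ^ (a + 2))⁻¹) ^ 2 = (t ^ (2 * (a + 2)))⁻¹ := by
    rw [inv_pow, ← Real.rpow_natCast, ← Real.rpow_mul ht0.le, mul_comm]
    norm_num
  rw [e1]
  calc (1 : ℝ) = (t ^ (2 * (a + 2)))⁻¹ * t ^ (2 * (a + 2)) :=
        (inv_mul_cancel₀ (Real.rpow_pos_of_pos ht0 _).ne').symm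
    _ ≤ (t ^ (2 * (a + 2)))⁻¹ * (62 * (1 - ‖w‖)) ^ (2 * (a + 2)) := by gcongr
    _ = 62 ^ (2 * (a + 2)) * ((t ^ (2 * (a + 2)))⁻¹ * (1 - ‖w‖) ^ (a + 2) *
          (1 - ‖w‖) ^ (a + 2)) := by
        rw [Real.mul_rpow (by norm_num) h0.le, two_mul, Real.rpow_add h0]
        ring
    _ ≤ _ := by
        gcongr
        nlinarith [norm_nonneg w]

theorem exists_one_le_normalizedKernel {α : Fin n → ℝ} (hα : ∀ j, -1 < α j) :
    ∃ c : ℝ≥0, 1 ≤ c ∧ ∀ w ∈ polydisc n, ∀ z ∈ polydisc n, z ∈ carlesonBox w →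
      1 ≤ c * polyBoxSize α w * ‖normalizedKernel α w z‖ₑ ^ (2 : ℝ) := by
  have hs : ∀ j, 0 < α j + 2 := fun j => by linarith [hα j]
  refine ⟨(∏ j, (62 : ℝ) ^ (2 * (α j + 2))).toNNReal, ?_, fun w hw z hz hb => ?_⟩
  · rw [Real.one_le_toNNReal]
    exact Finset.one_le_prod fun j _ =>
      Real.one_le_rpow (by norm_num) (by have := hs j; positivity)
  have h1 : ∀ j, 0 ≤ 1 - ‖w j‖ := fun j => sub_nonneg.2 (hw j).le
  have h2 : ∀ j, 0 < (1 - ‖w j‖ ^ 2) ^ (α j + 2) := fun j =>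
    Real.rpow_pos_of_pos (one_sub_norm_sq_pos (hw j)) _
  have key : (1 : ℝ) ≤ ∏ j, (62 : ℝ) ^ (2 * (α j + 2)) * (‖discKernel (α j) (z j) (w j)‖ ^ 2 *
      (1 - ‖w j‖ ^ 2) ^ (α j + 2) * (1 - ‖w j‖) ^ (α j + 2)) :=
    Finset.one_le_prod fun j _ => one_le_discKernel_sq_mul (hα j) (hw j) (hz j) (hb j)
  rw [enorm_normalizedKernel_sq hα hw]
  have e1 : ((∏ j, (62 : ℝ) ^ (2 * (α j + 2))).toNNReal : ℝ≥0∞) =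
      ENNReal.ofReal (∏ j, (62 : ℝ) ^ (2 * (α j + 2))) := rfl
  have e2 : polyBoxSize α w = ENNReal.ofReal (∏ j, (1 - ‖w j‖) ^ (α j + 2)) := by
    rw [polyBoxSize, ENNReal.ofReal_prod_of_nonneg fun j _ => Real.rpow_nonneg (h1 j) _]
    rfl
  have e3 : ‖bergmanKernel α z w‖ₑ ^ (2 : ℝ) = ENNReal.ofReal (‖bergmanKernel α z w‖ ^ 2) := by
    rw [← ofReal_norm, ENNReal.ofReal_rpow_of_nonneg (norm_nonneg _) two_pos.le, Real.rpow_two]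
  rw [e1, e2, e3, ← ENNReal.ofReal_inv_of_pos (diagKernel_pos α hw),
    ← ENNReal.ofReal_mul (by positivity), ← ENNReal.ofReal_mul (by positivity),
    ← ENNReal.ofReal_mul (mul_nonneg (by positivity)
      (Finset.prod_nonneg fun j _ => Real.rpow_nonneg (h1 j) _)), ENNReal.one_le_ofReal]
  refine key.trans (le_of_eq ?_)
  rw [diagKernel, bergmanKernel_eq_prod, norm_prod, ← Finset.prod_pow, ← Finset.prod_inv_distrib,
    ← Finset.prod_mul_distrib, ← Finset.prod_mul_distrib, ← Finset.prod_mul_distrib]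
  refine Finset.prod_congr rfl fun j _ => ?_
  rw [inv_inv]
  ring

/-- Raise the lower bound for `|k_w|²` to the power `p/2`. The resulting factor `(c e)^(1/2)` does
not depend on `p`, so the product of the bounds for `p` and `q` carries exactly `c e`. -/
theorem setLIntegral_carlesonBox_le {α : Fin n → ℝ} {c : ℝ≥0} {w : Fin n → ℂ}
    (hc : ∀ z ∈ polydisc n, z ∈ carlesonBox w →
      1 ≤ c * polyBoxSize α w * ‖normalizedKernel α w z‖ₑ ^ (2 : ℝ)) {p : ℝ} (hp : 0 < p)
    (f : (Fin n → ℂ) → ℂ) :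
    (∫⁻ z in carlesonBox w, ‖f z‖ₑ ^ p ∂polydiscMeasure α) ^ (1 / p) ≤
      (c * polyBoxSize α w) ^ (1 / 2 : ℝ) * bergmanNorm α p fun z => f z * normalizedKernel α w z := by
  set e := c * polyBoxSize α w with he
  have het : e ≠ ∞ := ENNReal.mul_ne_top ENNReal.coe_ne_top (polyBoxSize_ne_top _ _)
  have h1 : ∫⁻ z in carlesonBox w, ‖f z‖ₑ ^ p ∂polydiscMeasure α ≤
      e ^ (p / 2) * ∫⁻ z, ‖f z * normalizedKernel α w z‖ₑ ^ p ∂polydiscMeasure α := by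
    rw [← lintegral_const_mul' _ _ (ENNReal.rpow_ne_top_of_nonneg (by positivity) het)]
    refine le_trans ?_ (setLIntegral_le_lintegral (carlesonBox w) _)
    refine lintegral_mono_ae ?_
    filter_upwards [ae_restrict_mem (measurableSet_carlesonBox w),
      ae_restrict_of_ae (ae_mem_polydisc α)] with z hz hz'
    have h2 := ENNReal.rpow_le_rpow (hc z hz' hz) (show 0 ≤ p / 2 by positivity)
    rw [ENNReal.one_rpow, ENNReal.mul_rpow_of_nonneg _ _ (by positivity), ← ENNReal.rpow_mul,
      mul_div_cancel₀ _ two_ne_zero] at h2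
    calc ‖f z‖ₑ ^ p = 1 * ‖f z‖ₑ ^ p := (one_mul _).symm
      _ ≤ (e ^ (p / 2) * ‖normalizedKernel α w z‖ₑ ^ p) * ‖f z‖ₑ ^ p := by gcongr
      _ = e ^ (p / 2) * ‖f z * normalizedKernel α w z‖ₑ ^ p := by
          rw [enorm_mul, ENNReal.mul_rpow_of_nonneg _ _ hp.le]
          ring
  rw [bergmanNorm_eq α hp]
  refine (ENNReal.rpow_le_rpow h1 (by positivity)).trans (le_of_eq ?_)
  rw [ENNReal.mul_rpow_of_nonneg _ _ (by positivity), ← ENNReal.rpow_mul]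
  congr 2
  field_simp

theorem HolderConjugate.rpow_mul_rpow {p q : ℝ} (hpq : p.HolderConjugate q) (x : ℝ≥0∞) :
    x ^ (1 / p) * x ^ (1 / q) = x := by
  rw [← ENNReal.rpow_add_of_nonneg _ _ hpq.one_div_nonneg hpq.symm.one_div_nonneg, one_div,
    one_div, hpq.inv_add_inv_eq_one, ENNReal.rpow_one]

theorem bergmanNorm_mul_le_sarason {α : Fin n → ℝ} {p q : ℝ} (f g : (Fin n → ℂ) → ℂ)
    {w : Fin n → ℂ} (hw : w ∈ polydisc n) :
    bergmanNorm α p (fun z => f z * normalizedKernel α w z) *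
      bergmanNorm α q (fun z => g z * normalizedKernel α w z) ≤ sarason α p q f g :=
  le_iSup₂_of_le w hw le_rfl

theorem exists_box_mul_le_sarason {p q : ℝ} (hpq : p.HolderConjugate q) {α : Fin n → ℝ}
    (hα : ∀ j, -1 < α j) : ∃ c : ℝ≥0, 1 ≤ c ∧ ∀ f g : (Fin n → ℂ) → ℂ, ∀ w ∈ polydisc n,
      (∫⁻ z in carlesonBox w, ‖f z‖ₑ ^ p ∂polydiscMeasure α) ^ (1 / p) *
        (∫⁻ z in carlesonBox w, ‖g z‖ₑ ^ q ∂polydiscMeasure α) ^ (1 / q) ≤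
        c * polyBoxSize α w * sarason α p q f g := by
  obtain ⟨c, hc1, hc⟩ := exists_one_le_normalizedKernel hα
  refine ⟨c, hc1, fun f g w hw => ?_⟩
  refine (mul_le_mul' (setLIntegral_carlesonBox_le (hc w hw) hpq.pos f)
    (setLIntegral_carlesonBox_le (hc w hw) hpq.symm.pos g)).trans ?_
  rw [mul_mul_mul_comm, ← ENNReal.rpow_add_of_nonneg _ _ (by norm_num) (by norm_num)]
  norm_num only [ENNReal.rpow_one]
  gcongr
  exact bergmanNorm_mul_le_sarason f g hw

/-- Sub-mean value for `f` with exponent `p` and for `g` with exponent `q` on the same box; the size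
of the box cancels. -/
theorem exists_mul_le_sarason {p q : ℝ} (hpq : p.HolderConjugate q) {α : Fin n → ℝ}
    (hα : ∀ j, -1 < α j) : ∃ c : ℝ≥0, ∀ f g : (Fin n → ℂ) → ℂ, Measurable f → Measurable g →
      DifferentiableOn ℂ f (polydisc n) → DifferentiableOn ℂ g (polydisc n) →
      ∀ w ∈ polydisc n, ‖f w‖ₑ * ‖g w‖ₑ ≤ c * sarason α p q f g := by
  obtain ⟨c, -, hc⟩ := exists_box_mul_le_sarason hpq hα
  obtain ⟨c', -, hc'⟩ := exists_submean_polydisc α hα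
  refine ⟨c' * c, fun f g hf hg hfd hgd w hw => ?_⟩
  have h := rpow_mul_rpow_le_of_mul_le hpq (e' := 1) (polyBoxSize_ne_zero α hw)
    (polyBoxSize_ne_top _ _) (hc' hpq.lt hf hfd w hw) (hc' hpq.symm.lt hg hgd w hw)
    ((hc f g w hw).trans (le_of_eq (by rw [mul_one, mul_right_comm])))
  rw [← ENNReal.rpow_mul, ← ENNReal.rpow_mul, mul_one_div_cancel hpq.pos.ne',
    mul_one_div_cancel hpq.symm.pos.ne', ENNReal.rpow_one, ENNReal.rpow_one, mul_one,
    ← mul_assoc] at h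
  rwa [ENNReal.coe_mul]

theorem exists_isPolyWeight_sarason {p q : ℝ} (hpq : p.HolderConjugate q) {α : Fin n → ℝ}
    (hα : ∀ j, -1 < α j) : ∃ c : ℝ≥0, 1 ≤ c ∧ ∀ f : (Fin n → ℂ) → ℂ, Measurable f →
      DifferentiableOn ℂ f (polydisc n) → (∀ z ∈ polydisc n, f z ≠ 0) →
      IsPolyWeight α p q (c * invariantConst α p q f) f := by
  obtain ⟨c, hc1, hc⟩ := exists_box_mul_le_sarason hpq hα
  refine ⟨c, hc1, fun f hf hfd h0 => ⟨hf, hfd, h0, fun z hz => ?_⟩⟩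
  refine (hc f (fun z => (f z)⁻¹) z hz).trans (le_of_eq ?_)
  rw [invariantConst]
  ring

/-- For the trivial weight the joint condition says that the measure of a box is at most `c` times
its size. This follows from `‖k_w‖₂ = 1` and the box estimate with exponent `2`. -/
theorem exists_isPolyWeight_one {p q : ℝ} (hpq : p.HolderConjugate q) {α : Fin n → ℝ}
    (hα : ∀ j, -1 < α j) : ∃ c : ℝ≥0, 1 ≤ c ∧ IsPolyWeight α p q c fun _ => 1 := by
  obtain ⟨c, hc1, hc⟩ := exists_one_le_normalizedKernel hα
  refine ⟨c, hc1, measurable_const, differentiableOn_const 1, fun _ _ => one_ne_zero,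
    fun w hw => ?_⟩
  have h := setLIntegral_carlesonBox_le (hc w hw) two_pos fun _ => 1
  simp only [one_mul] at h
  rw [show (fun z => normalizedKernel α w z) = normalizedKernel α w from rfl,
    bergmanNorm_two_normalizedKernel hα hw, mul_one] at h
  have h2 := (ENNReal.rpow_le_rpow_iff (by norm_num)).1 h
  simp only [enorm_one, ENNReal.one_rpow, inv_one] at h2 ⊢
  rwa [HolderConjugate.rpow_mul_rpow hpq]

/-! ### The Bergman projection: absolute bounds, composition with `ḡ`, holomorphy -/

/-- The integral operator with kernel `|K|`. -/
def absProjection (α : Fin n → ℝ) (u : (Fin n → ℂ) → ℂ) (z : Fin n → ℂ) : ℝ≥0∞ :=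
  ∫⁻ w, ‖bergmanKernel α z w‖ₑ * ‖u w‖ₑ ∂polydiscMeasure α

theorem enorm_bergmanProjection_le (α : Fin n → ℝ) (u : (Fin n → ℂ) → ℂ) (z : Fin n → ℂ) :
    ‖bergmanProjection α u z‖ₑ ≤ absProjection α u z := by
  refine (enorm_integral_le_lintegral_enorm _).trans (lintegral_mono fun w => ?_)
  rw [enorm_mul, mul_comm]

theorem measurable_absProjection (α : Fin n → ℝ) {u : (Fin n → ℂ) → ℂ} (hu : Measurable u) :
    Measurable (absProjection α u) := by
  have h : Measurable fun x : (Fin n → ℂ) × (Fin n → ℂ) =>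
      ‖bergmanKernel α x.1 x.2‖ₑ * ‖u x.2‖ₑ := by fun_prop
  exact h.lintegral_prod_right'

theorem stronglyMeasurable_bergmanProjection (α : Fin n → ℝ) {u : (Fin n → ℂ) → ℂ}
    (hu : Measurable u) : StronglyMeasurable (bergmanProjection α u) := by
  have h : Measurable fun x : (Fin n → ℂ) × (Fin n → ℂ) =>
      u x.2 * bergmanKernel α x.1 x.2 := by fun_prop
  exact h.stronglyMeasurable.integral_prod_right'

theorem bergmanProjection_congr_ae {α : Fin n → ℝ} {u v : (Fin n → ℂ) → ℂ}
    (h : u =ᵐ[polydiscMeasure α] v) : bergmanProjection α u = bergmanProjection α v := by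
  funext w
  refine integral_congr_ae ?_
  filter_upwards [h] with z hz
  rw [hz]

theorem exists_weighted_bound_absProjection {p q : ℝ} (hpq : p.HolderConjugate q)
    {α : Fin n → ℝ} (hα : ∀ j, -1 < α j) :
    ∃ C : ℝ≥0, ∀ (A : ℝ≥0) (f : (Fin n → ℂ) → ℂ), 1 ≤ A → IsPolyWeight α p q A f →
      ∀ u : (Fin n → ℂ) → ℂ, Measurable u →
        (∫⁻ z, (‖f z‖ₑ * absProjection α u z) ^ p ∂polydiscMeasure α) ^ (1 / p) ≤
          (C : ℝ≥0∞) * A ^ (2 * n * max p q) * bergmanNorm α p fun z => f z * u z := by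
  obtain ⟨C, hC⟩ := exists_weighted_bound_polydisc hpq α hα
  refine ⟨C, fun A f hA hf u hu => ?_⟩
  have h := hC A f hA hf (fun z => ‖f z‖ₑ * ‖u z‖ₑ) (hf.measurable.enorm.mul hu.enorm)
  have h1 : ∀ z, absProjection α u z = ∫⁻ w, ‖bergmanKernel α z w‖ₑ *
      (‖(f w)⁻¹‖ₑ * (‖f w‖ₑ * ‖u w‖ₑ)) ∂polydiscMeasure α := fun z => by
    refine lintegral_congr_ae ?_
    filter_upwards [ae_mem_polydisc α] with w hw
    rw [← mul_assoc ‖(f w)⁻¹‖ₑ, ← enorm_mul (f w)⁻¹, inv_mul_cancel₀ (hf.ne_zero w hw), enorm_one,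
      one_mul]
  simp only [← h1] at h
  have h2 := ENNReal.rpow_le_rpow h hpq.one_div_nonneg
  rw [ENNReal.mul_rpow_of_nonneg _ _ hpq.one_div_nonneg, ← ENNReal.rpow_mul,
    mul_one_div_cancel hpq.pos.ne', ENNReal.rpow_one] at h2
  rw [bergmanNorm_eq α hpq.pos]
  simpa only [enorm_mul] using h2

/-- Weighted bound with the weight `1`. It gives boundedness of `P` on `L^p` and the absolute
convergence needed for Fubini. -/
theorem exists_bound_absProjection {p q : ℝ} (hpq : p.HolderConjugate q)
    {α : Fin n → ℝ} (hα : ∀ j, -1 < α j) :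
    ∃ C : ℝ≥0, ∀ u : (Fin n → ℂ) → ℂ, Measurable u →
      (∫⁻ z, absProjection α u z ^ p ∂polydiscMeasure α) ^ (1 / p) ≤ C * bergmanNorm α p u := by
  obtain ⟨c, hc1, hc⟩ := exists_isPolyWeight_one hpq hα
  obtain ⟨C, hC⟩ := exists_weighted_bound_absProjection hpq hα
  refine ⟨C * c ^ (2 * n * max p q), fun u hu => ?_⟩
  have h := hC c _ hc1 hc u hu
  have hm : 0 ≤ 2 * n * max p q := by
    have := hpq.pos.le.trans (le_max_left p q)
    positivity
  simp only [enorm_one, one_mul] at h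
  rwa [ENNReal.coe_mul, ENNReal.coe_rpow_of_nonneg _ hm]

/-- If `g` is holomorphic, then `P(ḡ P u) = P(ḡ u)`. -/
theorem bergmanProjection_conj_mul_bergmanProjection {α : Fin n → ℝ} (hα : ∀ j, -1 < α j)
    {g u : (Fin n → ℂ) → ℂ} (hg : Measurable g) (hgd : DifferentiableOn ℂ g (polydisc n))
    (hgi : Integrable g (polydiscMeasure α)) (hu : Measurable u)
    (hfin : ∫⁻ z, ‖g z‖ₑ * absProjection α u z ∂polydiscMeasure α ≠ ∞) {w : Fin n → ℂ}
    (hw : w ∈ polydisc n) :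
    bergmanProjection α (fun z => conj (g z) * bergmanProjection α u z) w =
      bergmanProjection α (fun z => conj (g z) * u z) w := by
  have hm : Measurable fun x : (Fin n → ℂ) × (Fin n → ℂ) =>
      conj (g x.1) * bergmanKernel α w x.1 * (u x.2 * bergmanKernel α x.1 x.2) := by
    have : Measurable fun x : (Fin n → ℂ) × (Fin n → ℂ) => conj (g x.1) :=
      Complex.continuous_conj.measurable.comp (hg.comp measurable_fst)
    fun_prop
  -- `K(w,·)` is bounded for fixed `w`, so absolute integrability of the double integral reduces to
  -- `hfin`.
  have hint : Integrable (Function.uncurry fun z ζ : Fin n → ℂ =>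
      conj (g z) * bergmanKernel α w z * (u ζ * bergmanKernel α z ζ))
      ((polydiscMeasure α).prod (polydiscMeasure α)) := by
    refine ⟨hm.aestronglyMeasurable, ?_⟩
    rw [hasFiniteIntegral_iff_enorm]
    simp only [Function.uncurry_def]
    rw [lintegral_prod _ hm.enorm.aemeasurable]
    refine lt_of_le_of_lt (b := ∫⁻ z, ENNReal.ofReal (kernelBound α fun j => ‖w j‖) *
      (‖g z‖ₑ * absProjection α u z) ∂polydiscMeasure α) ?_ ?_
    · refine lintegral_mono_ae ?_
      filter_upwards [ae_norm_bergmanKernel_le hα hw] with z hz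
      have h1 : Measurable fun ζ => ‖bergmanKernel α z ζ‖ₑ * ‖u ζ‖ₑ := by fun_prop
      calc ∫⁻ ζ, ‖conj (g z) * bergmanKernel α w z * (u ζ * bergmanKernel α z ζ)‖ₑ
            ∂polydiscMeasure α
          = ∫⁻ ζ, ‖g z‖ₑ * ‖bergmanKernel α w z‖ₑ * (‖bergmanKernel α z ζ‖ₑ * ‖u ζ‖ₑ)
            ∂polydiscMeasure α := by
            refine lintegral_congr fun ζ => ?_
            rw [enorm_mul, enorm_mul, enorm_mul, mul_comm ‖u ζ‖ₑ,
              ← ofReal_norm (conj (g z)), Complex.norm_conj, ofReal_norm]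
        _ = ‖bergmanKernel α w z‖ₑ * (‖g z‖ₑ * absProjection α u z) := by
            rw [lintegral_const_mul _ h1, absProjection]
            ring
        _ ≤ _ := by
            gcongr
            rw [← ofReal_norm]
            exact ENNReal.ofReal_le_ofReal hz
    · rw [lintegral_const_mul' _ _ ENNReal.ofReal_ne_top]
      exact ENNReal.mul_lt_top ENNReal.ofReal_lt_top (lt_top_iff_ne_top.2 hfin)
  have hgK : DifferentiableOn ℂ (fun z => g z * bergmanKernel α z w) (polydisc n) :=
    hgd.mul (differentiableOn_bergmanKernel α hw)
  have hgKi : Integrable (fun z => g z * bergmanKernel α z w) (polydiscMeasure α) := by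
    refine hgi.mul_bdd (c := kernelBound α fun j => ‖w j‖)
      (integrable_bergmanKernel hα hw).aestronglyMeasurable ?_
    filter_upwards [ae_norm_bergmanKernel_le hα hw] with z hz
    rwa [norm_bergmanKernel_comm]
  calc bergmanProjection α (fun z => conj (g z) * bergmanProjection α u z) w
      = ∫ z, ∫ ζ, conj (g z) * bergmanKernel α w z * (u ζ * bergmanKernel α z ζ)
          ∂polydiscMeasure α ∂polydiscMeasure α := by
        refine integral_congr_ae (.of_forall fun z => ?_)
        simp only [bergmanProjection]
        rw [integral_const_mul]
        ring
    _ = ∫ ζ, ∫ z, conj (g z) * bergmanKernel α w z * (u ζ * bergmanKernel α z ζ)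
          ∂polydiscMeasure α ∂polydiscMeasure α := integral_integral_swap hint
    _ = bergmanProjection α (fun z => conj (g z) * u z) w := by
        refine integral_congr_ae ?_
        filter_upwards [ae_mem_polydisc α] with ζ hζ
        -- After the exchange, the integral in `z` is the conjugate of `P(g K(·,w))(ζ) = g(ζ)
        -- K(ζ,w)`.
        have h1 := bergmanProjection_eq_self hα hgK hgKi hζ
        have h2 := congrArg conj h1
        rw [bergmanProjection, ← integral_conj, map_mul, conj_bergmanKernel α hζ hw] at h2
        rw [mul_right_comm, ← h2, ← integral_mul_const]
        refine integral_congr_ae ?_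
        filter_upwards [ae_mem_polydisc α] with z hz
        rw [map_mul, map_mul, conj_bergmanKernel α hz hw, conj_bergmanKernel α hζ hz]
        ring

theorem hasDerivAt_discKernel (a : ℝ) {z w : ℂ} (hz : ‖z‖ < 1) (hw : ‖w‖ < 1) :
    HasDerivAt (fun z => discKernel a z w) ((a + 2 : ℝ) * conj w * discKernel (a + 1) z w) z := by
  have h := one_sub_mul_conj_re_pos hz hw
  have h0 := one_sub_mul_conj_ne_zero hz hw
  have h1 : HasDerivAt (fun z : ℂ => 1 - z * conj w) (-conj w) z := by
    simpa using ((hasDerivAt_id z).mul_const (conj w)).const_sub 1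
  have h2 := h1.cpow_const (c := -((a + 2 : ℝ) : ℂ)) (Or.inl h)
  refine (h2.congr_of_eventuallyEq (.of_forall fun z => ?_)).congr_deriv ?_
  · simp only [discKernel, Complex.cpow_neg, one_div]
  · rw [discKernel, one_div, ← Complex.cpow_neg]
    have : -((a + 2 : ℝ) : ℂ) - 1 = -((a + 1 + 2 : ℝ) : ℂ) := by push_cast; ring
    rw [this]
    ring

/-- The derivative of `K(·, w)` at `z`. -/
def kernelDeriv (α : Fin n → ℝ) (z w : Fin n → ℂ) : (Fin n → ℂ) →L[ℂ] ℂ :=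
  ∑ i, (∏ j ∈ Finset.univ.erase i, discKernel (α j) (z j) (w j)) •
    (((α i + 2 : ℝ) * conj (w i) * discKernel (α i + 1) (z i) (w i)) •
      ContinuousLinearMap.proj (R := ℂ) (φ := fun _ : Fin n => ℂ) i)

theorem hasFDerivAt_bergmanKernel (α : Fin n → ℝ) {z w : Fin n → ℂ} (hz : z ∈ polydisc n)
    (hw : w ∈ polydisc n) :
    HasFDerivAt (fun z => bergmanKernel α z w) (kernelDeriv α z w) z := by
  simp only [bergmanKernel_eq_prod]
  refine HasFDerivAt.finsetProd (u := Finset.univ)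
    (g := fun j (z : Fin n → ℂ) => discKernel (α j) (z j) (w j)) fun j _ => ?_
  exact HasDerivAt.comp_hasFDerivAt (h₂ := fun x => discKernel (α j) x (w j)) z
    (hasDerivAt_discKernel (α j) (hz j) (hw j)) (ContinuousLinearMap.proj (R := ℂ) (φ := fun _ : Fin n => ℂ) j).hasFDerivAt

theorem stronglyMeasurable_kernelDeriv (α : Fin n → ℝ) (z : Fin n → ℂ) :
    StronglyMeasurable fun w => kernelDeriv α z w := by
  unfold kernelDeriv
  refine Finset.stronglyMeasurable_fun_sum _ fun i _ => ?_
  have h1 : Measurable fun w : Fin n → ℂ => ∏ j ∈ Finset.univ.erase i,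
      discKernel (α j) (z j) (w j) :=
    Finset.measurable_fun_prod _ fun j _ => by fun_prop
  have h2 : Measurable fun w : Fin n → ℂ =>
      (α i + 2 : ℝ) * conj (w i) * discKernel (α i + 1) (z i) (w i) := by
    have : Measurable fun w : Fin n → ℂ => conj (w i) :=
      Complex.continuous_conj.measurable.comp (measurable_pi_apply i)
    fun_prop
  exact h1.stronglyMeasurable.smul (h2.stronglyMeasurable.smul_const _)

theorem exists_norm_kernelDeriv_le {α : Fin n → ℝ} (hα : ∀ j, -1 < α j) {r : ℝ} (hr : r < 1) :
    ∃ B : ℝ, ∀ z w : Fin n → ℂ, (∀ j, ‖z j‖ ≤ r) → w ∈ polydisc n → ‖kernelDeriv α z w‖ ≤ B := by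
  refine ⟨∑ i, (∏ j ∈ Finset.univ.erase i, ((1 - r) ^ (α j + 2))⁻¹) *
    ((α i + 2) * 1 * ((1 - r) ^ (α i + 1 + 2))⁻¹ *
      ‖ContinuousLinearMap.proj (R := ℂ) (φ := fun _ : Fin n => ℂ) i‖), fun z w hz hw => ?_⟩
  have hk : ∀ (a : ℝ) (j : Fin n), -1 < a →
      ‖discKernel a (z j) (w j)‖ ≤ ((1 - r) ^ (a + 2))⁻¹ := fun a j ha => by
    have h1 := norm_discKernel_le ha (hw j).le hr (hz j)
    rwa [norm_discKernel, ← Complex.norm_conj, map_sub, map_one, map_mul, Complex.conj_conj,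
      mul_comm, ← norm_discKernel] at h1
  refine (norm_sum_le _ _).trans (Finset.sum_le_sum fun i _ => ?_)
  have hi := hα i
  rw [norm_smul, norm_smul, norm_mul, norm_mul, Complex.norm_conj, Complex.norm_real,
    Real.norm_of_nonneg (by linarith : 0 ≤ α i + 2), norm_prod]
  have h1r : 0 ≤ 1 - r := by linarith
  have h2 : ∏ j ∈ Finset.univ.erase i, ‖discKernel (α j) (z j) (w j)‖ ≤
      ∏ j ∈ Finset.univ.erase i, ((1 - r) ^ (α j + 2))⁻¹ :=
    Finset.prod_le_prod (fun _ _ => norm_nonneg _) fun j _ => hk _ j (hα j)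
  have h3 : (0 : ℝ) ≤ ∏ j ∈ Finset.univ.erase i, ((1 - r) ^ (α j + 2))⁻¹ :=
    Finset.prod_nonneg fun j _ => by positivity
  refine mul_le_mul h2 (mul_le_mul_of_nonneg_right (mul_le_mul (mul_le_mul_of_nonneg_left
    (hw i).le (by linarith)) (hk _ i (by linarith)) (norm_nonneg _) (by linarith))
    (norm_nonneg _)) ?_ h3
  have : (0 : ℝ) ≤ α i + 2 := by linarith
  positivity

/-- The Bergman projection of an integrable function is holomorphic. -/
theorem differentiableOn_bergmanProjection {α : Fin n → ℝ} (hα : ∀ j, -1 < α j)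
    {u : (Fin n → ℂ) → ℂ} (hu : Integrable u (polydiscMeasure α)) :
    DifferentiableOn ℂ (bergmanProjection α u) (polydisc n) := by
  intro z hz
  refine DifferentiableAt.differentiableWithinAt ?_
  -- On the smaller polydisc of radius `r` the derivative of the kernel is bounded uniformly in the
  -- integration variable, which dominates differentiation under the integral.
  obtain ⟨r, hr0, hr1, hr⟩ : ∃ r : ℝ, 0 ≤ r ∧ r < 1 ∧ ∀ j, ‖z j‖ < r := by
    have h1 : ‖z‖ < 1 := (pi_norm_lt_iff one_pos).2 hz
    obtain ⟨r, h2, h3⟩ := exists_between h1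
    exact ⟨r, (norm_nonneg z).trans h2.le, h3, fun j => (norm_le_pi_norm z j).trans_lt h2⟩
  obtain ⟨B, hB⟩ := exists_norm_kernelDeriv_le hα hr1
  have hopen : IsOpen {z : Fin n → ℂ | ∀ j, ‖z j‖ < r} := by
    have : {z : Fin n → ℂ | ∀ j, ‖z j‖ < r} = ⋂ j, {z | ‖z j‖ < r} := by ext z; simp
    rw [this]
    exact isOpen_iInter_of_finite fun j => isOpen_lt (by fun_prop) continuous_const
  have hsub : ∀ x ∈ {z : Fin n → ℂ | ∀ j, ‖z j‖ < r}, x ∈ polydisc n :=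
    fun x hx j => (hx j).trans hr1
  refine (hasFDerivAt_integral_of_dominated_of_fderiv_le (𝕜 := ℂ)
    (F := fun z ζ => u ζ * bergmanKernel α z ζ) (F' := fun z ζ => u ζ • kernelDeriv α z ζ)
    (bound := fun ζ => ‖u ζ‖ * B) (hopen.mem_nhds hr) ?_
    (integrable_mul_bergmanKernel hα hu hz) ?_ ?_ (hu.norm.mul_const B) ?_).differentiableAt
  · filter_upwards [hopen.mem_nhds hr] with x hx
    exact (integrable_mul_bergmanKernel hα hu (hsub x hx)).aestronglyMeasurable
  · exact hu.aestronglyMeasurable.smul (stronglyMeasurable_kernelDeriv α z).aestronglyMeasurable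
  · filter_upwards [ae_mem_polydisc α] with ζ hζ x hx
    rw [norm_smul]
    gcongr
    exact hB x ζ (fun j => (hx j).le) hζ
  · filter_upwards [ae_mem_polydisc α] with ζ hζ x hx
    exact (hasFDerivAt_bergmanKernel α (hsub x hx) hζ).const_mul (u ζ)

/-! ### Comparing `[f]`, `[f, g]` and `η` -/

theorem rpow_lintegral_le_mul {X : Type*} [MeasurableSpace X] {μ : Measure X} {p : ℝ} (hp : 0 < p)
    {F G : X → ℝ≥0∞} {c : ℝ≥0∞} (hc : c ≠ ∞) (h : ∀ᵐ x ∂μ, F x ≤ c * G x) :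
    (∫⁻ x, F x ^ p ∂μ) ^ (1 / p) ≤ c * (∫⁻ x, G x ^ p ∂μ) ^ (1 / p) := by
  have h1 : ∫⁻ x, F x ^ p ∂μ ≤ c ^ p * ∫⁻ x, G x ^ p ∂μ := by
    rw [← lintegral_const_mul' _ _ (ENNReal.rpow_ne_top_of_nonneg hp.le hc)]
    refine lintegral_mono_ae ?_
    filter_upwards [h] with x hx
    rw [← ENNReal.mul_rpow_of_nonneg _ _ hp.le]
    gcongr
  refine (ENNReal.rpow_le_rpow h1 (by positivity)).trans (le_of_eq ?_)
  rw [ENNReal.mul_rpow_of_nonneg _ _ (by positivity), ← ENNReal.rpow_mul,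
    mul_one_div_cancel hp.ne', ENNReal.rpow_one]

theorem bergmanNorm_le_mul {α : Fin n → ℝ} {p : ℝ} (hp : 0 < p) {u v : (Fin n → ℂ) → ℂ}
    {c : ℝ≥0∞} (hc : c ≠ ∞) (h : ∀ z ∈ polydisc n, ‖u z‖ₑ ≤ c * ‖v z‖ₑ) :
    bergmanNorm α p u ≤ c * bergmanNorm α p v := by
  rw [bergmanNorm_eq α hp, bergmanNorm_eq α hp]
  refine rpow_lintegral_le_mul hp hc ?_
  filter_upwards [ae_mem_polydisc α] with z hz using h z hz

theorem infProd_le (f g : (Fin n → ℂ) → ℂ) {z : Fin n → ℂ} (hz : z ∈ polydisc n) :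
    infProd f g ≤ ‖f z‖ₑ * ‖g z‖ₑ := iInf₂_le z hz

theorem zero_mem_polydisc : (0 : Fin n → ℂ) ∈ polydisc n := fun j => by simp

theorem infProd_ne_top (f g : (Fin n → ℂ) → ℂ) : infProd f g ≠ ∞ :=
  ne_top_of_le_ne_top (ENNReal.mul_ne_top enorm_ne_top enorm_ne_top)
    (infProd_le f g zero_mem_polydisc)

theorem ne_zero_of_infProd_pos {f g : (Fin n → ℂ) → ℂ} (h : 0 < infProd f g) {z : Fin n → ℂ}
    (hz : z ∈ polydisc n) : f z ≠ 0 ∧ g z ≠ 0 := by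
  have h1 := h.trans_le (infProd_le f g hz)
  constructor <;> rintro h0 <;> simp [h0] at h1

theorem enorm_inv_le_of_infProd {f g : (Fin n → ℂ) → ℂ} (h : 0 < infProd f g) {z : Fin n → ℂ}
    (hz : z ∈ polydisc n) : ‖(f z)⁻¹‖ₑ ≤ (infProd f g)⁻¹ * ‖g z‖ₑ := by
  have h0 := (ne_zero_of_infProd_pos h hz).1
  rw [enorm_inv h0, mul_comm, ← div_eq_mul_inv, ENNReal.le_div_iff_mul_le (.inl h.ne')
    (.inl (infProd_ne_top f g)), mul_comm, ← div_eq_mul_inv]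
  exact ENNReal.div_le_of_le_mul' (infProd_le f g hz)

theorem infProd_comm (f g : (Fin n → ℂ) → ℂ) : infProd f g = infProd g f := by
  simp only [infProd, mul_comm]

/-- From `|f|⁻¹ ≤ η⁻¹ |g|` pointwise. This linear bound is the one fed into the weighted inequality,
and it accounts for the power of `η` in the norm estimate. -/
theorem invariantConst_le {α : Fin n → ℝ} {p q : ℝ} (hpq : p.HolderConjugate q)
    {f g : (Fin n → ℂ) → ℂ} (h : 0 < infProd f g) :
    invariantConst α p q f ≤ (infProd f g)⁻¹ * sarason α p q f g := by
  refine iSup₂_le fun w hw => ?_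
  have h1 : bergmanNorm α q (fun z => (f z)⁻¹ * normalizedKernel α w z) ≤
      (infProd f g)⁻¹ * bergmanNorm α q (fun z => g z * normalizedKernel α w z) := by
    refine bergmanNorm_le_mul hpq.symm.pos (ENNReal.inv_ne_top.2 h.ne') fun z hz => ?_
    rw [enorm_mul, enorm_mul, ← mul_assoc]
    gcongr
    exact enorm_inv_le_of_infProd h hz
  calc _ ≤ bergmanNorm α p (fun z => f z * normalizedKernel α w z) *
        ((infProd f g)⁻¹ * bergmanNorm α q (fun z => g z * normalizedKernel α w z)) := by gcongr
    _ = (infProd f g)⁻¹ * (bergmanNorm α p (fun z => f z * normalizedKernel α w z) *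
        bergmanNorm α q (fun z => g z * normalizedKernel α w z)) := by ring
    _ ≤ _ := by gcongr; exact bergmanNorm_mul_le_sarason f g hw

theorem measurable_normalizedKernel (α : Fin n → ℝ) (w : Fin n → ℂ) :
    Measurable (normalizedKernel α w) := by
  unfold normalizedKernel
  exact Measurable.div_const (by fun_prop) _

theorem lintegral_mul_le_bergmanNorm {α : Fin n → ℝ} {p q : ℝ} (hpq : p.HolderConjugate q)
    {u v : (Fin n → ℂ) → ℂ} (hu : AEStronglyMeasurable u (polydiscMeasure α))
    (hv : AEStronglyMeasurable v (polydiscMeasure α)) :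
    ∫⁻ z, ‖u z‖ₑ * ‖v z‖ₑ ∂polydiscMeasure α ≤ bergmanNorm α p u * bergmanNorm α q v := by
  rw [bergmanNorm_eq α hpq.pos, bergmanNorm_eq α hpq.symm.pos]
  exact ENNReal.lintegral_mul_le_Lp_mul_Lq _ hpq hu.enorm hv.enorm

/-- Take `w = 0`: by Hölder the product of norms dominates `∫ |fg| |k_0|²`, and `‖k_0‖₂ = 1`. -/
theorem infProd_le_sarason {α : Fin n → ℝ} (hα : ∀ j, -1 < α j) {p q : ℝ}
    (hpq : p.HolderConjugate q) {f g : (Fin n → ℂ) → ℂ} (hf : Measurable f) (hg : Measurable g) :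
    infProd f g ≤ sarason α p q f g := by
  have hk := measurable_normalizedKernel α (0 : Fin n → ℂ)
  have h1 := bergmanNorm_two_normalizedKernel hα (zero_mem_polydisc (n := n))
  rw [bergmanNorm_eq α two_pos] at h1
  replace h1 := congrArg (· ^ (2 : ℝ)) h1
  simp only [← ENNReal.rpow_mul, one_div_mul_cancel (two_ne_zero' ℝ), ENNReal.rpow_one,
    ENNReal.one_rpow] at h1
  refine le_trans ?_ (bergmanNorm_mul_le_sarason f g zero_mem_polydisc)
  refine le_trans ?_ (lintegral_mul_le_bergmanNorm hpq (hf.mul hk).aestronglyMeasurable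
    (hg.mul hk).aestronglyMeasurable)
  rw [← mul_one (infProd f g), ← h1, ← lintegral_const_mul' _ _ (infProd_ne_top f g)]
  refine lintegral_mono_ae ?_
  filter_upwards [ae_mem_polydisc α] with z hz
  rw [enorm_mul, enorm_mul, mul_mul_mul_comm, ENNReal.rpow_two, ← sq]
  gcongr
  exact infProd_le f g hz

theorem one_le_inv_mul_sarason {α : Fin n → ℝ} (hα : ∀ j, -1 < α j) {p q : ℝ}
    (hpq : p.HolderConjugate q) {f g : (Fin n → ℂ) → ℂ} (hf : Measurable f) (hg : Measurable g)
    (h : 0 < infProd f g) : 1 ≤ (infProd f g)⁻¹ * sarason α p q f g := by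
  rw [← ENNReal.inv_mul_cancel h.ne' (infProd_ne_top f g)]
  gcongr
  exact infProd_le_sarason hα hpq hf hg

/-- The linear bound is squared at no cost, since `η⁻¹ [f,g] ≥ 1`. -/
theorem invariantConst_le_sq {α : Fin n → ℝ} (hα : ∀ j, -1 < α j) {p q : ℝ}
    (hpq : p.HolderConjugate q) {f g : (Fin n → ℂ) → ℂ} (hf : Measurable f) (hg : Measurable g)
    (h : 0 < infProd f g) : invariantConst α p q f ≤
      (infProd f g) ^ (-2 : ℝ) * (sarason α p q f g) ^ (2 : ℝ) := by
  refine (invariantConst_le hpq h).trans ?_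
  have h1 := one_le_inv_mul_sarason hα hpq hf hg h
  rw [ENNReal.rpow_neg, ← ENNReal.inv_rpow, ← ENNReal.mul_rpow_of_nonneg _ _ two_pos.le,
    ENNReal.rpow_two, sq]
  exact le_mul_of_one_le_left' h1

/-! ### Bounded operators on the Bergman space from pointwise formulas -/

theorem MemLp.integrable_of_polydisc {α : Fin n → ℝ} (hα : ∀ j, -1 < α j) {p : ℝ} (hp : 1 < p)
    {u : (Fin n → ℂ) → ℂ} (hu : MemLp u (ENNReal.ofReal p) (polydiscMeasure α)) :
    Integrable u (polydiscMeasure α) := by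
  have := isProbabilityMeasure_polydiscMeasure hα
  exact hu.integrable (ENNReal.one_le_ofReal.2 hp.le)

theorem integrable_conj_mul {α : Fin n → ℝ} {p q : ℝ} (hpq : p.HolderConjugate q)
    {g h : (Fin n → ℂ) → ℂ} (hg : MemLp g (ENNReal.ofReal q) (polydiscMeasure α))
    (hh : MemLp h (ENNReal.ofReal p) (polydiscMeasure α)) :
    Integrable (fun z => conj (g z) * h z) (polydiscMeasure α) := by
  have := hpq.symm.ennrealOfReal
  exact MemLp.integrable_mul hg.star hh

theorem bergmanProjection_add {α : Fin n → ℝ} (hα : ∀ j, -1 < α j) {u v : (Fin n → ℂ) → ℂ}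
    (hu : Integrable u (polydiscMeasure α)) (hv : Integrable v (polydiscMeasure α))
    {w : Fin n → ℂ} (hw : w ∈ polydisc n) :
    bergmanProjection α (fun z => u z + v z) w =
      bergmanProjection α u w + bergmanProjection α v w := by
  simp only [bergmanProjection, add_mul]
  exact integral_add (integrable_mul_bergmanKernel hα hu hw) (integrable_mul_bergmanKernel hα hv hw)

theorem bergmanProjection_const_mul (α : Fin n → ℝ) (c : ℂ) (u : (Fin n → ℂ) → ℂ)
    (w : Fin n → ℂ) :
    bergmanProjection α (fun z => c * u z) w = c * bergmanProjection α u w := by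
  simp only [bergmanProjection, mul_assoc]
  exact integral_const_mul _ _

theorem bergmanNorm_coe {α : Fin n → ℝ} {p : ℝ} [Fact (1 < p)] (h : bergmanSpace α p) :
    bergmanNorm α p (h : Lp ℂ (ENNReal.ofReal p) (polydiscMeasure α)) = ‖h‖ₑ :=
  (Lp.enorm_def _).symm

theorem exists_clm_of_bound {α : Fin n → ℝ} {p : ℝ} [Fact (1 < p)]
    (T : bergmanSpace α p → (Fin n → ℂ) → ℂ) (hd : ∀ h, DifferentiableOn ℂ (T h) (polydisc n))
    (M : ℝ≥0) (hb : ∀ h, bergmanNorm α p (T h) ≤ M * ‖h‖ₑ)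
    (hadd : ∀ h k, T (h + k) =ᵐ[polydiscMeasure α] fun z => T h z + T k z)
    (hsmul : ∀ (c : ℂ) h, T (c • h) =ᵐ[polydiscMeasure α] fun z => c * T h z) :
    ∃ S : bergmanSpace α p →L[ℂ] bergmanSpace α p, ‖S‖ₑ ≤ M ∧
      ∀ h, (S h : Lp ℂ (ENNReal.ofReal p) (polydiscMeasure α)) =ᵐ[polydiscMeasure α] T h := by
  have hmem : ∀ h, MemLp (T h) (ENNReal.ofReal p) (polydiscMeasure α) := fun h =>
    ⟨aestronglyMeasurable_of_differentiableOn α (hd h),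
      (hb h).trans_lt (ENNReal.mul_lt_top ENNReal.coe_lt_top enorm_lt_top)⟩
  have hco : ∀ h, ((hmem h).toLp (T h) : (Fin n → ℂ) → ℂ) =ᵐ[polydiscMeasure α] T h := fun h =>
    (hmem h).coeFn_toLp
  let L : bergmanSpace α p →ₗ[ℂ] bergmanSpace α p :=
    { toFun := fun h => ⟨(hmem h).toLp (T h), T h, hd h, hco h⟩
      map_add' := fun h k => by
        refine Subtype.ext (Lp.ext ?_)
        refine (hco _).trans ((hadd h k).trans ?_)
        refine Filter.EventuallyEq.trans ?_ (Lp.coeFn_add _ _).symm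
        filter_upwards [hco h, hco k] with z h1 h2
        rw [Pi.add_apply, h1, h2]
      map_smul' := fun c h => by
        refine Subtype.ext (Lp.ext ?_)
        refine (hco _).trans ((hsmul c h).trans ?_)
        refine Filter.EventuallyEq.trans ?_ (Lp.coeFn_smul _ _).symm
        filter_upwards [hco h] with z h1
        rw [Pi.smul_apply, RingHom.id_apply, h1, smul_eq_mul] }
  have hL : ∀ h, ‖L h‖ ≤ M * ‖h‖ := fun h => by
    have h1 : ‖L h‖ₑ ≤ M * ‖h‖ₑ := by
      rw [← bergmanNorm_coe]
      refine le_trans (le_of_eq ?_) (hb h)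
      exact eLpNorm_congr_ae (hco h)
    rw [← ofReal_norm, ← ofReal_norm, ← ENNReal.ofReal_coe_nnreal, ← ENNReal.ofReal_mul M.coe_nonneg] at h1
    exact (ENNReal.ofReal_le_ofReal_iff (by positivity)).1 h1
  refine ⟨L.mkContinuous M hL, ?_, fun h => hco h⟩
  rw [← ofReal_norm, ← ENNReal.ofReal_coe_nnreal]
  exact ENNReal.ofReal_le_ofReal (L.mkContinuous_norm_le M.coe_nonneg hL)

theorem measurable_coe_bergmanSpace {α : Fin n → ℝ} {p : ℝ} (h : bergmanSpace α p) :
    Measurable (h : Lp ℂ (ENNReal.ofReal p) (polydiscMeasure α)) :=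
  (Lp.stronglyMeasurable _).measurable

/-- The operator `h ↦ φ P(ψ h)` on `A^p`. -/
theorem exists_clm_mul_bergmanProjection {α : Fin n → ℝ} (hα : ∀ j, -1 < α j) {p : ℝ}
    [Fact (1 < p)] {φ ψ : (Fin n → ℂ) → ℂ} (hφ : DifferentiableOn ℂ φ (polydisc n))
    (hint : ∀ h : (Fin n → ℂ) → ℂ, MemLp h (ENNReal.ofReal p) (polydiscMeasure α) →
      Integrable (fun z => ψ z * h z) (polydiscMeasure α)) (M : ℝ≥0)
    (hb : ∀ h : (Fin n → ℂ) → ℂ, Measurable h →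
      (∫⁻ z, (‖φ z‖ₑ * absProjection α (fun z => ψ z * h z) z) ^ p ∂polydiscMeasure α) ^ (1 / p) ≤
        M * bergmanNorm α p h) :
    ∃ S : bergmanSpace α p →L[ℂ] bergmanSpace α p, ‖S‖ₑ ≤ M ∧
      ∀ h : bergmanSpace α p,
        (S h : Lp ℂ (ENNReal.ofReal p) (polydiscMeasure α)) =ᵐ[polydiscMeasure α]
          fun z => φ z * bergmanProjection α (fun z => ψ z *
            (h : Lp ℂ (ENNReal.ofReal p) (polydiscMeasure α)) z) z := by
  have hp0 : 0 < p := one_pos.trans (Fact.out : 1 < p)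
  have hi : ∀ h : bergmanSpace α p, Integrable (fun z => ψ z *
      (h : Lp ℂ (ENNReal.ofReal p) (polydiscMeasure α)) z) (polydiscMeasure α) := fun h =>
    hint _ (Lp.memLp _)
  obtain ⟨T, hT⟩ : ∃ T : bergmanSpace α p → (Fin n → ℂ) → ℂ, ∀ h z, T h z = φ z *
      bergmanProjection α (fun z => ψ z *
        (h : Lp ℂ (ENNReal.ofReal p) (polydiscMeasure α)) z) z := ⟨_, fun _ _ => rfl⟩
  suffices h : ∃ S : bergmanSpace α p →L[ℂ] bergmanSpace α p, ‖S‖ₑ ≤ M ∧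
      ∀ h, (S h : Lp ℂ (ENNReal.ofReal p) (polydiscMeasure α)) =ᵐ[polydiscMeasure α] T h by
    obtain ⟨S, h1, h2⟩ := h
    refine ⟨S, h1, fun h => ?_⟩
    filter_upwards [h2 h] with z hz
    rw [hz, hT]
  refine exists_clm_of_bound T (fun h => ?_) M (fun h => ?_) (fun h k => ?_) (fun c h => ?_)
  · rw [funext (hT h)]
    exact hφ.mul (differentiableOn_bergmanProjection hα (hi h))
  · rw [← bergmanNorm_coe]
    refine le_trans ?_ (hb _ (measurable_coe_bergmanSpace h))
    rw [bergmanNorm_eq α hp0]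
    gcongr with z
    rw [hT, enorm_mul]
    gcongr
    exact enorm_bergmanProjection_le _ _ _
  · have h1 : (fun z => ψ z * ((h + k : bergmanSpace α p) :
        Lp ℂ (ENNReal.ofReal p) (polydiscMeasure α)) z) =ᵐ[polydiscMeasure α]
        fun z => ψ z * (h : Lp ℂ (ENNReal.ofReal p) (polydiscMeasure α)) z +
          ψ z * (k : Lp ℂ (ENNReal.ofReal p) (polydiscMeasure α)) z := by
      filter_upwards [Lp.coeFn_add (h : Lp ℂ (ENNReal.ofReal p) (polydiscMeasure α)) k] with z hz
      rw [Submodule.coe_add, hz, Pi.add_apply, mul_add]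
    filter_upwards [ae_mem_polydisc α] with z hz
    rw [hT, hT, hT, bergmanProjection_congr_ae h1, bergmanProjection_add hα (hi h) (hi k) hz, mul_add]
  · have h1 : (fun z => ψ z * ((c • h : bergmanSpace α p) :
        Lp ℂ (ENNReal.ofReal p) (polydiscMeasure α)) z) =ᵐ[polydiscMeasure α]
        fun z => c * (ψ z * (h : Lp ℂ (ENNReal.ofReal p) (polydiscMeasure α)) z) := by
      filter_upwards [Lp.coeFn_smul c (h : Lp ℂ (ENNReal.ofReal p) (polydiscMeasure α))] with z hz
      rw [Submodule.coe_smul, hz, Pi.smul_apply, smul_eq_mul]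
      ring
    refine .of_forall fun z => ?_
    simp only [hT, bergmanProjection_congr_ae h1, bergmanProjection_const_mul]
    ring

theorem IsPolyWeight.mono {α : Fin n → ℝ} {p q : ℝ} {A B : ℝ≥0∞} {f : (Fin n → ℂ) → ℂ}
    (hf : IsPolyWeight α p q A f) (hAB : A ≤ B) : IsPolyWeight α p q B f :=
  ⟨hf.measurable, hf.differentiableOn, hf.ne_zero, fun z hz =>
    (hf.le_mul z hz).trans (by gcongr)⟩

theorem enorm_conj_apply (z : ℂ) : ‖conj z‖ₑ = ‖z‖ₑ := by
  rw [← ofReal_norm, Complex.norm_conj, ofReal_norm]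

theorem lintegral_lt_top_of_rpow {X : Type*} [MeasurableSpace X] {μ : Measure X}
    [IsProbabilityMeasure μ] {p q : ℝ} (hpq : p.HolderConjugate q) {F : X → ℝ≥0∞}
    (hF : Measurable F) (h : (∫⁻ x, F x ^ p ∂μ) ^ (1 / p) ≠ ∞) : ∫⁻ x, F x ∂μ ≠ ∞ := by
  have h1 := ENNReal.lintegral_mul_le_Lp_mul_Lq μ hpq hF.aemeasurable
    (measurable_const (a := (1 : ℝ≥0∞))).aemeasurable
  simp only [Pi.mul_apply, mul_one, ENNReal.one_rpow, lintegral_one, measure_univ] at h1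
  exact ne_top_of_le_ne_top h h1

theorem exists_holomorphic_rep {α : Fin n → ℝ} {p : ℝ} (h : bergmanSpace α p) :
    ∃ F : (Fin n → ℂ) → ℂ, DifferentiableOn ℂ F (polydisc n) ∧
      (h : Lp ℂ (ENNReal.ofReal p) (polydiscMeasure α)) =ᵐ[polydiscMeasure α] F := h.2

/-- Where the outer Toeplitz operator is defined, `f T_ḡ h` is holomorphic and integrable, so the
outer projection acts as the identity. -/
theorem isToeplitzProduct_of_ae_eq {α : Fin n → ℝ} (hα : ∀ j, -1 < α j) {p : ℝ} [Fact (1 < p)]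
    {f g : (Fin n → ℂ) → ℂ} (hf : DifferentiableOn ℂ f (polydisc n))
    {S : bergmanSpace α p →L[ℂ] bergmanSpace α p}
    (hS : ∀ h : bergmanSpace α p,
      (S h : Lp ℂ (ENNReal.ofReal p) (polydiscMeasure α)) =ᵐ[polydiscMeasure α]
        fun z => f z * bergmanProjection α (fun z => conj (g z) *
          (h : Lp ℂ (ENNReal.ofReal p) (polydiscMeasure α)) z) z) :
    IsToeplitzProduct α p f g S := by
  intro h h1 h2
  refine (hS h).trans ?_
  filter_upwards [ae_mem_polydisc α] with z hz
  exact (bergmanProjection_eq_self hα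
    (hf.mul (differentiableOn_bergmanProjection hα h1)) h2 hz).symm

theorem memLp_inv_of_infProd {α : Fin n → ℝ} {q : ℝ} {f g : (Fin n → ℂ) → ℂ} (hf : Measurable f)
    (hg : MemLp g (ENNReal.ofReal q) (polydiscMeasure α)) (h : 0 < infProd f g) :
    MemLp (fun z => (f z)⁻¹) (ENNReal.ofReal q) (polydiscMeasure α) := by
  refine hg.of_le_mul (c := (infProd f g)⁻¹.toReal) hf.inv.aestronglyMeasurable ?_
  filter_upwards [ae_mem_polydisc α] with z hz
  have h1 := enorm_inv_le_of_infProd h hz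
  have h2 := ENNReal.toReal_mono (ENNReal.mul_ne_top (ENNReal.inv_ne_top.2 h.ne') enorm_ne_top) h1
  rwa [ENNReal.toReal_mul, toReal_enorm, toReal_enorm] at h2

/-! ### Sufficiency: the bounded invertible Toeplitz product -/

/-- If `[f, g] < ∞` and `η > 0`, then `h ↦ f P(ḡ h)` is a bounded invertible operator. -/
theorem exists_invertible_toeplitzProduct {p q : ℝ} [Fact (1 < p)] (hpq : p.HolderConjugate q)
    {α : Fin n → ℝ} (hα : ∀ j, -1 < α j) :
    ∃ C : ℝ≥0, ∀ f g : (Fin n → ℂ) → ℂ, Measurable f → Measurable g → MemBergman α p f →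
      MemBergman α q g → sarason α p q f g < ∞ → 0 < infProd f g →
      ∃ S : bergmanSpace α p →L[ℂ] bergmanSpace α p, IsToeplitzProduct α p f g S ∧ IsUnit S ∧
        ‖S‖ₑ ≤ C * (infProd f g) ^ (-(2 * n * max p q)) *
          (sarason α p q f g) ^ (1 + 2 * n * max p q) := by
  have hprob := isProbabilityMeasure_polydiscMeasure hα
  obtain ⟨c, hc1, hc⟩ := exists_isPolyWeight_sarason hpq hα
  obtain ⟨c', hc'⟩ := exists_mul_le_sarason hpq hα
  obtain ⟨C, hC⟩ := exists_weighted_bound_absProjection hpq hα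
  obtain ⟨C₁, hC₁⟩ := exists_bound_absProjection hpq hα
  have hk : 0 ≤ 2 * n * max p q := by
    have := hpq.pos.le.trans (le_max_left p q)
    positivity
  set k := 2 * n * max p q with hkdef
  refine ⟨C * c ^ k * c', fun f g hfm hgm hf hg hs hη => ?_⟩
  set η := infProd f g with hηdef
  set s := sarason α p q f g with hsdef
  have hη' : η⁻¹ ≠ ∞ := ENNReal.inv_ne_top.2 hη.ne'
  have h0 : ∀ z ∈ polydisc n, f z ≠ 0 ∧ g z ≠ 0 := fun z hz => ne_zero_of_infProd_pos hη hz
  have hX : η⁻¹ * s ≠ ∞ := ENNReal.mul_ne_top hη' hs.ne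
  have hX1 : 1 ≤ η⁻¹ * s := one_le_inv_mul_sarason hα hpq hfm hgm hη
  obtain ⟨A, hA⟩ : ∃ A : ℝ≥0, (A : ℝ≥0∞) = c * (η⁻¹ * s) :=
    ⟨_, ENNReal.coe_toNNReal (ENNReal.mul_ne_top ENNReal.coe_ne_top hX)⟩
  have hA1 : 1 ≤ A := by
    rw [← ENNReal.one_le_coe_iff, hA]
    exact one_le_mul (by exact_mod_cast hc1) hX1
  -- `A = c η⁻¹ [f,g]` bounds the box constant of `f`, and it is at least `1`, as the weighted
  -- inequality requires.
  have hw : IsPolyWeight α p q A f := by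
    refine (hc f hfm hf.1 fun z hz => (h0 z hz).1).mono ?_
    rw [hA]
    gcongr
    exact invariantConst_le hpq hη
  have hcs : (c' : ℝ≥0∞) * s ≠ ∞ := ENNReal.mul_ne_top ENNReal.coe_ne_top hs.ne
  obtain ⟨M, hM⟩ : ∃ M : ℝ≥0, (M : ℝ≥0∞) = C * (A : ℝ≥0∞) ^ k * (c' * s) :=
    ⟨_, ENNReal.coe_toNNReal (ENNReal.mul_ne_top (ENNReal.mul_ne_top ENNReal.coe_ne_top
      (ENNReal.rpow_ne_top_of_nonneg hk ENNReal.coe_ne_top)) hcs)⟩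
  obtain ⟨M', hM'⟩ : ∃ M' : ℝ≥0, (M' : ℝ≥0∞) = C₁ * η⁻¹ :=
    ⟨_, ENNReal.coe_toNNReal (ENNReal.mul_ne_top ENNReal.coe_ne_top hη')⟩
  have hgc : Measurable fun z => conj (g z) := Complex.continuous_conj.measurable.comp hgm
  have hgch : ∀ h : (Fin n → ℂ) → ℂ, Measurable h → Measurable fun z => conj (g z) * h z :=
    fun h hh => hgc.mul hh
  -- The weighted inequality is applied to `u = ḡ h`; its right side has `|f u| = |fg| |h| ≤ c'
  -- [f,g] |h|`, the source of the extra factor `[f,g]`.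
  have hSb : ∀ h : (Fin n → ℂ) → ℂ, Measurable h → (∫⁻ z, (‖f z‖ₑ *
      absProjection α (fun z => conj (g z) * h z) z) ^ p ∂polydiscMeasure α) ^ (1 / p) ≤
        M * bergmanNorm α p h := fun h hh => by
    refine (hC A f hA1 hw _ (hgch h hh)).trans ?_
    rw [hM, mul_assoc (_ * _)]
    gcongr
    refine bergmanNorm_le_mul hpq.pos hcs fun z hz => ?_
    rw [enorm_mul, enorm_mul, ← mul_assoc, enorm_conj_apply]
    gcongr ?_ * _
    exact hc' f g hfm hgm hf.1 hg.1 z hz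
  have hψ : ∀ z ∈ polydisc n, ‖(f z * conj (g z))⁻¹‖ₑ ≤ η⁻¹ := fun z hz => by
    rw [enorm_inv (mul_ne_zero (h0 z hz).1 (by simpa using (h0 z hz).2)), enorm_mul,
      enorm_conj_apply]
    exact ENNReal.inv_le_inv.2 (infProd_le f g hz)
  have hψm : Measurable fun z => (f z * conj (g z))⁻¹ := (hfm.mul hgc).inv
  have hψh : ∀ h : (Fin n → ℂ) → ℂ, Measurable h →
      Measurable fun z => (f z * conj (g z))⁻¹ * h z := fun h hh => hψm.mul hh
  have hginv : Measurable fun z => (g z)⁻¹ := hgm.inv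
  have hRb' : ∀ h : (Fin n → ℂ) → ℂ, Measurable h → (∫⁻ z,
      (absProjection α (fun z => (f z * conj (g z))⁻¹ * h z) z) ^ p ∂polydiscMeasure α) ^ (1 / p) ≤
        M' * bergmanNorm α p h := fun h hh => by
    refine (hC₁ _ (hψh h hh)).trans ?_
    rw [hM', mul_assoc]
    gcongr
    refine bergmanNorm_le_mul hpq.pos hη' fun z hz => ?_
    rw [enorm_mul]
    gcongr
    exact hψ z hz
  obtain ⟨S, hSn, hS⟩ := exists_clm_mul_bergmanProjection hα (φ := f) (ψ := fun z => conj (g z))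
    hf.1 (fun h hh => integrable_conj_mul hpq hg.2 hh) M hSb
  -- The inverse is `h ↦ P(h / (f ḡ))`; its boundedness needs only the unweighted estimate and `|fg|
  -- ≥ η`.
  obtain ⟨R, -, hR⟩ := exists_clm_mul_bergmanProjection hα (p := p) (φ := fun _ => 1)
    (ψ := fun z => (f z * conj (g z))⁻¹) (differentiableOn_const 1) (fun h hh => by
      refine (MemLp.integrable_of_polydisc hα hpq.lt hh).bdd_mul (c := η⁻¹.toReal)
        hψm.aestronglyMeasurable ?_
      filter_upwards [ae_mem_polydisc α] with z hz
      rw [← toReal_enorm]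
      exact ENNReal.toReal_mono hη' (hψ z hz)) M' (fun h hh => by
        simpa only [enorm_one, one_mul] using hRb' h hh)
  have hfi : MemLp (fun z => (f z)⁻¹) (ENNReal.ofReal q) (polydiscMeasure α) :=
    memLp_inv_of_infProd hfm hg.2 hη
  have hgi : MemLp (fun z => (g z)⁻¹) (ENNReal.ofReal p) (polydiscMeasure α) :=
    memLp_inv_of_infProd hgm hf.2 (by rwa [infProd_comm])
  have hnorm : ∀ h : bergmanSpace α p,
      bergmanNorm α p (h : Lp ℂ (ENNReal.ofReal p) (polydiscMeasure α)) ≠ ∞ := fun h =>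
    (Lp.memLp _).2.ne
  -- `f P(ḡ P(h/(fḡ))) = f P(h/f) = h`: the inner projection is absorbed by `ḡ`, and `h/f` is
  -- holomorphic and integrable.
  have hSR : S * R = 1 := by
    ext1 h
    refine Subtype.ext (Lp.ext ?_)
    obtain ⟨F, hF, hhF⟩ := exists_holomorphic_rep h
    have hhm := measurable_coe_bergmanSpace h
    refine (hS (R h)).trans ?_
    have e1 : (fun z => conj (g z) * (R h : Lp ℂ (ENNReal.ofReal p) (polydiscMeasure α)) z)
        =ᵐ[polydiscMeasure α] fun z => conj (g z) * bergmanProjection α (fun z =>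
          (f z * conj (g z))⁻¹ * (h : Lp ℂ (ENNReal.ofReal p) (polydiscMeasure α)) z) z := by
      filter_upwards [hR h] with z hz
      rw [hz, one_mul]
    have e2 : (fun z => conj (g z) * ((f z * conj (g z))⁻¹ *
        (h : Lp ℂ (ENNReal.ofReal p) (polydiscMeasure α)) z)) =ᵐ[polydiscMeasure α]
        fun z => (f z)⁻¹ * F z := by
      filter_upwards [ae_mem_polydisc α, hhF] with z hz hzF
      have h1 : conj (g z) ≠ 0 := by simpa using (h0 z hz).2
      rw [hzF, mul_inv]
      field_simp
    have hfin : ∫⁻ z, ‖g z‖ₑ * absProjection α (fun z => (f z * conj (g z))⁻¹ *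
        (h : Lp ℂ (ENNReal.ofReal p) (polydiscMeasure α)) z) z ∂polydiscMeasure α ≠ ∞ := by
      refine ne_top_of_le_ne_top ?_ (ENNReal.lintegral_mul_le_Lp_mul_Lq (polydiscMeasure α) hpq.symm
        hgm.enorm.aemeasurable (measurable_absProjection α (hψh _ hhm)).aemeasurable)
      refine ENNReal.mul_ne_top ?_ ?_
      · rw [← bergmanNorm_eq α hpq.symm.pos]
        exact hg.2.2.ne
      · exact ne_top_of_le_ne_top (ENNReal.mul_ne_top ENNReal.coe_ne_top (hnorm h)) (hRb' _ hhm)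
    have hFi : Integrable (fun z => (f z)⁻¹ * F z) (polydiscMeasure α) := by
      have := hpq.symm.ennrealOfReal
      exact MemLp.integrable_mul hfi ((Lp.memLp _).ae_eq hhF)
    rw [bergmanProjection_congr_ae e1]
    filter_upwards [ae_mem_polydisc α, hhF] with z hz hzF
    rw [bergmanProjection_conj_mul_bergmanProjection hα hgm hg.1
      (MemLp.integrable_of_polydisc hα hpq.symm.lt hg.2) (hψh _ hhm) hfin hz,
      bergmanProjection_congr_ae e2, bergmanProjection_eq_self hα
        (F := fun z => (f z)⁻¹ * F z) ((hf.1.inv fun z hz => (h0 z hz).1).mul hF) hFi hz, ← mul_assoc,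
      mul_inv_cancel₀ (h0 z hz).1, one_mul]
    exact hzF.symm
  -- Here `S h / (f ḡ) = conj(1/g) P(ḡ h)`, and the same absorption, now for the holomorphic
  -- function `1/g`, leaves `P h = h`.
  have hRS : R * S = 1 := by
    ext1 h
    refine Subtype.ext (Lp.ext ?_)
    obtain ⟨F, hF, hhF⟩ := exists_holomorphic_rep h
    have hhm := measurable_coe_bergmanSpace h
    refine (hR (S h)).trans ?_
    have e1 : (fun z => (f z * conj (g z))⁻¹ *
        (S h : Lp ℂ (ENNReal.ofReal p) (polydiscMeasure α)) z) =ᵐ[polydiscMeasure α]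
        fun z => conj (g z)⁻¹ * bergmanProjection α (fun z =>
          conj (g z) * (h : Lp ℂ (ENNReal.ofReal p) (polydiscMeasure α)) z) z := by
      filter_upwards [hS h, ae_mem_polydisc α] with z hzS hz
      have h1 := (h0 z hz).1
      rw [hzS, mul_inv, map_inv₀]
      field_simp
    have e2 : (fun z => conj (g z)⁻¹ * (conj (g z) *
        (h : Lp ℂ (ENNReal.ofReal p) (polydiscMeasure α)) z)) =ᵐ[polydiscMeasure α] F := by
      filter_upwards [ae_mem_polydisc α, hhF] with z hz hzF
      rw [hzF, ← mul_assoc, ← map_mul, inv_mul_cancel₀ (h0 z hz).2, map_one, one_mul]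
    -- No bound for `|P|(ḡ h)` alone is at hand; `|1/g| ≤ η⁻¹ |f|` brings in the weighted estimate,
    -- and `L^p ⊆ L^1` on a probability space.
    have hfin : ∫⁻ z, ‖(g z)⁻¹‖ₑ * absProjection α (fun z => conj (g z) *
        (h : Lp ℂ (ENNReal.ofReal p) (polydiscMeasure α)) z) z ∂polydiscMeasure α ≠ ∞ := by
      have h1 := lintegral_lt_top_of_rpow hpq (hfm.enorm.mul (measurable_absProjection α
        (hgch _ hhm))) (ne_top_of_le_ne_top (ENNReal.mul_ne_top ENNReal.coe_ne_top (hnorm h))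
          (hSb _ hhm))
      refine ne_top_of_le_ne_top (ENNReal.mul_ne_top hη' h1) ?_
      rw [← lintegral_const_mul' _ _ hη']
      refine lintegral_mono_ae ?_
      filter_upwards [ae_mem_polydisc α] with z hz
      rw [Pi.mul_apply, ← mul_assoc]
      gcongr
      have h2 := enorm_inv_le_of_infProd (f := g) (g := f) (by rwa [infProd_comm]) hz
      rwa [infProd_comm] at h2
    have hFi : Integrable F (polydiscMeasure α) :=
      MemLp.integrable_of_polydisc hα hpq.lt ((Lp.memLp _).ae_eq hhF)
    rw [bergmanProjection_congr_ae e1]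
    filter_upwards [ae_mem_polydisc α, hhF] with z hz hzF
    rw [bergmanProjection_conj_mul_bergmanProjection hα hginv
      (hg.1.inv fun z hz => (h0 z hz).2)
      (MemLp.integrable_of_polydisc hα hpq.lt hgi) (hgch _ hhm) hfin hz,
      bergmanProjection_congr_ae e2, bergmanProjection_eq_self hα hF hFi hz, one_mul]
    exact hzF.symm
  refine ⟨S, isToeplitzProduct_of_ae_eq hα hf.1 hS, ⟨⟨S, R, hSR, hRS⟩, rfl⟩, hSn.trans ?_⟩
  rw [hM, hA, ENNReal.mul_rpow_of_nonneg _ _ hk, ENNReal.mul_rpow_of_nonneg _ _ hk,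
    ENNReal.inv_rpow, ← ENNReal.rpow_neg, ENNReal.rpow_add_of_nonneg _ _ one_pos.le hk,
    ENNReal.rpow_one, ENNReal.coe_mul, ENNReal.coe_mul, ENNReal.coe_rpow_of_nonneg _ hk]
  exact le_of_eq (by ring)

/-! ### A bounded Toeplitz product is `h ↦ f P(ḡ h)` everywhere -/

theorem lintegral_mul_absProjection_ne_top {α : Fin n → ℝ} {p q : ℝ} (hpq : p.HolderConjugate q)
    {C : ℝ≥0} (hC : ∀ u : (Fin n → ℂ) → ℂ, Measurable u →
      (∫⁻ z, absProjection α u z ^ p ∂polydiscMeasure α) ^ (1 / p) ≤ C * bergmanNorm α p u)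
    {g u : (Fin n → ℂ) → ℂ} (hg : MemLp g (ENNReal.ofReal q) (polydiscMeasure α))
    (hu : Measurable u) (hu' : MemLp u (ENNReal.ofReal p) (polydiscMeasure α)) :
    ∫⁻ z, ‖g z‖ₑ * absProjection α u z ∂polydiscMeasure α ≠ ∞ := by
  refine ne_top_of_le_ne_top ?_ (ENNReal.lintegral_mul_le_Lp_mul_Lq (polydiscMeasure α) hpq.symm
    hg.1.enorm (measurable_absProjection α hu).aemeasurable)
  refine ENNReal.mul_ne_top ?_ ?_
  · rw [← bergmanNorm_eq α hpq.symm.pos]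
    exact hg.2.ne
  · exact ne_top_of_le_ne_top (ENNReal.mul_ne_top ENNReal.coe_ne_top hu'.2.ne) (hC _ hu)

theorem exists_bergmanSpace_projection {α : Fin n → ℝ} (hα : ∀ j, -1 < α j) {p : ℝ} [Fact (1 < p)]
    {C : ℝ≥0} (hC : ∀ u : (Fin n → ℂ) → ℂ, Measurable u →
      (∫⁻ z, absProjection α u z ^ p ∂polydiscMeasure α) ^ (1 / p) ≤ C * bergmanNorm α p u)
    {u : (Fin n → ℂ) → ℂ} (hu : Measurable u)
    (hu' : MemLp u (ENNReal.ofReal p) (polydiscMeasure α)) :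
    ∃ h : bergmanSpace α p, ((h : Lp ℂ (ENNReal.ofReal p) (polydiscMeasure α)) : (Fin n → ℂ) → ℂ)
      =ᵐ[polydiscMeasure α] bergmanProjection α u ∧ ‖h‖ₑ ≤ C * bergmanNorm α p u := by
  have hp1 : 1 < p := Fact.out
  have hb : bergmanNorm α p (bergmanProjection α u) ≤ C * bergmanNorm α p u := by
    refine le_trans ?_ (hC u hu)
    rw [bergmanNorm_eq α (by linarith)]
    gcongr with z
    exact enorm_bergmanProjection_le _ _ _
  have hm : MemLp (bergmanProjection α u) (ENNReal.ofReal p) (polydiscMeasure α) :=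
    ⟨(stronglyMeasurable_bergmanProjection α hu).aestronglyMeasurable,
      hb.trans_lt (ENNReal.mul_lt_top ENNReal.coe_lt_top hu'.2)⟩
  refine ⟨⟨hm.toLp _, bergmanProjection α u, differentiableOn_bergmanProjection hα
    (MemLp.integrable_of_polydisc hα hp1 hu'), hm.coeFn_toLp⟩, hm.coeFn_toLp, ?_⟩
  rw [← bergmanNorm_coe]
  exact (eLpNorm_congr_ae hm.coeFn_toLp).trans_le hb

/-- The closed polydisc of radius `r`. -/
def closedPolydisc (n : ℕ) (r : ℝ) : Set (Fin n → ℂ) := {z | ∀ j, ‖z j‖ ≤ r}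

theorem measurableSet_closedPolydisc (r : ℝ) : MeasurableSet (closedPolydisc n r) := by
  have : closedPolydisc n r = ⋂ j, {z | ‖z j‖ ≤ r} := by ext z; simp [closedPolydisc]
  rw [this]
  exact (isClosed_iInter fun j => isClosed_le (by fun_prop) continuous_const).measurableSet

theorem norm_bergmanProjection_le_of_support {α : Fin n → ℝ} (hα : ∀ j, -1 < α j)
    {v : (Fin n → ℂ) → ℂ} (hv : Integrable v (polydiscMeasure α)) {r : ℝ} (hr : r < 1)
    (hsupp : ∀ z, z ∉ closedPolydisc n r → v z = 0) {z : Fin n → ℂ} (hz : z ∈ polydisc n) :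
    ‖bergmanProjection α v z‖ ≤ (∫ ζ, ‖v ζ‖ ∂polydiscMeasure α) * kernelBound α fun _ => r := by
  rw [← integral_mul_const]
  refine norm_integral_le_of_norm_le (hv.norm.mul_const _) (.of_forall fun ζ => ?_)
  rw [norm_mul]
  by_cases h : ζ ∈ closedPolydisc n r
  · gcongr
    exact norm_bergmanKernel_le hα (fun j => (hz j).le) (fun _ => hr) h
  · simp [hsupp ζ h]

/-- On projections of compactly supported functions the Toeplitz product is explicit. -/
theorem IsToeplitzProduct.apply_of_support {α : Fin n → ℝ} (hα : ∀ j, -1 < α j) {p q : ℝ}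
    [Fact (1 < p)] (hpq : p.HolderConjugate q)
    {C : ℝ≥0} (hC : ∀ u : (Fin n → ℂ) → ℂ, Measurable u →
      (∫⁻ z, absProjection α u z ^ p ∂polydiscMeasure α) ^ (1 / p) ≤ C * bergmanNorm α p u)
    {f g : (Fin n → ℂ) → ℂ} (hgm : Measurable g) (hf : MemBergman α p f)
    (hg : MemBergman α q g) {S : bergmanSpace α p →L[ℂ] bergmanSpace α p}
    (hS : IsToeplitzProduct α p f g S) {u : (Fin n → ℂ) → ℂ} (hu : Measurable u)
    (hu' : MemLp u (ENNReal.ofReal p) (polydiscMeasure α)) {r : ℝ} (hr : r < 1)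
    (hsupp : ∀ z, z ∉ closedPolydisc n r → u z = 0) {h : bergmanSpace α p}
    (hh : ((h : Lp ℂ (ENNReal.ofReal p) (polydiscMeasure α)) : (Fin n → ℂ) → ℂ)
      =ᵐ[polydiscMeasure α] bergmanProjection α u) :
    (S h : Lp ℂ (ENNReal.ofReal p) (polydiscMeasure α)) =ᵐ[polydiscMeasure α]
      fun z => f z * bergmanProjection α (fun z => conj (g z) * u z) z := by
  have hgu := integrable_conj_mul hpq hg.2 hu'
  have hd := differentiableOn_bergmanProjection hα hgu
  have e1 : (fun z => conj (g z) * (h : Lp ℂ (ENNReal.ofReal p) (polydiscMeasure α)) z)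
      =ᵐ[polydiscMeasure α] fun z => conj (g z) * bergmanProjection α u z := by
    filter_upwards [hh] with z hz
    rw [hz]
  have e2 : ∀ z ∈ polydisc n, toeplitz α (fun z => conj (g z))
      (h : Lp ℂ (ENNReal.ofReal p) (polydiscMeasure α)) z =
        bergmanProjection α (fun z => conj (g z) * u z) z := fun z hz => by
    rw [toeplitz, bergmanProjection_congr_ae e1, bergmanProjection_conj_mul_bergmanProjection hα hgm
      hg.1 (MemLp.integrable_of_polydisc hα hpq.symm.lt hg.2) hu
      (lintegral_mul_absProjection_ne_top hpq hC hg.2 hu hu') hz]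
  have e3 : (fun z => f z * bergmanProjection α (fun z => conj (g z) * u z) z)
      =ᵐ[polydiscMeasure α] fun z => f z * toeplitz α (fun z => conj (g z))
        (h : Lp ℂ (ENNReal.ofReal p) (polydiscMeasure α)) z := by
    filter_upwards [ae_mem_polydisc α] with z hz
    rw [e2 z hz]
  -- The support of `u` stays away from the boundary, so `P(ḡ u)` is bounded on the polydisc. Hence
  -- the outer Toeplitz operator is defined and `hS` may be used.
  have hi : Integrable (fun z => f z * bergmanProjection α (fun z => conj (g z) * u z) z)
      (polydiscMeasure α) := by
    refine (MemLp.integrable_of_polydisc hα hpq.lt hf.2).mul_bdd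
      (aestronglyMeasurable_of_differentiableOn α hd)
      (c := (∫ ζ, ‖conj (g ζ) * u ζ‖ ∂polydiscMeasure α) * kernelBound α fun _ => r) ?_
    filter_upwards [ae_mem_polydisc α] with z hz
    exact norm_bergmanProjection_le_of_support hα hgu hr
      (fun z hz => by rw [hsupp z hz, mul_zero]) hz
  refine (hS h (integrable_conj_mul hpq hg.2 (Lp.memLp _)) (hi.congr e3)).trans ?_
  filter_upwards [ae_mem_polydisc α] with z hz
  rw [toeplitz, ← bergmanProjection_congr_ae e3]
  exact bergmanProjection_eq_self hα (hf.1.mul hd) hi hz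

theorem eventually_mem_closedPolydisc {z : Fin n → ℂ} (hz : z ∈ polydisc n) :
    ∀ᶠ m : ℕ in Filter.atTop, z ∈ closedPolydisc n (1 - 1 / ((m : ℝ) + 1)) := by
  refine Filter.eventually_all.2 fun j => ?_
  have h := (tendsto_one_div_add_atTop_nhds_zero_nat (𝕜 := ℝ)).const_sub 1
  rw [sub_zero] at h
  filter_upwards [h.eventually (lt_mem_nhds (hz j))] with m hm using hm.le

/-- A bounded Toeplitz product is `h ↦ f P(ḡ h)` on the whole space. -/
theorem IsToeplitzProduct.apply {α : Fin n → ℝ} (hα : ∀ j, -1 < α j) {p q : ℝ}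
    [Fact (1 < p)] (hpq : p.HolderConjugate q)
    {C : ℝ≥0} (hC : ∀ u : (Fin n → ℂ) → ℂ, Measurable u →
      (∫⁻ z, absProjection α u z ^ p ∂polydiscMeasure α) ^ (1 / p) ≤ C * bergmanNorm α p u)
    {f g : (Fin n → ℂ) → ℂ} (hgm : Measurable g) (hf : MemBergman α p f)
    (hg : MemBergman α q g) {S : bergmanSpace α p →L[ℂ] bergmanSpace α p}
    (hS : IsToeplitzProduct α p f g S) (h : bergmanSpace α p) :
    (S h : Lp ℂ (ENNReal.ofReal p) (polydiscMeasure α)) =ᵐ[polydiscMeasure α]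
      fun z => f z * bergmanProjection α (fun z => conj (g z) *
        (h : Lp ℂ (ENNReal.ofReal p) (polydiscMeasure α)) z) z := by
  have hhm := measurable_coe_bergmanSpace h
  have hhp := Lp.memLp (h : Lp ℂ (ENNReal.ofReal p) (polydiscMeasure α))
  obtain ⟨v, hv⟩ : ∃ v : (Fin n → ℂ) → ℂ,
    ((h : Lp ℂ (ENNReal.ofReal p) (polydiscMeasure α)) : (Fin n → ℂ) → ℂ) = v := ⟨_, rfl⟩
  rw [hv] at hhm hhp ⊢
  obtain ⟨F, hF, hhF⟩ := exists_holomorphic_rep h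
  rw [hv] at hhF
  have hvi := MemLp.integrable_of_polydisc hα hpq.lt hhp
  have hgv := integrable_conj_mul hpq hg.2 hhp
  set E : ℕ → Set (Fin n → ℂ) := fun m => closedPolydisc n (1 - 1 / ((m : ℝ) + 1)) with hE
  have hEm : ∀ m, MeasurableSet (E m) := fun m => measurableSet_closedPolydisc _
  have hum : ∀ m, Measurable ((E m).indicator v) := fun m => hhm.indicator (hEm m)
  have hup : ∀ m, MemLp ((E m).indicator v) (ENNReal.ofReal p) (polydiscMeasure α) :=
    fun m => hhp.indicator (hEm m)
  have hcm : ∀ m, Measurable ((E m)ᶜ.indicator v) := fun m => hhm.indicator (hEm m).compl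
  have hcp : ∀ m, MemLp ((E m)ᶜ.indicator v) (ENNReal.ofReal p) (polydiscMeasure α) :=
    fun m => hhp.indicator (hEm m).compl
  choose k hk _ using fun m => exists_bergmanSpace_projection hα hC (hum m) (hup m)
  choose l hl hl' using fun m => exists_bergmanSpace_projection hα hC (hcm m) (hcp m)
  -- Since `h = P h`, the error is the projection of `h` cut off to the complement of `E m`, so its
  -- norm is controlled by that tail.
  have hkl : ∀ m, h - k m = l m := fun m => by
    refine Subtype.ext (Lp.ext ?_)
    rw [Submodule.coe_sub]
    refine (Lp.coeFn_sub _ _).trans ?_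
    filter_upwards [hk m, hl m, hhF, ae_mem_polydisc α] with z h1 h2 h3 hz
    rw [Pi.sub_apply, h1, h2, hv, h3, sub_eq_iff_eq_add,
      ← bergmanProjection_add hα (MemLp.integrable_of_polydisc hα hpq.lt (hcp m))
      (MemLp.integrable_of_polydisc hα hpq.lt (hup m)) hz,
      ← bergmanProjection_eq_self hα hF (hvi.congr hhF) hz, ← bergmanProjection_congr_ae hhF]
    congr 1
    funext ζ
    exact (Set.indicator_compl_add_self_apply (E m) v ζ).symm
  have hlim0 : Filter.Tendsto (fun m => bergmanNorm α p ((E m)ᶜ.indicator v)) Filter.atTop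
      (nhds 0) := by
    simp only [bergmanNorm_eq α hpq.pos]
    have h1 : Filter.Tendsto (fun m => ∫⁻ z, ‖(E m)ᶜ.indicator v z‖ₑ ^ p ∂polydiscMeasure α)
        Filter.atTop (nhds (∫⁻ _, 0 ∂polydiscMeasure α)) := by
      refine tendsto_lintegral_of_dominated_convergence (fun z => ‖v z‖ₑ ^ p)
        (fun m => (hcm m).enorm.pow_const p) (fun m => .of_forall fun z => ?_) ?_ ?_
      · exact ENNReal.rpow_le_rpow (enorm_indicator_le_enorm_self _ _) hpq.nonneg
      · have h2 := hhp.2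
        change bergmanNorm α p v < ∞ at h2
        rw [bergmanNorm_eq α hpq.pos] at h2
        intro h3
        rw [h3, ENNReal.top_rpow_of_pos hpq.one_div_pos] at h2
        exact lt_irrefl _ h2
      · filter_upwards [ae_mem_polydisc α] with z hz
        refine tendsto_const_nhds.congr' ?_
        filter_upwards [eventually_mem_closedPolydisc hz] with m hm
        rw [Set.indicator_of_notMem (Set.notMem_compl_iff.2 hm), enorm_zero, ENNReal.zero_rpow_of_pos hpq.pos]
    rw [lintegral_zero] at h1
    have h2 := h1.ennrpow_const (1 / p)
    rwa [ENNReal.zero_rpow_of_pos hpq.one_div_pos] at h2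
  have hlim1 : Filter.Tendsto k Filter.atTop (nhds h) := by
    rw [tendsto_iff_edist_tendsto_0]
    refine tendsto_of_tendsto_of_tendsto_of_le_of_le tendsto_const_nhds (h := fun m =>
      C * bergmanNorm α p ((E m)ᶜ.indicator v)) ?_ (fun m => zero_le) fun m => ?_
    · have := ENNReal.Tendsto.const_mul (a := (C : ℝ≥0∞)) hlim0 (.inr ENNReal.coe_ne_top)
      rwa [mul_zero] at this
    · change edist (k m) h ≤ _
      rw [edist_comm, edist_eq_enorm_sub, hkl]
      exact hl' m
  have hlim2 : Filter.Tendsto (fun m => (S (k m) : Lp ℂ (ENNReal.ofReal p) (polydiscMeasure α)))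
      Filter.atTop (nhds (S h : Lp ℂ (ENNReal.ofReal p) (polydiscMeasure α))) :=
    (continuous_subtype_val.tendsto _).comp ((S.continuous.tendsto h).comp hlim1)
  -- The formula for `S (k m)` passes to the limit pointwise: on the left along an almost everywhere
  -- convergent subsequence, on the right by dominated convergence for each `z`.
  obtain ⟨ns, hns, hae⟩ := (tendstoInMeasure_of_tendsto_Lp hlim2).exists_seq_tendsto_ae
  have hSk := fun m => hS.apply_of_support hα hpq hC hgm hf hg (hum m) (hup m)
    (r := 1 - 1 / ((m : ℝ) + 1)) (by linarith [Nat.one_div_pos_of_nat (α := ℝ) (n := m)])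
    (fun z hz => Set.indicator_of_notMem hz v) (hk m)
  filter_upwards [hae, ae_all_iff.2 hSk, ae_mem_polydisc α] with z h1 h2 hz
  refine tendsto_nhds_unique h1 ?_
  simp only [h2]
  refine Filter.Tendsto.const_mul (f z) (Filter.Tendsto.comp (g := fun m =>
    bergmanProjection α (fun z => conj (g z) * (E m).indicator v z) z) ?_ hns.tendsto_atTop)
  refine tendsto_integral_of_dominated_convergence
    (fun ζ => ‖conj (g ζ) * v ζ * bergmanKernel α z ζ‖) (fun m => ?_)
    (integrable_mul_bergmanKernel hα hgv hz).norm (fun m => .of_forall fun ζ => ?_) ?_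
  · exact (integrable_mul_bergmanKernel hα (integrable_conj_mul hpq hg.2 (hup m))
      hz).aestronglyMeasurable
  · simp only [norm_mul]
    gcongr
    exact norm_indicator_le_norm_self _ _
  · filter_upwards [ae_mem_polydisc α] with ζ hζ
    refine tendsto_const_nhds.congr' ?_
    filter_upwards [eventually_mem_closedPolydisc hζ] with m hm
    rw [Set.indicator_of_mem hm]

/-- On all of `L^p` the map `u ↦ f P(ḡ u)` is `S P`. This extension is needed because multiplication
by a conjugated monomial leaves the Bergman space. -/
theorem IsToeplitzProduct.bergmanNorm_le {α : Fin n → ℝ} (hα : ∀ j, -1 < α j) {p q : ℝ}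
    [Fact (1 < p)] (hpq : p.HolderConjugate q)
    {C : ℝ≥0} (hC : ∀ u : (Fin n → ℂ) → ℂ, Measurable u →
      (∫⁻ z, absProjection α u z ^ p ∂polydiscMeasure α) ^ (1 / p) ≤ C * bergmanNorm α p u)
    {f g : (Fin n → ℂ) → ℂ} (hgm : Measurable g) (hf : MemBergman α p f)
    (hg : MemBergman α q g) {S : bergmanSpace α p →L[ℂ] bergmanSpace α p}
    (hS : IsToeplitzProduct α p f g S) {u : (Fin n → ℂ) → ℂ} (hu : Measurable u)
    (hu' : MemLp u (ENNReal.ofReal p) (polydiscMeasure α)) :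
    bergmanNorm α p (fun z => f z * bergmanProjection α (fun z => conj (g z) * u z) z) ≤
      ‖S‖ₑ * (C * bergmanNorm α p u) := by
  obtain ⟨h, hh, hb⟩ := exists_bergmanSpace_projection hα hC hu hu'
  have e1 : (fun z => conj (g z) * (h : Lp ℂ (ENNReal.ofReal p) (polydiscMeasure α)) z)
      =ᵐ[polydiscMeasure α] fun z => conj (g z) * bergmanProjection α u z := by
    filter_upwards [hh] with z hz
    rw [hz]
  have e2 : (fun z => f z * bergmanProjection α (fun z => conj (g z) * u z) z)
      =ᵐ[polydiscMeasure α] (S h : Lp ℂ (ENNReal.ofReal p) (polydiscMeasure α)) := by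
    filter_upwards [hS.apply hα hpq hC hgm hf hg h, ae_mem_polydisc α] with z h1 hz
    rw [h1, bergmanProjection_congr_ae e1, bergmanProjection_conj_mul_bergmanProjection hα hgm
      hg.1 (MemLp.integrable_of_polydisc hα hpq.symm.lt hg.2) hu
      (lintegral_mul_absProjection_ne_top hpq hC hg.2 hu hu') hz]
  calc bergmanNorm α p (fun z => f z * bergmanProjection α (fun z => conj (g z) * u z) z)
      = ‖S h‖ₑ := by
        rw [← bergmanNorm_coe]
        exact eLpNorm_congr_ae e2
    _ ≤ ‖S‖ₑ * ‖h‖ₑ := S.le_opENorm h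
    _ ≤ _ := by gcongr

/-! ### Necessity of `η > 0`: the action on normalized kernels -/

theorem bergmanProjection_conj_mul_bergmanKernel {α : Fin n → ℝ} (hα : ∀ j, -1 < α j)
    {g : (Fin n → ℂ) → ℂ} (hg : DifferentiableOn ℂ g (polydisc n))
    (hgi : Integrable g (polydiscMeasure α)) {w z : Fin n → ℂ} (hw : w ∈ polydisc n)
    (hz : z ∈ polydisc n) :
    bergmanProjection α (fun ζ => conj (g ζ) * bergmanKernel α ζ w) z =
      conj (g w) * bergmanKernel α z w := by
  have hgK : DifferentiableOn ℂ (fun ζ => g ζ * bergmanKernel α ζ z) (polydisc n) :=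
    hg.mul (differentiableOn_bergmanKernel α hz)
  have hgKi : Integrable (fun ζ => g ζ * bergmanKernel α ζ z) (polydiscMeasure α) := by
    refine hgi.mul_bdd (c := kernelBound α fun j => ‖z j‖)
      (integrable_bergmanKernel hα hz).aestronglyMeasurable ?_
    filter_upwards [ae_norm_bergmanKernel_le hα hz] with ζ hζ
    rwa [norm_bergmanKernel_comm]
  -- Kernels are eigenfunctions of `T_ḡ`: this is the conjugate of the reproducing formula for `g
  -- K(·,z)` at `w`.
  have h1 := congrArg conj (bergmanProjection_eq_self hα hgK hgKi hw)
  rw [bergmanProjection, ← integral_conj, map_mul, conj_bergmanKernel α hw hz] at h1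
  rw [← h1]
  refine integral_congr_ae ?_
  filter_upwards [ae_mem_polydisc α] with ζ hζ
  rw [map_mul, map_mul, conj_bergmanKernel α hζ hz, conj_bergmanKernel α hw hζ]
  ring

theorem bergmanProjection_conj_mul_normalizedKernel {α : Fin n → ℝ} (hα : ∀ j, -1 < α j)
    {g : (Fin n → ℂ) → ℂ} (hg : DifferentiableOn ℂ g (polydisc n))
    (hgi : Integrable g (polydiscMeasure α)) {w z : Fin n → ℂ} (hw : w ∈ polydisc n)
    (hz : z ∈ polydisc n) :
    bergmanProjection α (fun ζ => conj (g ζ) * normalizedKernel α w ζ) z =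
      conj (g w) * normalizedKernel α w z := by
  rw [normalizedKernel, mul_div_assoc', ← bergmanProjection_conj_mul_bergmanKernel hα hg hgi hw hz,
    div_eq_inv_mul, ← bergmanProjection_const_mul]
  congr 1
  funext ζ
  rw [normalizedKernel]
  ring

theorem differentiableOn_normalizedKernel (α : Fin n → ℝ) {w : Fin n → ℂ} (hw : w ∈ polydisc n) :
    DifferentiableOn ℂ (normalizedKernel α w) (polydisc n) := by
  have h := (differentiableOn_bergmanKernel α hw).mul_const
    ((bergmanNorm α 2 fun ζ => bergmanKernel α ζ w).toReal : ℂ)⁻¹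
  simpa only [normalizedKernel, div_eq_mul_inv] using! h

theorem exists_norm_normalizedKernel_le {α : Fin n → ℝ} (hα : ∀ j, -1 < α j) {w : Fin n → ℂ}
    (hw : w ∈ polydisc n) :
    ∃ B : ℝ, ∀ᵐ z ∂polydiscMeasure α, ‖normalizedKernel α w z‖ ≤ B := by
  refine ⟨(kernelBound α fun j => ‖w j‖) /
    ‖((bergmanNorm α 2 fun ζ => bergmanKernel α ζ w).toReal : ℂ)‖, ?_⟩
  filter_upwards [ae_norm_bergmanKernel_le hα hw] with z hz
  rw [normalizedKernel, norm_div, norm_bergmanKernel_comm]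
  gcongr

theorem exists_bergmanSpace_normalizedKernel {α : Fin n → ℝ} (hα : ∀ j, -1 < α j) {p : ℝ}
    {w : Fin n → ℂ} (hw : w ∈ polydisc n) :
    ∃ k : bergmanSpace α p, ((k : Lp ℂ (ENNReal.ofReal p) (polydiscMeasure α)) : (Fin n → ℂ) → ℂ)
      =ᵐ[polydiscMeasure α] normalizedKernel α w := by
  have := isProbabilityMeasure_polydiscMeasure hα
  obtain ⟨B, hB⟩ := exists_norm_normalizedKernel_le hα hw
  have hm : MemLp (normalizedKernel α w) (ENNReal.ofReal p) (polydiscMeasure α) :=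
    MemLp.of_bound (measurable_normalizedKernel α w).aestronglyMeasurable B hB
  exact ⟨⟨hm.toLp _, _, differentiableOn_normalizedKernel α hw, hm.coeFn_toLp⟩, hm.coeFn_toLp⟩

/-- Both values at `w` are given by the same reproducing integral. Point evaluation is thus
legitimate for identities between classes. -/
theorem eq_of_ae_eq {α : Fin n → ℝ} (hα : ∀ j, -1 < α j) {F G : (Fin n → ℂ) → ℂ}
    (hF : DifferentiableOn ℂ F (polydisc n)) (hG : DifferentiableOn ℂ G (polydisc n))
    (hi : Integrable F (polydiscMeasure α)) (h : F =ᵐ[polydiscMeasure α] G) {w : Fin n → ℂ}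
    (hw : w ∈ polydisc n) : F w = G w := by
  rw [← bergmanProjection_eq_self hα hF hi hw, ← bergmanProjection_eq_self hα hG (hi.congr h) hw,
    bergmanProjection_congr_ae h]

theorem enorm_bergmanKernel_eq {α : Fin n → ℝ} (hα : ∀ j, -1 < α j) {w : Fin n → ℂ}
    (hw : w ∈ polydisc n) (z : Fin n → ℂ) : ‖bergmanKernel α w z‖ₑ =
      ENNReal.ofReal (Real.sqrt (diagKernel α w)) * ‖normalizedKernel α w z‖ₑ := by
  have hd : 0 < Real.sqrt (diagKernel α w) := Real.sqrt_pos.2 (diagKernel_pos α hw)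
  rw [← ofReal_norm, ← ofReal_norm, ← ENNReal.ofReal_mul hd.le, norm_bergmanKernel_comm,
    normalizedKernel_eq hα hw, norm_div, Complex.norm_real, Real.norm_of_nonneg hd.le,
    mul_div_cancel₀ _ hd.ne']

theorem enorm_normalizedKernel_self {α : Fin n → ℝ} (hα : ∀ j, -1 < α j) {w : Fin n → ℂ}
    (hw : w ∈ polydisc n) :
    ‖normalizedKernel α w w‖ₑ = ENNReal.ofReal (Real.sqrt (diagKernel α w)) := by
  have hd := diagKernel_pos α hw
  rw [normalizedKernel_eq hα hw, bergmanKernel_self α hw, ← Complex.ofReal_div,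
    Real.div_sqrt, ← ofReal_norm, Complex.norm_real, Real.norm_of_nonneg (Real.sqrt_nonneg _)]

/-- An invertible Toeplitz product with `[f, g] < ∞` has `η > 0`. -/
theorem IsToeplitzProduct.infProd_pos {α : Fin n → ℝ} (hα : ∀ j, -1 < α j) {p q : ℝ}
    [Fact (1 < p)] (hpq : p.HolderConjugate q) {f g : (Fin n → ℂ) → ℂ} (hgm : Measurable g) (hf : MemBergman α p f)
    (hg : MemBergman α q g) {S : bergmanSpace α p →L[ℂ] bergmanSpace α p}
    (hS : IsToeplitzProduct α p f g S) (hunit : IsUnit S) (hs : sarason α p q f g < ∞) :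
    0 < infProd f g := by
  obtain ⟨C, hC⟩ := exists_bound_absProjection hpq hα
  have hap := hS.apply hα hpq hC hgm hf hg
  obtain ⟨R, hSR⟩ := hunit.exists_right_inv
  have hRS : R * S = 1 := by
    obtain ⟨R', hR'⟩ := hunit.exists_left_inv
    rwa [← left_inv_eq_right_inv hR' hSR]
  have hgi := MemLp.integrable_of_polydisc hα hpq.symm.lt hg.2
  have key : ∀ w ∈ polydisc n, 1 ≤ ‖R‖ₑ * ‖R‖ₑ * sarason α p q f g * (‖f w‖ₑ * ‖g w‖ₑ) := by
    intro w hw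
    obtain ⟨k, hk⟩ := exists_bergmanSpace_normalizedKernel hα (p := p) hw
    have hkm := measurable_normalizedKernel α w
    have hki : Integrable (normalizedKernel α w) (polydiscMeasure α) :=
      MemLp.integrable_of_polydisc hα hpq.lt ((Lp.memLp _).ae_eq hk)
    -- From `k_w = R S k_w` and `S k_w = conj g(w) f k_w`.
    have hkn : ‖k‖ₑ ≤ ‖R‖ₑ * (‖g w‖ₑ * bergmanNorm α p fun z => f z * normalizedKernel α w z) := by
      have h1 : k = R (S k) := by
        exact (congrArg (fun T : bergmanSpace α p →L[ℂ] bergmanSpace α p => T k) hRS).symm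
      rw [h1]
      refine (R.le_opENorm _).trans ?_
      gcongr
      rw [← bergmanNorm_coe, show bergmanNorm α p _ = _ from eLpNorm_congr_ae (hap k)]
      refine bergmanNorm_le_mul hpq.pos enorm_ne_top fun z hz => ?_
      have e1 : (fun z => conj (g z) * (k : Lp ℂ (ENNReal.ofReal p) (polydiscMeasure α)) z)
          =ᵐ[polydiscMeasure α] fun z => conj (g z) * normalizedKernel α w z := by
        filter_upwards [hk] with z hz
        rw [hz]
      rw [bergmanProjection_congr_ae e1, bergmanProjection_conj_mul_normalizedKernel hα hg.1 hgi hw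
        hz, enorm_mul, enorm_mul, enorm_mul, enorm_conj_apply]
      exact le_of_eq (by ring)
    have hd : 0 < Real.sqrt (diagKernel α w) := Real.sqrt_pos.2 (diagKernel_pos α hw)
    have hkR : S (R k) = k :=
      congrArg (fun T : bergmanSpace α p →L[ℂ] bergmanSpace α p => T k) hSR
    have h2 := hap (R k)
    rw [hkR] at h2
    have hgR := integrable_conj_mul hpq hg.2 (Lp.memLp
      (R k : Lp ℂ (ENNReal.ofReal p) (polydiscMeasure α)))
    -- The other identity, `k_w = S R k_w = f P(ḡ R k_w)`, is evaluated at `w`.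
    have h3 := congrArg (‖·‖ₑ) (eq_of_ae_eq hα (differentiableOn_normalizedKernel α hw)
      (hf.1.mul (differentiableOn_bergmanProjection hα hgR)) hki (hk.symm.trans h2) hw)
    simp only [Pi.mul_apply] at h3
    rw [enorm_normalizedKernel_self hα hw, enorm_mul] at h3
    have h4 : absProjection α (fun z => conj (g z) *
        (R k : Lp ℂ (ENNReal.ofReal p) (polydiscMeasure α)) z) w ≤
        ENNReal.ofReal (Real.sqrt (diagKernel α w)) *
          (‖R k‖ₑ * bergmanNorm α q fun z => g z * normalizedKernel α w z) := by
      rw [← bergmanNorm_coe]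
      refine le_trans (le_of_eq ?_) (mul_le_mul_right (lintegral_mul_le_bergmanNorm hpq
        (measurable_coe_bergmanSpace (R k)).aestronglyMeasurable
        (hgm.mul hkm).aestronglyMeasurable) _)
      rw [← lintegral_const_mul' _ _ ENNReal.ofReal_ne_top]
      refine lintegral_congr fun z => ?_
      rw [enorm_bergmanKernel_eq hα hw, enorm_mul, enorm_conj_apply, Pi.mul_apply, enorm_mul]
      ring
    -- `d = K(w,w)^(1/2)` occurs on both sides, as `k_w(w)` and as the ratio `|K(w,z)| / |k_w(z)|`,
    -- and cancels.
    set d := ENNReal.ofReal (Real.sqrt (diagKernel α w)) with hd'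
    have hd0 : d ≠ 0 := by rw [hd']; simpa using diagKernel_pos α hw
    have hdt : d ≠ ∞ := ENNReal.ofReal_ne_top
    have h5 : d * 1 ≤ d * (‖R‖ₑ * ‖R‖ₑ * sarason α p q f g * (‖f w‖ₑ * ‖g w‖ₑ)) := by
      rw [mul_one]
      calc d ≤ ‖f w‖ₑ * (d * (‖R k‖ₑ * bergmanNorm α q fun z => g z * normalizedKernel α w z)) := by
            refine h3.trans_le ?_
            gcongr
            exact (enorm_bergmanProjection_le _ _ _).trans h4
        _ ≤ ‖f w‖ₑ * (d * ((‖R‖ₑ * (‖R‖ₑ * (‖g w‖ₑ *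
              bergmanNorm α p fun z => f z * normalizedKernel α w z))) *
              bergmanNorm α q fun z => g z * normalizedKernel α w z)) := by
            gcongr
            exact (R.le_opENorm k).trans (by gcongr)
        _ = d * (‖R‖ₑ * ‖R‖ₑ * ((bergmanNorm α p fun z => f z * normalizedKernel α w z) *
              bergmanNorm α q fun z => g z * normalizedKernel α w z) * (‖f w‖ₑ * ‖g w‖ₑ)) := by
            ring
        _ ≤ _ := by gcongr; exact bergmanNorm_mul_le_sarason f g hw
    exact (ENNReal.mul_le_mul_iff_right hd0 hdt).1 h5
  have hfin : ‖R‖ₑ * ‖R‖ₑ * sarason α p q f g ≠ ∞ :=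
    ENNReal.mul_ne_top (ENNReal.mul_ne_top enorm_ne_top enorm_ne_top) hs.ne
  refine lt_of_lt_of_le (ENNReal.inv_pos.2 hfin) (le_iInf₂ fun w hw => ?_)
  rw [← one_div]
  exact ENNReal.div_le_of_le_mul' (key w hw)

/-! ### Necessity of `[f, g] < ∞`: binomial expansion of the rank-one kernel -/

/-- The coefficients of `(1 - x) ^ s`. -/
def binomialCoeff (s : ℝ) (k : ℕ) : ℂ := Ring.choose (s : ℂ) k * (-1) ^ k

theorem hasSum_binomialCoeff (s : ℝ) {x : ℂ} (hx : ‖x‖ < 1) :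
    HasSum (fun k => binomialCoeff s k * x ^ k) ((1 - x) ^ (s : ℂ)) := by
  have h := (Complex.one_add_cpow_hasFPowerSeriesOnBall_zero (a := (s : ℂ))).hasSum (y := -x)
    (by
      rw [Metric.mem_eball, edist_zero_right, enorm_neg, ← ofReal_norm, ← ENNReal.ofReal_one]
      exact (ENNReal.ofReal_lt_ofReal_iff one_pos).2 hx)
  simp only [binomialSeries_apply, List.ofFn_const, List.prod_replicate, smul_eq_mul] at h
  rw [zero_add, ← sub_eq_add_neg] at h
  refine h.congr_fun fun k => ?_
  rw [binomialCoeff, neg_pow]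
  ring

theorem binomialCoeff_succ (s : ℝ) (k : ℕ) :
    ((k : ℂ) + 1) * binomialCoeff s (k + 1) = -(binomialCoeff s k * (s - k)) := by
  have h := Ring.choose_smul_choose (s : ℂ) (Nat.le_succ k)
  rw [Nat.succ_eq_add_one, Nat.add_sub_cancel_left, Ring.choose_one_right, nsmul_eq_mul,
    Nat.choose_succ_self_right] at h
  push_cast at h
  rw [binomialCoeff, binomialCoeff, ← mul_assoc, h]
  ring

/-- Once `k ≥ s`, the recursion reads `s |c_k| = k |c_k| - (k+1) |c_(k+1)|`, which telescopes;
division by `s` is where `s > 0` enters. -/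
theorem summable_norm_binomialCoeff {s : ℝ} (hs : 0 < s) :
    Summable fun k => ‖binomialCoeff s k‖ := by
  obtain ⟨N, hN⟩ := exists_nat_ge s
  refine (summable_nat_add_iff N).1 ?_
  refine summable_of_sum_range_le (c := N * ‖binomialCoeff s N‖ / s) (fun _ => norm_nonneg _)
    fun M => ?_
  rw [le_div_iff₀' hs, Finset.mul_sum]
  have h1 : ∀ k, s * ‖binomialCoeff s (k + N)‖ = (k + N : ℕ) * ‖binomialCoeff s (k + N)‖ -
      (k + 1 + N : ℕ) * ‖binomialCoeff s (k + 1 + N)‖ := fun k => by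
    have h2 := congrArg norm (binomialCoeff_succ s (k + N))
    have h3 : ‖(s : ℂ) - (k + N : ℕ)‖ = (k + N : ℕ) - s := by
      rw [← Complex.ofReal_natCast, ← Complex.ofReal_sub, Complex.norm_real, Real.norm_eq_abs,
        abs_sub_comm, abs_of_nonneg]
      have : (N : ℝ) ≤ (k + N : ℕ) := by push_cast; linarith [k.cast_nonneg (α := ℝ)]
      linarith
    have h4 : ‖((k + N : ℕ) : ℂ) + 1‖ = (k + 1 + N : ℕ) := by
      rw [← Nat.cast_add_one, Complex.norm_natCast]
      push_cast
      ring
    rw [norm_neg, norm_mul, norm_mul, h3, h4] at h2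
    rw [add_right_comm k 1 N] at h2 ⊢
    rw [h2]
    ring
  simp only [h1]
  rw [Finset.sum_range_sub' (fun k => ((k + N : ℕ) : ℝ) * ‖binomialCoeff s (k + N)‖)]
  rw [zero_add]
  have : 0 ≤ ((M + N : ℕ) : ℝ) * ‖binomialCoeff s (M + N)‖ := by positivity
  linarith

/-- The `(a+2)`-th power of the Möbius identity. Its factors separate `z` from `u` once `K(z,u)` is
taken to the left, which makes the normalized kernels appear. -/
theorem one_sub_discInvolution_mul_conj_cpow (a : ℝ) {w z u : ℂ} (hw : ‖w‖ < 1) (hz : ‖z‖ < 1)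
    (hu : ‖u‖ < 1) :
    (1 - discInvolution w z * conj (discInvolution w u)) ^ ((a + 2 : ℝ) : ℂ) * discKernel a z u *
      discKernel a w w = discKernel a z w * conj (discKernel a u w) := by
  have h := one_sub_discInvolution_mul hw hz hu
  have hXr := one_sub_mul_conj_re_pos (norm_discInvolution_lt_one hw hz)
    (norm_discInvolution_lt_one hw hu)
  have hYr := one_sub_mul_conj_re_pos hz hw
  have hZr := one_sub_mul_conj_re_pos hw hu
  have hTr := one_sub_mul_conj_re_pos hz hu
  have hY0 := one_sub_mul_conj_ne_zero hz hw
  have hZ0 := one_sub_mul_conj_ne_zero hw hu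
  have hT0 := one_sub_mul_conj_ne_zero hz hu
  have hρ := one_sub_norm_sq_pos hw
  have hww : (1 : ℂ) - w * conj w = ((1 - ‖w‖ ^ 2 : ℝ) : ℂ) := by
    rw [Complex.mul_conj, Complex.normSq_eq_norm_sq]
    push_cast
    rfl
  rw [conj_discKernel a hu hw]
  simp only [discKernel]
  rw [hww]
  set X := 1 - discInvolution w z * conj (discInvolution w u)
  set Y := 1 - z * conj w
  set Z := 1 - w * conj u
  set T := 1 - z * conj u
  set ρ := 1 - ‖w‖ ^ 2
  set s := ((a + 2 : ℝ) : ℂ)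
  have hρr : 0 < (ρ : ℂ).re := by simpa using hρ
  have hρ0 : (ρ : ℂ) ≠ 0 := by exact_mod_cast hρ.ne'
  have hρT : 0 < ((ρ : ℂ) * T).re := by
    rw [Complex.re_ofReal_mul]
    exact mul_pos hρ hTr
  -- Moving only `Y` across makes each side a product of two factors with positive real part, so the
  -- principal powers multiply.
  have h1 : X * Y = ρ * T * Z⁻¹ := by
    rw [h]
    field_simp
  have h2 : X ^ s * Y ^ s = ρ ^ s * T ^ s * (Z ^ s)⁻¹ := by
    rw [← mul_cpow_of_re_pos hXr hYr, h1, mul_cpow_of_re_pos hρT (inv_re_pos hZr),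
      mul_cpow_of_re_pos hρr hTr, Complex.inv_cpow _ _ (arg_ne_pi_of_re_pos hZr)]
  have hne : ∀ {x : ℂ}, x ≠ 0 → x ^ s ≠ 0 := fun {x} hx h0 => hx ((Complex.cpow_eq_zero_iff _ _).1 h0).1
  have e1 := hne hY0
  have e2 := hne hZ0
  have e3 := hne hT0
  have e4 := hne hρ0
  rw [eq_mul_inv_iff_mul_eq₀ e2] at h2
  field_simp
  linear_combination h2

theorem hasSum_prod_binomialCoeff (a : ℝ) {w z u : ℂ} (hw : ‖w‖ < 1) (hz : ‖z‖ < 1)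
    (hu : ‖u‖ < 1) :
    HasSum (fun k => binomialCoeff (a + 2) k *
      (discInvolution w z * conj (discInvolution w u)) ^ k)
      ((1 - discInvolution w z * conj (discInvolution w u)) ^ ((a + 2 : ℝ) : ℂ)) := by
  refine hasSum_binomialCoeff _ ?_
  rw [norm_mul, Complex.norm_conj]
  exact mul_lt_one_of_nonneg_of_lt_one_left (norm_nonneg _) (norm_discInvolution_lt_one hw hz)
    (norm_discInvolution_lt_one hw hu).le

/-- The monomials in the coordinates of the automorphism of the polydisc attached to `w`. -/
def involutionPow (w : Fin n → ℂ) (κ : Fin n → ℕ) (z : Fin n → ℂ) : ℂ :=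
  ∏ j, discInvolution (w j) (z j) ^ κ j

theorem measurable_involutionPow (w : Fin n → ℂ) (κ : Fin n → ℕ) :
    Measurable (involutionPow w κ) := by
  unfold involutionPow discInvolution
  exact Finset.measurable_fun_prod _ fun j _ => by fun_prop

theorem enorm_involutionPow_le {w : Fin n → ℂ} (hw : w ∈ polydisc n) (κ : Fin n → ℕ)
    {z : Fin n → ℂ} (hz : z ∈ polydisc n) : ‖involutionPow w κ z‖ₑ ≤ 1 := by
  rw [← ofReal_norm, ← ENNReal.ofReal_one]
  refine ENNReal.ofReal_le_ofReal ?_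
  rw [involutionPow, norm_prod]
  refine Finset.prod_le_one (fun _ _ => norm_nonneg _) fun j _ => ?_
  rw [norm_pow]
  exact pow_le_one₀ (norm_nonneg _) (norm_discInvolution_lt_one (hw j) (hz j)).le

/-- The product of the sums of the moduli of the coefficients of `(1 - x) ^ (αⱼ + 2)`. -/
def coeffSum (α : Fin n → ℝ) : ℝ≥0∞ := ∏ j, ∑' k, ‖binomialCoeff (α j + 2) k‖ₑ

theorem coeffSum_ne_top {α : Fin n → ℝ} (hα : ∀ j, -1 < α j) : coeffSum α ≠ ∞ := by
  refine ENNReal.prod_ne_top fun j _ => ?_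
  have h := summable_norm_binomialCoeff (s := α j + 2) (by linarith [hα j])
  simp only [← ofReal_norm]
  exact h.tsum_ofReal_ne_top

theorem sum_coeff_le (α : Fin n → ℝ) (N : ℕ) :
    ∑ κ ∈ Fintype.piFinset fun _ : Fin n => Finset.range N,
      ‖∏ j, binomialCoeff (α j + 2) (κ j)‖ₑ ≤ coeffSum α := by
  have h : ∀ κ : Fin n → ℕ, ‖∏ j, binomialCoeff (α j + 2) (κ j)‖ₑ =
      ∏ j, ‖binomialCoeff (α j + 2) (κ j)‖ₑ := fun κ => by
    simp only [← ofReal_norm, norm_prod]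
    exact ENNReal.ofReal_prod_of_nonneg fun _ _ => norm_nonneg _
  simp only [h]
  rw [← Finset.prod_univ_sum (fun _ : Fin n => Finset.range N)
    fun j k => ‖binomialCoeff (α j + 2) k‖ₑ]
  exact Finset.prod_le_prod' fun j _ => ENNReal.sum_le_tsum _

/-- The truncations of the series of `∏ⱼ (1 - φⱼ(z) conj φⱼ(ζ)) ^ (αⱼ + 2)`. -/
def truncatedProduct (α : Fin n → ℝ) (w : Fin n → ℂ) (N : ℕ) (z ζ : Fin n → ℂ) : ℂ :=
  ∑ κ ∈ Fintype.piFinset fun _ : Fin n => Finset.range N,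
    (∏ j, binomialCoeff (α j + 2) (κ j)) * (involutionPow w κ z * conj (involutionPow w κ ζ))

theorem truncatedProduct_eq (α : Fin n → ℝ) (w : Fin n → ℂ) (N : ℕ) (z ζ : Fin n → ℂ) :
    truncatedProduct α w N z ζ = ∏ j, ∑ k ∈ Finset.range N, binomialCoeff (α j + 2) k *
      (discInvolution (w j) (z j) * conj (discInvolution (w j) (ζ j))) ^ k := by
  rw [Finset.prod_univ_sum, truncatedProduct]
  refine Finset.sum_congr rfl fun κ _ => ?_
  rw [Finset.prod_mul_distrib, involutionPow, involutionPow, map_prod, ← Finset.prod_mul_distrib]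
  simp only [map_pow, mul_pow]

theorem enorm_truncatedProduct_le (α : Fin n → ℝ) {w : Fin n → ℂ} (hw : w ∈ polydisc n) (N : ℕ)
    {z ζ : Fin n → ℂ} (hz : z ∈ polydisc n) (hζ : ζ ∈ polydisc n) :
    ‖truncatedProduct α w N z ζ‖ₑ ≤ coeffSum α := by
  refine (enorm_sum_le _ _).trans (le_trans (Finset.sum_le_sum fun κ _ => ?_) (sum_coeff_le α N))
  rw [enorm_mul, enorm_mul, enorm_conj_apply]
  exact mul_le_of_le_one_right' (mul_le_one' (enorm_involutionPow_le hw κ hz)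
    (enorm_involutionPow_le hw κ hζ))

theorem tendsto_truncatedProduct {α : Fin n → ℝ} (hα : ∀ j, -1 < α j) {w z ζ : Fin n → ℂ}
    (hw : w ∈ polydisc n) (hz : z ∈ polydisc n) (hζ : ζ ∈ polydisc n) :
    Filter.Tendsto (fun N => truncatedProduct α w N z ζ * bergmanKernel α z ζ) Filter.atTop
      (nhds (normalizedKernel α w z * conj (normalizedKernel α w ζ))) := by
  have h : normalizedKernel α w z * conj (normalizedKernel α w ζ) =
      (∏ j, (1 - discInvolution (w j) (z j) * conj (discInvolution (w j) (ζ j))) ^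
        ((α j + 2 : ℝ) : ℂ)) * bergmanKernel α z ζ := by
    have hd := diagKernel_pos α hw
    have hd0 : (diagKernel α w : ℂ) ≠ 0 := by exact_mod_cast hd.ne'
    have hs : ((Real.sqrt (diagKernel α w) : ℝ) : ℂ) * (Real.sqrt (diagKernel α w) : ℝ) =
        diagKernel α w := by
      rw [← Complex.ofReal_mul, Real.mul_self_sqrt hd.le]
    rw [normalizedKernel_eq hα hw, normalizedKernel_eq hα hw, map_div₀, Complex.conj_ofReal,
      div_mul_div_comm, hs, div_eq_iff hd0, ← bergmanKernel_self α hw]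
    simp only [bergmanKernel_eq_prod]
    rw [map_prod, ← Finset.prod_mul_distrib, ← Finset.prod_mul_distrib, ← Finset.prod_mul_distrib]
    exact Finset.prod_congr rfl fun j _ =>
      (one_sub_discInvolution_mul_conj_cpow (α j) (hw j) (hz j) (hζ j)).symm
  rw [h]
  refine Filter.Tendsto.mul_const _ ?_
  simp only [truncatedProduct_eq]
  exact tendsto_finsetProd _ fun j _ =>
    (hasSum_prod_binomialCoeff (α j) (hw j) (hz j) (hζ j)).tendsto_sum_nat

/-- The rank-one operator `u ↦ ⟨u, g k_w⟩ f k_w` is the sum over `κ` of `c_κ φ^κ · S P (conj φ^κ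
u)`. Each `|φ^κ| ≤ 1`, so the norms are bounded by `∑ |c_κ|` times that of `S P`, uniformly in `w`.
-/
theorem IsToeplitzProduct.bergmanNorm_mul_integral_le {α : Fin n → ℝ} (hα : ∀ j, -1 < α j)
    {p q : ℝ} [Fact (1 < p)] (hpq : p.HolderConjugate q)
    {C : ℝ≥0} (hC : ∀ u : (Fin n → ℂ) → ℂ, Measurable u →
      (∫⁻ z, absProjection α u z ^ p ∂polydiscMeasure α) ^ (1 / p) ≤ C * bergmanNorm α p u)
    {f g : (Fin n → ℂ) → ℂ} (hgm : Measurable g) (hf : MemBergman α p f)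
    (hg : MemBergman α q g) {S : bergmanSpace α p →L[ℂ] bergmanSpace α p}
    (hS : IsToeplitzProduct α p f g S) {u : (Fin n → ℂ) → ℂ} (hu : Measurable u)
    (hu' : MemLp u (ENNReal.ofReal p) (polydiscMeasure α)) {w : Fin n → ℂ} (hw : w ∈ polydisc n) :
    ‖∫ ζ, conj (g ζ) * u ζ * conj (normalizedKernel α w ζ) ∂polydiscMeasure α‖ₑ *
      bergmanNorm α p (fun z => f z * normalizedKernel α w z) ≤
      coeffSum α * (‖S‖ₑ * (C * bergmanNorm α p u)) := by
  have hp1 : 1 < p := hpq.lt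
  have hcs := coeffSum_ne_top hα
  have hgu := integrable_conj_mul hpq hg.2 hu'
  set I := ∫ ζ, conj (g ζ) * u ζ * conj (normalizedKernel α w ζ) ∂polydiscMeasure α with hI
  obtain ⟨v, hv⟩ : ∃ v : (Fin n → ℕ) → (Fin n → ℂ) → ℂ,
    ∀ κ ζ, v κ ζ = conj (involutionPow w κ ζ) * u ζ := ⟨_, fun _ _ => rfl⟩
  have hvm : ∀ κ, Measurable (v κ) := fun κ => by
    rw [funext (hv κ)]
    exact (Complex.continuous_conj.measurable.comp (measurable_involutionPow w κ)).mul hu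
  have hvle : ∀ κ, ∀ z ∈ polydisc n, ‖v κ z‖ₑ ≤ 1 * ‖u z‖ₑ := fun κ z hz => by
    rw [hv, enorm_mul, enorm_conj_apply]
    gcongr
    exact enorm_involutionPow_le hw κ hz
  have hvn : ∀ κ, bergmanNorm α p (v κ) ≤ bergmanNorm α p u := fun κ => by
    have := bergmanNorm_le_mul (α := α) hpq.pos ENNReal.one_ne_top (hvle κ)
    rwa [one_mul] at this
  have hvp : ∀ κ, MemLp (v κ) (ENNReal.ofReal p) (polydiscMeasure α) := fun κ =>
    ⟨(hvm κ).aestronglyMeasurable, (hvn κ).trans_lt hu'.2⟩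
  have hvi := fun κ => integrable_conj_mul hpq hg.2 (hvp κ)
  obtain ⟨F, hF⟩ : ∃ F : (Fin n → ℕ) → (Fin n → ℂ) → ℂ, ∀ κ z, F κ z =
    f z * bergmanProjection α (fun ζ => conj (g ζ) * v κ ζ) z := ⟨_, fun _ _ => rfl⟩
  have hFd : ∀ κ, DifferentiableOn ℂ (F κ) (polydisc n) := fun κ => by
    rw [funext (hF κ)]
    exact hf.1.mul (differentiableOn_bergmanProjection hα (hvi κ))
  have hFn : ∀ κ, bergmanNorm α p (F κ) ≤ ‖S‖ₑ * (C * bergmanNorm α p u) := fun κ => by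
    rw [funext (hF κ)]
    refine (hS.bergmanNorm_le hα hpq hC hgm hf hg (hvm κ) (hvp κ)).trans ?_
    gcongr
    exact hvn κ
  obtain ⟨G, hG⟩ : ∃ G : (Fin n → ℕ) → (Fin n → ℂ) → ℂ, ∀ κ z, G κ z =
    (∏ j, binomialCoeff (α j + 2) (κ j)) * involutionPow w κ z * F κ z := ⟨_, fun _ _ => rfl⟩
  have hGm : ∀ κ, AEStronglyMeasurable (G κ) (polydiscMeasure α) := fun κ => by
    rw [funext (hG κ)]
    exact ((measurable_involutionPow w κ).aestronglyMeasurable.const_mul _).mul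
      (aestronglyMeasurable_of_differentiableOn α (hFd κ))
  have hGn : ∀ κ, bergmanNorm α p (G κ) ≤
      ‖∏ j, binomialCoeff (α j + 2) (κ j)‖ₑ * (‖S‖ₑ * (C * bergmanNorm α p u)) := fun κ => by
    refine le_trans (bergmanNorm_le_mul hpq.pos enorm_ne_top fun z hz => ?_)
      (mul_le_mul_right (hFn κ) _)
    rw [hG, enorm_mul, enorm_mul]
    gcongr
    exact mul_le_of_le_one_right' (enorm_involutionPow_le hw κ hz)
  obtain ⟨D, hD⟩ : ∃ D : ℕ → (Fin n → ℂ) → ℂ, ∀ N, D N =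
    ∑ κ ∈ Fintype.piFinset fun _ : Fin n => Finset.range N, G κ := ⟨_, fun _ => rfl⟩
  have hDm : ∀ N, AEStronglyMeasurable (D N) (polydiscMeasure α) := fun N => by
    rw [hD]
    exact Finset.aestronglyMeasurable_sum _ fun κ _ => hGm κ
  have hDn : ∀ N, bergmanNorm α p (D N) ≤ coeffSum α * (‖S‖ₑ * (C * bergmanNorm α p u)) := by
    intro N
    rw [hD]
    refine (eLpNorm_sum_le (fun κ _ => hGm κ) (ENNReal.one_le_ofReal.2 hp1.le)).trans ?_
    refine (Finset.sum_le_sum fun κ _ => hGn κ).trans ?_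
    rw [← Finset.sum_mul]
    gcongr
    exact sum_coeff_le α N
  -- A finite sum of terms `φ^κ S P conj φ^κ` has the truncated product times `K` as kernel;
  -- finiteness of the sum makes the exchange with the integral trivial.
  have hDz : ∀ N, ∀ z ∈ polydisc n, D N z = f z * ∫ ζ, conj (g ζ) * u ζ *
      (truncatedProduct α w N z ζ * bergmanKernel α z ζ) ∂polydiscMeasure α := by
    intro N z hz
    rw [hD, Finset.sum_apply]
    have h1 : ∀ ζ, conj (g ζ) * u ζ * (truncatedProduct α w N z ζ * bergmanKernel α z ζ) =
        ∑ κ ∈ Fintype.piFinset fun _ : Fin n => Finset.range N,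
          (∏ j, binomialCoeff (α j + 2) (κ j)) * involutionPow w κ z *
            (conj (g ζ) * v κ ζ * bergmanKernel α z ζ) := fun ζ => by
      rw [truncatedProduct, Finset.sum_mul, Finset.mul_sum]
      refine Finset.sum_congr rfl fun κ _ => ?_
      rw [hv]
      ring
    simp only [h1]
    rw [integral_finsetSum _ fun κ _ => (integrable_mul_bergmanKernel hα (hvi κ) hz).const_mul _,
      Finset.mul_sum]
    refine Finset.sum_congr rfl fun κ _ => ?_
    rw [hG, hF, bergmanProjection, integral_const_mul]
    ring
  have hlim : ∀ᵐ z ∂polydiscMeasure α, Filter.Tendsto (D · z) Filter.atTop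
      (nhds (I * (f z * normalizedKernel α w z))) := by
    filter_upwards [ae_mem_polydisc α] with z hz
    simp only [hDz _ z hz]
    have h1 : I * (f z * normalizedKernel α w z) = f z * ∫ ζ, conj (g ζ) * u ζ *
        (normalizedKernel α w z * conj (normalizedKernel α w ζ)) ∂polydiscMeasure α := by
      rw [hI, mul_comm, mul_assoc, ← integral_const_mul]
      congr 2
      funext ζ
      ring
    rw [h1]
    refine Filter.Tendsto.const_mul (f z) ?_
    refine tendsto_integral_of_dominated_convergence (fun ζ => (coeffSum α).toReal *
      ‖conj (g ζ) * u ζ * bergmanKernel α z ζ‖) (fun N => ?_)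
      ((integrable_mul_bergmanKernel hα hgu hz).norm.const_mul _) (fun N => ?_) ?_
    · have hm : Measurable fun ζ => truncatedProduct α w N z ζ * bergmanKernel α z ζ := by
        unfold truncatedProduct
        refine Measurable.mul (Finset.measurable_fun_sum _ fun κ _ => ?_) (by fun_prop)
        exact ((Complex.continuous_conj.measurable.comp
          (measurable_involutionPow w κ)).const_mul _).const_mul _
      exact hgu.aestronglyMeasurable.mul hm.aestronglyMeasurable
    · filter_upwards [ae_mem_polydisc α] with ζ hζ
      have h2 := ENNReal.toReal_mono hcs (enorm_truncatedProduct_le α hw N hz hζ)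
      rw [toReal_enorm] at h2
      simp only [norm_mul]
      rw [mul_left_comm]
      gcongr
    · filter_upwards [ae_mem_polydisc α] with ζ hζ
      exact (tendsto_truncatedProduct hα hw hz hζ).const_mul _
  -- Pointwise convergence and Fatou suffice; convergence of the series in operator norm is not
  -- needed.
  have hfin := Lp.eLpNorm_le_of_ae_tendsto (p := ENNReal.ofReal p) (.of_forall hDn) hDm hlim
  refine le_trans (le_of_eq ?_) hfin
  change _ = bergmanNorm α p _
  rw [bergmanNorm_eq α hpq.pos, bergmanNorm_eq α hpq.pos]
  simp only [enorm_mul I, ENNReal.mul_rpow_of_nonneg _ _ hpq.nonneg]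
  rw [lintegral_const_mul' _ _ (ENNReal.rpow_ne_top_of_nonneg hpq.nonneg enorm_ne_top),
    ENNReal.mul_rpow_of_nonneg _ _ hpq.one_div_nonneg, ← ENNReal.rpow_mul,
    mul_one_div_cancel hpq.pos.ne', ENNReal.rpow_one]

/-- The extremal function for the duality between `L^p` and `L^q`. -/
theorem exists_dual_function {α : Fin n → ℝ} {p q : ℝ} (hpq : p.HolderConjugate q)
    {G : (Fin n → ℂ) → ℂ} (hG : Measurable G)
    (hGq : MemLp G (ENNReal.ofReal q) (polydiscMeasure α)) :
    ∃ u : (Fin n → ℂ) → ℂ, Measurable u ∧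
      bergmanNorm α p u = (∫⁻ z, ‖G z‖ₑ ^ q ∂polydiscMeasure α) ^ (1 / p) ∧
      ‖∫ z, u z * conj (G z) ∂polydiscMeasure α‖ₑ = ∫⁻ z, ‖G z‖ₑ ^ q ∂polydiscMeasure α := by
  have hq := hpq.symm.pos
  have hq1 := hpq.symm.lt
  -- At zeros of `G` the factor `G z` makes the value `0`, whatever the sign of `q - 2`.
  refine ⟨fun z => ((‖G z‖ ^ (q - 2) : ℝ) : ℂ) * G z, ?_, ?_, ?_⟩
  · exact (Complex.measurable_ofReal.comp (hG.norm.pow_const _)).mul hG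
  · rw [bergmanNorm_eq α hpq.pos]
    congr 1
    refine lintegral_congr fun z => ?_
    have h1 : ‖((‖G z‖ ^ (q - 2) : ℝ) : ℂ) * G z‖ = ‖G z‖ ^ (q - 1) := by
      rw [norm_mul, Complex.norm_real, Real.norm_of_nonneg (by positivity)]
      rcases (norm_nonneg (G z)).eq_or_lt with h0 | h0
      · rw [← h0, mul_zero, Real.zero_rpow (by linarith)]
      · rw [← Real.rpow_add_one h0.ne']
        congr 1
        ring
    rw [← ofReal_norm, h1, ENNReal.ofReal_rpow_of_nonneg (by positivity) hpq.nonneg,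
      ← Real.rpow_mul (norm_nonneg _), ← ofReal_norm,
      ENNReal.ofReal_rpow_of_nonneg (norm_nonneg _) hq.le]
    congr 2
    have := hpq.symm.sub_one_mul_conj
    linarith
  · have h1 : ∀ z, ((‖G z‖ ^ (q - 2) : ℝ) : ℂ) * G z * conj (G z) = ((‖G z‖ ^ q : ℝ) : ℂ) := by
      intro z
      rw [mul_assoc, Complex.mul_conj, Complex.normSq_eq_norm_sq, ← Complex.ofReal_mul]
      congr 1
      rcases (norm_nonneg (G z)).eq_or_lt with h0 | h0
      · rw [← h0, Real.zero_rpow hq.ne']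
        simp
      · rw [← Real.rpow_two, ← Real.rpow_add h0]
        congr 1
        ring
    simp only [h1]
    have hi : Integrable (fun z => ‖G z‖ ^ q) (polydiscMeasure α) := by
      have := hGq.integrable_norm_rpow (by simpa using hq) ENNReal.ofReal_ne_top
      rwa [ENNReal.toReal_ofReal hq.le] at this
    rw [integral_complex_ofReal, ← ofReal_norm, Complex.norm_real, Real.norm_of_nonneg
      (integral_nonneg fun z => by positivity), ofReal_integral_eq_lintegral_ofReal hi
      (.of_forall fun z => by positivity)]
    refine lintegral_congr fun z => ?_
    rw [← ofReal_norm, ENNReal.ofReal_rpow_of_nonneg (norm_nonneg _) hq.le]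

/-- A bounded Toeplitz product has `[f, g] < ∞`. -/
theorem IsToeplitzProduct.sarason_lt_top {α : Fin n → ℝ} (hα : ∀ j, -1 < α j)
    {p q : ℝ} [Fact (1 < p)] (hpq : p.HolderConjugate q) {f g : (Fin n → ℂ) → ℂ}
    (hgm : Measurable g) (hf : MemBergman α p f) (hg : MemBergman α q g)
    {S : bergmanSpace α p →L[ℂ] bergmanSpace α p} (hS : IsToeplitzProduct α p f g S) :
    sarason α p q f g < ∞ := by
  obtain ⟨C, hC⟩ := exists_bound_absProjection hpq hα
  have hM : coeffSum α * (‖S‖ₑ * C) < ∞ := ENNReal.mul_lt_top (coeffSum_ne_top hα).lt_top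
    (ENNReal.mul_lt_top enorm_lt_top ENNReal.coe_lt_top)
  refine lt_of_le_of_lt (iSup₂_le fun w hw => ?_) hM
  have hkm := measurable_normalizedKernel α w
  obtain ⟨B, hB⟩ := exists_norm_normalizedKernel_le hα hw
  have hGm : Measurable fun z => g z * normalizedKernel α w z := hgm.mul hkm
  have hGq : MemLp (fun z => g z * normalizedKernel α w z) (ENNReal.ofReal q)
      (polydiscMeasure α) := by
    refine hg.2.of_le_mul (c := B) hGm.aestronglyMeasurable ?_
    filter_upwards [hB] with z hz
    rw [norm_mul, mul_comm]
    gcongr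
  -- For the function dual to `g k_w`, the rank-one bound reads `Q ‖f k_w‖ ≤ M Q^(1/p)`; cancelling
  -- `Q^(1/p)` leaves `‖f k_w‖ ‖g k_w‖ ≤ M` with `M` independent of `w`.
  obtain ⟨u, hu, hun, hui⟩ := exists_dual_function hpq hGm hGq
  set Q := ∫⁻ z, ‖g z * normalizedKernel α w z‖ₑ ^ q ∂polydiscMeasure α with hQ
  have hQn : bergmanNorm α q (fun z => g z * normalizedKernel α w z) = Q ^ (1 / q) :=
    bergmanNorm_eq α hpq.symm.pos _
  have hQt : Q ≠ ∞ := by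
    intro h
    have h1 : bergmanNorm α q (fun z => g z * normalizedKernel α w z) < ∞ := hGq.2
    rw [hQn, h, ENNReal.top_rpow_of_pos hpq.symm.one_div_pos] at h1
    exact lt_irrefl _ h1
  have hu' : MemLp u (ENNReal.ofReal p) (polydiscMeasure α) := by
    refine ⟨hu.aestronglyMeasurable, ?_⟩
    change bergmanNorm α p u < ∞
    rw [hun]
    exact (ENNReal.rpow_ne_top_of_nonneg hpq.one_div_nonneg hQt).lt_top
  have key := hS.bergmanNorm_mul_integral_le hα hpq hC hgm hf hg hu hu' hw
  have e1 : ∀ ζ, conj (g ζ) * u ζ * conj (normalizedKernel α w ζ) =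
      u ζ * conj (g ζ * normalizedKernel α w ζ) := fun ζ => by
    rw [map_mul]
    ring
  simp only [e1] at key
  rw [hui, hun] at key
  rw [hQn]
  rcases eq_or_ne Q 0 with h0 | h0
  · rw [h0, ENNReal.zero_rpow_of_pos hpq.symm.one_div_pos, mul_zero]
    exact zero_le
  · refine (ENNReal.mul_le_mul_iff_right (a := Q ^ (1 / p))
      (fun h => h0 ((ENNReal.rpow_eq_zero_iff_of_pos hpq.one_div_pos).1 h))
      (ENNReal.rpow_ne_top_of_nonneg hpq.one_div_nonneg hQt)).1 ?_
    calc Q ^ (1 / p) * (bergmanNorm α p (fun z => f z * normalizedKernel α w z) * Q ^ (1 / q))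
        = Q ^ (1 / p) * Q ^ (1 / q) * bergmanNorm α p (fun z => f z * normalizedKernel α w z) := by
          ring
      _ ≤ coeffSum α * (‖S‖ₑ * (C * Q ^ (1 / p))) := by
          rwa [HolderConjugate.rpow_mul_rpow hpq]
      _ = Q ^ (1 / p) * (coeffSum α * (‖S‖ₑ * C)) := by ring

/-! ### Independence of values off the polydisc, and the final assembly -/

theorem ae_eq_of_eqOn {f f' : (Fin n → ℂ) → ℂ} (h : Set.EqOn f f' (polydisc n)) (α : Fin n → ℝ) :
    f =ᵐ[polydiscMeasure α] f' := by
  filter_upwards [ae_mem_polydisc α] with z hz using h hz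

theorem MemBergman.congr {α : Fin n → ℝ} {p : ℝ} {f f' : (Fin n → ℂ) → ℂ}
    (hf : MemBergman α p f) (h : Set.EqOn f f' (polydisc n)) : MemBergman α p f' :=
  ⟨hf.1.congr fun _ hz => (h hz).symm, hf.2.ae_eq (ae_eq_of_eqOn h α)⟩

theorem sarason_congr {α : Fin n → ℝ} {p q : ℝ} {f f' g g' : (Fin n → ℂ) → ℂ}
    (hf : Set.EqOn f f' (polydisc n)) (hg : Set.EqOn g g' (polydisc n)) :
    sarason α p q f g = sarason α p q f' g' := by
  refine iSup_congr fun w => iSup_congr fun _ => ?_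
  refine congrArg₂ (· * ·) (eLpNorm_congr_ae ?_) (eLpNorm_congr_ae ?_)
  · exact ae_eq_of_eqOn (fun z hz => by simp only [hf hz]) α
  · exact ae_eq_of_eqOn (fun z hz => by simp only [hg hz]) α

theorem infProd_congr {f f' g g' : (Fin n → ℂ) → ℂ}
    (hf : Set.EqOn f f' (polydisc n)) (hg : Set.EqOn g g' (polydisc n)) :
    infProd f g = infProd f' g' :=
  iInf_congr fun z => iInf_congr fun hz => by rw [hf hz, hg hz]

theorem toeplitz_congr {α : Fin n → ℝ} {f f' : (Fin n → ℂ) → ℂ}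
    (hf : Set.EqOn f f' (polydisc n)) (u : (Fin n → ℂ) → ℂ) :
    toeplitz α f u = toeplitz α f' u :=
  bergmanProjection_congr_ae (ae_eq_of_eqOn (fun z hz => by simp only [hf hz]) α)

theorem toeplitzDefined_congr {α : Fin n → ℝ} {f f' : (Fin n → ℂ) → ℂ}
    (hf : Set.EqOn f f' (polydisc n)) (u : (Fin n → ℂ) → ℂ) :
    ToeplitzDefined α f u ↔ ToeplitzDefined α f' u :=
  integrable_congr (ae_eq_of_eqOn (fun z hz => by simp only [hf hz]) α)

theorem isToeplitzProduct_congr {α : Fin n → ℝ} {p : ℝ} [Fact (1 < p)]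
    {f f' g g' : (Fin n → ℂ) → ℂ} (hf : Set.EqOn f f' (polydisc n))
    (hg : Set.EqOn g g' (polydisc n)) (S : bergmanSpace α p →L[ℂ] bergmanSpace α p) :
    IsToeplitzProduct α p f g S ↔ IsToeplitzProduct α p f' g' S := by
  have hg' : Set.EqOn (fun z => conj (g z)) (fun z => conj (g' z)) (polydisc n) :=
    fun z hz => by simp only [hg hz]
  simp only [IsToeplitzProduct, toeplitz_congr hf, toeplitz_congr hg', toeplitzDefined_congr hf,
    toeplitzDefined_congr hg']

theorem holderConjugate_of_mul_eq_add {p q : ℝ} (hp : 1 < p) (h : p * q = p + q) :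
    p.HolderConjugate q := by
  have hq : q ≠ 0 := by
    rintro rfl
    linarith
  rw [Real.holderConjugate_iff]
  refine ⟨hp, ?_⟩
  have hp0 : p ≠ 0 := by linarith
  field_simp
  linarith

end

end PolydiscBergman

theorem mainTheorem2 {n : ℕ} (α : Fin n → ℝ) (hα : ∀ j, -1 < α j)
    (p q : ℝ) [Fact (1 < p)] (hpq : p * q = p + q) :
    ∃ C : ℝ≥0, ∀ f g : (Fin n → ℂ) → ℂ, MemBergman α p f → MemBergman α q g →
      ((∃ S : bergmanSpace α p →L[ℂ] bergmanSpace α p, IsToeplitzProduct α p f g S ∧ IsUnit S) →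
        sarason α p q f g < ∞ ∧ (sarason α p q f g < ∞ ↔ 0 < infProd f g)) ∧
      (sarason α p q f g < ∞ → 0 < infProd f g →
        invariantConst α p q f ≤ (infProd f g) ^ (-2 : ℝ) * (sarason α p q f g) ^ (2 : ℝ) ∧
        ∃ S : bergmanSpace α p →L[ℂ] bergmanSpace α p, IsToeplitzProduct α p f g S ∧ IsUnit S ∧
          ‖S‖ₑ ≤ C * (infProd f g) ^ (-(2 * n * max p q)) *
            (sarason α p q f g) ^ (1 + 2 * n * max p q)) := by
  have hpq' := holderConjugate_of_mul_eq_add Fact.out hpq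
  obtain ⟨C, hC⟩ := exists_invertible_toeplitzProduct hpq' hα
  refine ⟨C, fun f g hf hg => ?_⟩
  have hP : MeasurableSet (polydisc n) := isOpen_polydisc.measurableSet
  -- Nothing makes `f` and `g` measurable off the polydisc. Every quantity involved depends only on
  -- their values there, so both are replaced by their extensions by zero.
  have hfm := measurable_indicator_of_continuousOn hP hf.1.continuousOn
  have hgm := measurable_indicator_of_continuousOn hP hg.1.continuousOn
  have ef : Set.EqOn f ((polydisc n).indicator f) (polydisc n) :=
    fun z hz => (Set.indicator_of_mem hz f).symm
  have eg : Set.EqOn g ((polydisc n).indicator g) (polydisc n) :=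
    fun z hz => (Set.indicator_of_mem hz g).symm
  have hinv : invariantConst α p q f = invariantConst α p q ((polydisc n).indicator f) :=
    sarason_congr ef fun z hz => by simp only [← ef hz]
  rw [hinv]
  simp only [isToeplitzProduct_congr ef eg, sarason_congr (α := α) (p := p) (q := q) ef eg,
    infProd_congr ef eg]
  have hf' := hf.congr ef
  have hg' := hg.congr eg
  refine ⟨?_, fun hs hη => ⟨invariantConst_le_sq hα hpq' hfm hgm hη,
    hC _ _ hfm hgm hf' hg' hs hη⟩⟩
  rintro ⟨S, hS, hunit⟩
  have hs := hS.sarason_lt_top hα hpq' hgm hf' hg'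
  have hη := hS.infProd_pos hα hpq' hgm hf' hg' hunit hs
  exact ⟨hs, iff_of_true hs hη⟩
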